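/- \textbf{Distributions.} All (sub-)distributions have finite support; a sub-distribution $\gamma$ has mass $|\gamma|=\sum_o\gamma(o)\in(0,1]$, a distribution has mass $1$; $\delta_o$ is the point distribution at $o$. \textbf{Processes.} Fix sets of channels $c$, state variables, sensors $s$ and actuators $a$, and a set of values that contains $\mathbb R$. Processes are given by $$P,Q::= \mathsf{nil}\mid \mathsf{tick}.C\mid P\parallel Q\mid \lfloor \mathit{chn}.C\rfloor D\mid \mathit{phy}.C\mid \mathsf{if}\,(b)\,\{P\}\,\mathsf{else}\,\{Q\}\mid P\backslash c\mid X\mid \mathsf{fix}\,X.P,\qquad C,D::=\bigoplus_{i\in I}p_i{:}P_i,$$ where $\mathit{chn}$ is $\overline c\langle v\rangle$ (send) or $c(x)$ (receive), $\mathit{phy}$ is $s?(x)$ (read a sensor) or $a!v$ (write an actuator), $I$ is finite and non-empty, $p_i\in(0,1]$, $\sum_i p_i=1$; recursion is time-guarded (in $\mathsf{fix}\,X.P$ each occurrence of $X$ lies under some $\mathsf{tick}.\_$ or in the second component of some $\lfloor\_\rfloor\_$), and terms are taken up to $\alpha$-conversion. Put $[\![\bigoplus_i p_i{:}P_i]\!]=\sum_i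 p_i\delta_{P_i}$. The probabilistic transitions $P\xrightarrow{\lambda}\pi$, $\pi$ a distribution over processes, are generated by: $\lfloor\overline c\langle v\rangle.C\rfloor D\xrightarrow{\overline c v}[\![C]\!]$; $\lfloor c(x).C\rfloor D\xrightarrow{cv}[\![C\{v/x\}]\!]$ for every value $v$; $a!v.C\xrightarrow{a!v}[\![C]\!]$; $s?(x).C\xrightarrow{s?x}[\![C]\!]$; if $P_1\xrightarrow{\overline cv}\pi_1$ and $P_2\xrightarrow{cv}\pi_2$ then $P_1\parallel P_2\xrightarrow{\tau}\pi_1\parallel\pi_2$ (and symmetrically); if $P\xrightarrow{\lambda}\pi$ with $\lambda\ne\mathsf{tick}$ then $P\parallel Q\xrightarrow{\lambda}\pi\parallel\delta_Q$ (and symmetrically); if $P\xrightarrow{\lambda}\pi$ and $\lambda$ is not of the form $\overline cv$ or $cv$ then $P\backslash c\xrightarrow{\lambda}\pi\backslash c$; if $P\{\mathsf{fix}X.P/X\}\xrightarrow{\lambda}\pi$ then $\mathsf{fix}X.P\xrightarrow{\lambda}\pi$; a conditional has the transitions of the branch selected by its guard; $\mathsf{nil}\xrightarrow{\mathsf{tick}}\delta_{\mathsf{nil}}$;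 $\mathsf{tick}.C\xrightarrow{\mathsf{tick}}[\![C]\!]$; $\lfloor\mathit{chn}.C\rfloor D\xrightarrow{\mathsf{tick}}[\![D]\!]$; if $P_1\xrightarrow{\mathsf{tick}}\pi_1$, $P_2\xrightarrow{\mathsf{tick}}\pi_2$ and $P_1\parallel P_2$ has no $\tau$-transition then $P_1\parallel P_2\xrightarrow{\mathsf{tick}}\pi_1\parallel\pi_2$. \textbf{Systems.} A physical environment $E$ on sets $\mathsf X,\mathsf S,\mathsf A$ of state variables, sensors and actuators consists of maps $\mathit{evol}$, from $\mathbb R^{\mathsf X}\times\mathbb R^{\mathsf A}$ to distributions over $\mathbb R^{\mathsf X}$, and $\mathit{meas}$, from $\mathbb R^{\mathsf X}$ to distributions over $\mathbb R^{\mathsf S}$, and a set $\mathit{inv}\subseteq\mathbb R^{\mathsf X}$. A physical state is $S=\langle\xi_x,\xi_s,\xi_a\rangle\in\mathbb R^{\mathsf X}\times\mathbb R^{\mathsf S}\times\mathbb R^{\mathsf A}$. A cyber-physical system (CPS) is either the system $\mathsf{Dead}$, which has no transitions, or $M=E;S\bowtie P$ with $P$ a closed process that mentions only sensors in $\mathsf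 S$ and actuators in $\mathsf A$. Its transitions $M\xrightarrow{\alpha}\gamma$, with $\alpha\in\{\tau,\overline cv,cv,\mathsf{tick}\}$ and $\gamma$ a distribution over CPSs, are as follows ($E$ never changes and is omitted). If $\xi_x\notin\mathit{inv}$, the only transition is $M\xrightarrow{\tau}\delta_{\mathsf{Dead}}$. If $\xi_x\in\mathit{inv}$: $M\xrightarrow{\alpha}\delta_S\bowtie\pi$ whenever $P\xrightarrow{\alpha}\pi$ and $\alpha\neq\mathsf{tick}$; $M\xrightarrow{\tau}\delta_S\bowtie\pi\{\xi_s(s)/x\}$ whenever $P\xrightarrow{s?x}\pi$; $M\xrightarrow{\tau}\delta_{\langle\xi_x,\xi_s,\xi_a[a\mapsto v]\rangle}\bowtie\pi$ whenever $P\xrightarrow{a!v}\pi$ (values written on actuators are real; by convention, writing any other value leaves $\xi_a$ unchanged); and $M\xrightarrow{\mathsf{tick}}\mathit{next}_E(S)\bowtie\pi$ whenever $P\xrightarrow{\mathsf{tick}}\pi$ and $M$ has no $\tau$-transition, where $\mathit{next}_E(S)$ is the distribution of $\langle\xi_x',\xi_s',\xi_a\rangle$ with $\xi_x'$ drawn from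 $\mathit{evol}(\xi_x,\xi_a)$ and then $\xi_s'$ drawn from $\mathit{meas}(\xi_x')$. \textbf{Weak transitions.} Let $M\xrightarrow{\hat\tau}\gamma$ mean $M\xrightarrow{\tau}\gamma$ or $\gamma=\delta_M$, and for $\alpha\ne\tau$ let $\xrightarrow{\hat\alpha}$ be $\xrightarrow{\alpha}$. For sub-distributions, $\gamma\xrightarrow{\hat\alpha}\gamma'$ means that for some finite decomposition $\gamma=\sum_{i\in I}p_i\delta_{M_i}$ with $p_i>0$ (the $M_i$ need not be distinct) and some non-empty $J\subseteq I$ we have $M_j\xrightarrow{\hat\alpha}\gamma_j$ for $j\in J$, no $\hat\alpha$-transition from $M_i$ for $i\in I\setminus J$, and $\gamma'=\sum_{j\in J}p_j\gamma_j$. Let $\stackrel{\hat\tau}{\Longrightarrow}$ be the reflexive transitive closure of $\xrightarrow{\hat\tau}$ and, for $\alpha\neq\tau$, $\stackrel{\hat\alpha}{\Longrightarrow}\;=\;\stackrel{\hat\tau}{\Longrightarrow}\xrightarrow{\hat\alpha}\stackrel{\hat\tau}{\Longrightarrow}$; write $M\stackrel{\hat\alpha}{\Longrightarrow}\gamma$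 for $\delta_M\stackrel{\hat\alpha}{\Longrightarrow}\gamma$. \textbf{Metrics.} For $d$ from pairs of CPSs to $[0,1]$ and distributions $\gamma,\gamma'$ over CPSs, let $\mathbf K(d)(\gamma,\gamma')=\min_\omega\sum_{M,N}\omega(M,N)\,d(M,N)$, over all distributions $\omega$ on pairs of CPSs with marginals $\gamma,\gamma'$. For a sub-distribution $\gamma$ put $\gamma^\ast=\gamma+(1-|\gamma|)\delta_{\mathsf{Dead}}$. A \emph{weak bisimulation metric} is a pseudometric $d$ on CPSs with values in $[0,1]$ such that, whenever $d(M,N)<1$ and $M\xrightarrow{\alpha}\gamma$, there is a sub-distribution $\gamma'$ with $N\stackrel{\hat\alpha}{\Longrightarrow}\gamma'$ and $\mathbf K(d)(\gamma,\gamma'^{\ast})\le d(M,N)$. Let $\mathbf d$ be the pointwise infimum of all weak bisimulation metrics. Define the functional $\mathbf B$ on functions from pairs of CPSs to $[0,1]$ by $$\mathbf B(d)(M,N)=\sup_{\alpha:\,M\xrightarrow{\alpha}\,\vee\, N\xrightarrow{\alpha}}\max\Big\{\sup_{M\xrightarrow{\alpha}\gamma_1}\ \inf_{N\stackrel{\hat\alpha}{\Longrightarrow}\gamma_2}\mathbf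 K(d)(\gamma_1,\gamma_2^{\ast}),\ \sup_{N\xrightarrow{\alpha}\gamma_2}\ \inf_{M\stackrel{\hat\alpha}{\Longrightarrow}\gamma_1}\mathbf K(d)(\gamma_1^{\ast},\gamma_2)\Big\},$$ with $\sup\emptyset=0$ and $\inf\emptyset=1$, and let $\mathbf d^n=\mathbf B^n(\mathbf 0)$, where $\mathbf 0$ is the constant function $0$. \textbf{Proposition.} $\mathbf d$ is the least weak bisimulation metric (the \emph{weak bisimilarity metric}), and it is the pointwise limit of the $n$-weak bisimilarity metrics: $\mathbf d(M,N)=\lim_{n\to\infty}\mathbf d^n(M,N)$ for all cyber-physical systems $M,N$. -/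

import Mathlib

open Filter Topology
open scoped NNReal

noncomputable section

namespace CPC

universe u

/-! ## Finite-support probability (sub-)distributions -/

/-- The total mass `|γ|`. -/
def mass {O : Type*} (γ : O →₀ ℝ≥0) : ℝ≥0 := γ.sum fun _ p => p

/-- Finite-support probability sub-distributions: the mass lies in `(0, 1]`. -/
structure SubDist (O : Type*) where
  weight : O →₀ ℝ≥0
  mass_pos : 0 < mass weight
  mass_le_one : mass weight ≤ 1

/-- Finite-support probability distributions. -/
structure FDist (O : Type*) where
  weight : O →₀ ℝ≥0
  mass_eq_one : mass weight = 1

theorem mass_single {O : Type*} (o : O) (p : ℝ≥0) : mass (Finsupp.single o p) = p := by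
  simp [mass]

theorem mass_add {O : Type*} (γ δ : O →₀ ℝ≥0) : mass (γ + δ) = mass γ + mass δ := by
  classical
  exact Finsupp.sum_add_index' (fun _ => rfl) (fun _ _ _ => rfl)

theorem mass_mapDomain {O O' : Type*} (f : O → O') (γ : O →₀ ℝ≥0) :
    mass (γ.mapDomain f) = mass γ :=
  Finsupp.sum_mapDomain_index (fun _ => rfl) (fun _ _ _ => rfl)

theorem mass_smul {O : Type*} (p : ℝ≥0) (γ : O →₀ ℝ≥0) : mass (p • γ) = p * mass γ := by
  unfold mass
  rw [Finsupp.sum_smul_index (fun _ => rfl), Finsupp.sum, Finsupp.sum, Finset.mul_sum]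

theorem mass_finset_sum {O ι : Type*} (s : Finset ι) (γ : ι → O →₀ ℝ≥0) :
    mass (∑ i ∈ s, γ i) = ∑ i ∈ s, mass (γ i) := by
  classical
  induction s using Finset.induction_on with
  | empty => simp [mass]
  | insert a s ha ih => rw [Finset.sum_insert ha, Finset.sum_insert ha, mass_add, ih]

/-- The point distribution at `o`. -/
def FDist.dirac {O : Type*} (o : O) : FDist O :=
  ⟨Finsupp.single o 1, mass_single o 1⟩

/-- The image of a distribution under a map. -/
def FDist.map {O O' : Type*} (f : O → O') (γ : FDist O) : FDist O' :=
  ⟨γ.weight.mapDomain f, (mass_mapDomain f γ.weight).trans γ.mass_eq_one⟩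

/-- The mixture `∑ₒ γ(o) · k(o)`. -/
def FDist.bind {O O' : Type*} (γ : FDist O) (k : O → FDist O') : FDist O' :=
  ⟨γ.weight.sum fun o p => p • (k o).weight, by
    rw [Finsupp.sum, mass_finset_sum]
    simp only [mass_smul, FDist.mass_eq_one, mul_one]
    exact γ.mass_eq_one⟩

/-- The product distribution `(o, o') ↦ γ(o) · δ(o')`. -/
def FDist.prod {O O' : Type*} (γ : FDist O) (δ : FDist O') : FDist (O × O') :=
  γ.bind fun o => δ.map fun o' => (o, o')

/-- A distribution seen as a sub-distribution. -/
def FDist.toSubDist {O : Type*} (γ : FDist O) : SubDist O :=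
  ⟨γ.weight, by rw [γ.mass_eq_one]; exact one_pos, γ.mass_eq_one.le⟩

/-- `γ + (1 - |γ|) · δₒ`. -/
def SubDist.complete {O : Type*} (γ : SubDist O) (o : O) : FDist O :=
  ⟨γ.weight + Finsupp.single o (1 - mass γ.weight), by
    rw [mass_add, mass_single]; exact add_tsub_cancel_of_le γ.mass_le_one⟩

/-- The expectation `∑ₒ γ(o) · f(o)` of a `[0,1]`-valued function. -/
def FDist.expect {O : Type*} (γ : FDist O) (f : O → unitInterval) : unitInterval :=
  ⟨γ.weight.sum fun o p => (p : ℝ) * (f o : ℝ), by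
    refine ⟨Finset.sum_nonneg fun o _ => mul_nonneg (γ.weight o).2 (f o).2.1, ?_⟩
    have h : ((mass γ.weight : ℝ≥0) : ℝ) = 1 := by rw [γ.mass_eq_one]; rfl
    rw [← h, mass, Finsupp.sum, Finsupp.sum, NNReal.coe_sum]
    exact Finset.sum_le_sum fun o _ => mul_le_of_le_one_right (γ.weight o).2 (f o).2.2⟩

/-! ## Processes -/

/-- The name sets of the calculus: channels, state variables, sensors, actuators, and the
values other than real numbers (Booleans, names, ...). -/
structure Signature where
  Chan : Type u
  StateVar : Type u
  Sensor : Type u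
  Actuator : Type u
  Const : Type u

/-- Values: the real numbers and the further constants of the signature. -/
inductive Val (g : Signature.{u}) : Type u
  | real (r : ℝ)
  | other (n : g.Const)

/-- A value or a value variable. Terms are identified up to α-conversion by using de Bruijn
indices, separately for value variables and for process variables. -/
inductive ValTerm (g : Signature.{u}) : Type u
  | const (v : Val g)
  | var (n : ℕ)

/-- Guards: a Boolean test on finitely many values or value variables. -/
structure Guard (g : Signature.{u}) : Type u where
  arity : ℕ
  test : (Fin arity → Val g) → Bool
  args : Fin arity → ValTerm g

/-- The probabilities `p₁, …, pₖ ∈ (0,1]`, of sum 1, of a probabilistic choice. -/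
structure Weights (k : ℕ) where
  prob : Fin k → ℝ≥0
  pos : ∀ i, 0 < prob i
  sum_eq_one : ∑ i, prob i = 1

/-- Processes. A probabilistic choice `⨁ᵢ pᵢ : Cᵢ` is given by its weights `p` and its
summands `C`. `input` and `sense` bind a value variable in `C`; `fix` binds a process variable. -/
inductive Proc (g : Signature.{u}) : Type u
  | nil
  /-- `tick.C` -/
  | tick {k : ℕ} (p : Weights k) (C : Fin k → Proc g)
  /-- `P ∥ Q` -/
  | par (P Q : Proc g)
  /-- `⌊c!e.C⌋D` -/
  | output (c : g.Chan) (e : ValTerm g) {k l : ℕ} (p : Weights k) (C : Fin k → Proc g)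
      (q : Weights l) (D : Fin l → Proc g)
  /-- `⌊c?(x).C⌋D` -/
  | input (c : g.Chan) {k l : ℕ} (p : Weights k) (C : Fin k → Proc g)
      (q : Weights l) (D : Fin l → Proc g)
  /-- `s?(x).C`, reading from the sensor `s` -/
  | sense (s : g.Sensor) {k : ℕ} (p : Weights k) (C : Fin k → Proc g)
  /-- `a!e.C`, writing on the actuator `a` -/
  | write (a : g.Actuator) (e : ValTerm g) {k : ℕ} (p : Weights k) (C : Fin k → Proc g)
  | ite (b : Guard g) (P Q : Proc g)
  /-- `P \ c` -/
  | res (P : Proc g) (c : g.Chan)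
  | var (n : ℕ)
  | fix (P : Proc g)

variable {g : Signature.{u}}

/-- Substitution of a value for the value variable `k`. -/
def ValTerm.subst (k : ℕ) (v : Val g) : ValTerm g → ValTerm g
  | .const w => .const w
  | .var n => if n = k then .const v else if k < n then .var (n - 1) else .var n

/-- Substitution of a value for the value variable `k`. -/
def Guard.subst (k : ℕ) (v : Val g) (b : Guard g) : Guard g :=
  ⟨b.arity, b.test, fun i => (b.args i).subst k v⟩

/-- `P{v/x}`, for `x` the value variable `k`. -/
def Proc.substVal (v : Val g) : ℕ → Proc g → Proc g
  | _, .nil => .nil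
  | k, .tick p C => .tick p fun i => (C i).substVal v k
  | k, .par P Q => .par (P.substVal v k) (Q.substVal v k)
  | k, .output c e p C q D =>
      .output c (e.subst k v) p (fun i => (C i).substVal v k) q (fun i => (D i).substVal v k)
  | k, .input c p C q D =>
      .input c p (fun i => (C i).substVal v (k + 1)) q (fun i => (D i).substVal v k)
  | k, .sense s p C => .sense s p fun i => (C i).substVal v (k + 1)
  | k, .write a e p C => .write a (e.subst k v) p fun i => (C i).substVal v k
  | k, .ite b P Q => .ite (b.subst k v) (P.substVal v k) (Q.substVal v k)
  | k, .res P c => .res (P.substVal v k) c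
  | _, .var n => .var n
  | k, .fix P => .fix (P.substVal v k)

/-- `P{R/X}`, for `X` the process variable `k` and `R` a closed process (so that no index of `R`
needs shifting under the binders of `P`). -/
def Proc.substProc (R : Proc g) : ℕ → Proc g → Proc g
  | _, .nil => .nil
  | k, .tick p C => .tick p fun i => substProc R k (C i)
  | k, .par P Q => .par (substProc R k P) (substProc R k Q)
  | k, .output c e p C q D =>
      .output c e p (fun i => substProc R k (C i)) q (fun i => substProc R k (D i))
  | k, .input c p C q D =>
      .input c p (fun i => substProc R k (C i)) q (fun i => substProc R k (D i))
  | k, .sense s p C => .sense s p fun i => substProc R k (C i)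
  | k, .write a e p C => .write a e p fun i => substProc R k (C i)
  | k, .ite b P Q => .ite b (substProc R k P) (substProc R k Q)
  | k, .res P c => .res (substProc R k P) c
  | k, .var n => if n = k then R else if k < n then .var (n - 1) else .var n
  | k, .fix P => .fix (substProc R (k + 1) P)

/-- All free value variables are below `n`. -/
def ValTerm.ClosedAt (n : ℕ) : ValTerm g → Prop
  | .const _ => True
  | .var i => i < n

/-- All free value variables are below `n` and all free process variables are below `m`. -/
def Proc.ClosedAt : ℕ → ℕ → Proc g → Prop
  | _, _, .nil => True
  | n, m, .tick _ C => ∀ i, (C i).ClosedAt n m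
  | n, m, .par P Q => P.ClosedAt n m ∧ Q.ClosedAt n m
  | n, m, .output _ e _ C _ D =>
      e.ClosedAt n ∧ (∀ i, (C i).ClosedAt n m) ∧ ∀ i, (D i).ClosedAt n m
  | n, m, .input _ _ C _ D => (∀ i, (C i).ClosedAt (n + 1) m) ∧ ∀ i, (D i).ClosedAt n m
  | n, m, .sense _ _ C => ∀ i, (C i).ClosedAt (n + 1) m
  | n, m, .write _ e _ C => e.ClosedAt n ∧ ∀ i, (C i).ClosedAt n m
  | n, m, .ite b P Q => (∀ i, (b.args i).ClosedAt n) ∧ P.ClosedAt n m ∧ Q.ClosedAt n m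
  | n, m, .res P _ => P.ClosedAt n m
  | _, m, .var i => i < m
  | n, m, .fix P => P.ClosedAt n (m + 1)

/-- Every free occurrence of the process variable `k` is time-guarded, that is, lies in `C` for
some subterm `tick.C`, or in `D` for some subterm `⌊chn.C⌋D`. -/
def Proc.TimeGuards : ℕ → Proc g → Prop
  | _, .nil => True
  | _, .tick _ _ => True
  | k, .par P Q => P.TimeGuards k ∧ Q.TimeGuards k
  | k, .output _ _ _ C _ _ => ∀ i, (C i).TimeGuards k
  | k, .input _ _ C _ _ => ∀ i, (C i).TimeGuards k
  | k, .sense _ _ C => ∀ i, (C i).TimeGuards k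
  | k, .write _ _ _ C => ∀ i, (C i).TimeGuards k
  | k, .ite _ P Q => P.TimeGuards k ∧ Q.TimeGuards k
  | k, .res P _ => P.TimeGuards k
  | k, .var n => n ≠ k
  | k, .fix P => P.TimeGuards (k + 1)

/-- All recursions in the process are time-guarded. -/
def Proc.Guarded : Proc g → Prop
  | .nil => True
  | .tick _ C => ∀ i, (C i).Guarded
  | .par P Q => P.Guarded ∧ Q.Guarded
  | .output _ _ _ C _ D => (∀ i, (C i).Guarded) ∧ ∀ i, (D i).Guarded
  | .input _ _ C _ D => (∀ i, (C i).Guarded) ∧ ∀ i, (D i).Guarded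
  | .sense _ _ C => ∀ i, (C i).Guarded
  | .write _ _ _ C => ∀ i, (C i).Guarded
  | .ite _ P Q => P.Guarded ∧ Q.Guarded
  | .res P _ => P.Guarded
  | .var _ => True
  | .fix P => P.TimeGuards 0 ∧ P.Guarded

/-- All sensors mentioned in the process are in `S` and all actuators mentioned are in `A`. -/
def Proc.DevicesIn (S : Set g.Sensor) (A : Set g.Actuator) : Proc g → Prop
  | .nil => True
  | .tick _ C => ∀ i, (C i).DevicesIn S A
  | .par P Q => P.DevicesIn S A ∧ Q.DevicesIn S A
  | .output _ _ _ C _ D => (∀ i, (C i).DevicesIn S A) ∧ ∀ i, (D i).DevicesIn S A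
  | .input _ _ C _ D => (∀ i, (C i).DevicesIn S A) ∧ ∀ i, (D i).DevicesIn S A
  | .sense s _ C => s ∈ S ∧ ∀ i, (C i).DevicesIn S A
  | .write a _ _ C => a ∈ A ∧ ∀ i, (C i).DevicesIn S A
  | .ite _ P Q => P.DevicesIn S A ∧ Q.DevicesIn S A
  | .res P _ => P.DevicesIn S A
  | .var _ => True
  | .fix P => P.DevicesIn S A

/-- The (closed) guard `b` evaluates to `t`. -/
def Guard.EvalsTo (b : Guard g) (t : Bool) : Prop :=
  ∃ v : Fin b.arity → Val g, (∀ i, b.args i = .const (v i)) ∧ b.test v = t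

/-- `⟦⨁ᵢ pᵢ : Cᵢ⟧ = ∑ᵢ pᵢ · δ_{Cᵢ}`. -/
def choice {k : ℕ} (p : Weights k) (C : Fin k → Proc g) : FDist (Proc g) :=
  ⟨∑ i, p.prob i • (FDist.dirac (C i)).weight, by
    rw [mass_finset_sum]
    simp only [mass_smul, FDist.mass_eq_one, mul_one]
    exact p.sum_eq_one⟩

/-- `π₁ ∥ π₂`. -/
def parDist (π₁ π₂ : FDist (Proc g)) : FDist (Proc g) :=
  (π₁.prod π₂).map fun R => Proc.par R.1 R.2

/-- `π \ c`. -/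
def resDist (π : FDist (Proc g)) (c : g.Chan) : FDist (Proc g) :=
  π.map fun P => Proc.res P c

/-- The untimed labels of processes. The label `sns s` is `s?x`: the bound variable `x` is the
value variable `0` of the target. -/
inductive Label (g : Signature.{u}) : Type u
  | tau
  | out (c : g.Chan) (v : Val g)
  | inp (c : g.Chan) (v : Val g)
  | wrt (a : g.Actuator) (v : Val g)
  | sns (s : g.Sensor)

/-- The untimed transitions of (closed) processes. -/
inductive Proc.Untimed : Proc g → Label g → FDist (Proc g) → Prop
  | outp {c : g.Chan} {v : Val g} {k l : ℕ} {p : Weights k} {C : Fin k → Proc g}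
      {q : Weights l} {D : Fin l → Proc g} :
      Untimed (.output c (.const v) p C q D) (.out c v) (choice p C)
  | inpp {c : g.Chan} (v : Val g) {k l : ℕ} {p : Weights k} {C : Fin k → Proc g}
      {q : Weights l} {D : Fin l → Proc g} :
      Untimed (.input c p C q D) (.inp c v) (choice p fun i => (C i).substVal v 0)
  | write {a : g.Actuator} {v : Val g} {k : ℕ} {p : Weights k} {C : Fin k → Proc g} :
      Untimed (.write a (.const v) p C) (.wrt a v) (choice p C)
  | read {s : g.Sensor} {k : ℕ} {p : Weights k} {C : Fin k → Proc g} :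
      Untimed (.sense s p C) (.sns s) (choice p C)
  | comL {P₁ P₂ : Proc g} {c : g.Chan} {v : Val g} {π₁ π₂ : FDist (Proc g)} :
      Untimed P₁ (.out c v) π₁ → Untimed P₂ (.inp c v) π₂ →
      Untimed (.par P₁ P₂) .tau (parDist π₁ π₂)
  | comR {P₁ P₂ : Proc g} {c : g.Chan} {v : Val g} {π₁ π₂ : FDist (Proc g)} :
      Untimed P₁ (.inp c v) π₁ → Untimed P₂ (.out c v) π₂ →
      Untimed (.par P₁ P₂) .tau (parDist π₁ π₂)
  | parL {P Q : Proc g} {lam : Label g} {π : FDist (Proc g)} :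
      Untimed P lam π → Untimed (.par P Q) lam (parDist π (.dirac Q))
  | parR {P Q : Proc g} {lam : Label g} {π : FDist (Proc g)} :
      Untimed Q lam π → Untimed (.par P Q) lam (parDist (.dirac P) π)
  | chnRes {P : Proc g} {c : g.Chan} {lam : Label g} {π : FDist (Proc g)} :
      Untimed P lam π → (∀ v, lam ≠ .inp c v) → (∀ v, lam ≠ .out c v) →
      Untimed (.res P c) lam (resDist π c)
  | unfold {P : Proc g} {lam : Label g} {π : FDist (Proc g)} :
      Untimed (Proc.substProc (.fix P) 0 P) lam π → Untimed (.fix P) lam π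
  | iteTrue {b : Guard g} {P Q : Proc g} {lam : Label g} {π : FDist (Proc g)} :
      b.EvalsTo true → Untimed P lam π → Untimed (.ite b P Q) lam π
  | iteFalse {b : Guard g} {P Q : Proc g} {lam : Label g} {π : FDist (Proc g)} :
      b.EvalsTo false → Untimed Q lam π → Untimed (.ite b P Q) lam π

/-- The `tick`-transitions of (closed) processes. -/
inductive Proc.Timed : Proc g → FDist (Proc g) → Prop
  | timeNil : Timed .nil (.dirac .nil)
  | delay {k : ℕ} {p : Weights k} {C : Fin k → Proc g} : Timed (.tick p C) (choice p C)
  | timeoutOut {c : g.Chan} {e : ValTerm g} {k l : ℕ} {p : Weights k} {C : Fin k → Proc g}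
      {q : Weights l} {D : Fin l → Proc g} : Timed (.output c e p C q D) (choice q D)
  | timeoutIn {c : g.Chan} {k l : ℕ} {p : Weights k} {C : Fin k → Proc g}
      {q : Weights l} {D : Fin l → Proc g} : Timed (.input c p C q D) (choice q D)
  | timePar {P₁ P₂ : Proc g} {π₁ π₂ : FDist (Proc g)} :
      Timed P₁ π₁ → Timed P₂ π₂ → (¬ ∃ π, Proc.Untimed (.par P₁ P₂) .tau π) →
      Timed (.par P₁ P₂) (parDist π₁ π₂)
  | chnRes {P : Proc g} {c : g.Chan} {π : FDist (Proc g)} :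
      Timed P π → Timed (.res P c) (resDist π c)
  | unfold {P : Proc g} {π : FDist (Proc g)} :
      Timed (Proc.substProc (.fix P) 0 P) π → Timed (.fix P) π
  | iteTrue {b : Guard g} {P Q : Proc g} {π : FDist (Proc g)} :
      b.EvalsTo true → Timed P π → Timed (.ite b P Q) π
  | iteFalse {b : Guard g} {P Q : Proc g} {π : FDist (Proc g)} :
      b.EvalsTo false → Timed Q π → Timed (.ite b P Q) π

/-! ## Cyber-physical systems -/

/-- A physical environment, on its sets of state variables, sensors and actuators. -/
structure PhysEnv (g : Signature.{u}) where
  X : Set g.StateVar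
  S : Set g.Sensor
  A : Set g.Actuator
  evol : (X → ℝ) → (A → ℝ) → FDist (X → ℝ)
  meas : (X → ℝ) → FDist (S → ℝ)
  inv : Set (X → ℝ)

/-- A physical state: state function, sensor function and actuator function. -/
structure PhysState (E : PhysEnv g) where
  x : E.X → ℝ
  s : E.S → ℝ
  a : E.A → ℝ

/-- The possible physical states in the next time slot. -/
def PhysEnv.next (E : PhysEnv g) (σ : PhysState E) : FDist (PhysState E) :=
  (E.evol σ.x σ.a).bind fun x' => (E.meas x').map fun s' => ⟨x', s', σ.a⟩

open Classical in
/-- `S[a ↦ v]` on the actuator function. Writing is meant for real values; any other value leaves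
the actuators unchanged. -/
def PhysState.setActuator {E : PhysEnv g} (σ : PhysState E) (a : E.A) : Val g → PhysState E
  | .real r => ⟨σ.x, σ.s, Function.update σ.a a r⟩
  | .other _ => σ

/-- Systems `E;S ⋈ P`, not necessarily well-formed, and the deadlocked system `Dead`. -/
inductive RawCPS (g : Signature.{u}) : Type u
  | dead
  | sys (E : PhysEnv g) (σ : PhysState E) (P : Proc g)

/-- The standing assumptions on systems: closed process, time-guarded recursion, and the process
only mentions sensors and actuators of the physical component. -/
def RawCPS.WellFormed : RawCPS g → Prop
  | .dead => True
  | .sys E _ P => P.ClosedAt 0 0 ∧ P.Guarded ∧ P.DevicesIn E.S E.A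

/-- `E;σ ⋈ π` for distributions `σ`, `π` over physical states and processes. -/
def sysDist (E : PhysEnv g) (σ : FDist (PhysState E)) (π : FDist (Proc g)) : FDist (RawCPS g) :=
  (σ.prod π).map fun R => RawCPS.sys E R.1 R.2

/-- The `τ`-transitions of systems. -/
inductive RawCPS.TauStep : RawCPS g → FDist (RawCPS g) → Prop
  | tau {E : PhysEnv g} {σ : PhysState E} {P : Proc g} {π : FDist (Proc g)} :
      P.Untimed .tau π → σ.x ∈ E.inv → TauStep (.sys E σ P) (sysDist E (.dirac σ) π)
  | sensRead {E : PhysEnv g} {σ : PhysState E} {P : Proc g} {π : FDist (Proc g)} (s : E.S) :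
      P.Untimed (.sns s) π → σ.x ∈ E.inv →
      TauStep (.sys E σ P)
        (sysDist E (.dirac σ) (π.map fun Q => Q.substVal (.real (σ.s s)) 0))
  | actWrite {E : PhysEnv g} {σ : PhysState E} {P : Proc g} {π : FDist (Proc g)} (a : E.A)
      (v : Val g) :
      P.Untimed (.wrt a v) π → σ.x ∈ E.inv →
      TauStep (.sys E σ P) (sysDist E (.dirac (σ.setActuator a v)) π)
  | deadlock {E : PhysEnv g} {σ : PhysState E} {P : Proc g} :
      σ.x ∉ E.inv → TauStep (.sys E σ P) (.dirac .dead)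

/-- The actions of systems. -/
inductive Act (g : Signature.{u}) : Type u
  | tau
  | out (c : g.Chan) (v : Val g)
  | inp (c : g.Chan) (v : Val g)
  | tick

/-- The transitions of systems. -/
inductive RawCPS.Step : RawCPS g → Act g → FDist (RawCPS g) → Prop
  | tau {M : RawCPS g} {γ : FDist (RawCPS g)} : M.TauStep γ → Step M .tau γ
  | out {E : PhysEnv g} {σ : PhysState E} {P : Proc g} {c : g.Chan} {v : Val g}
      {π : FDist (Proc g)} :
      P.Untimed (.out c v) π → σ.x ∈ E.inv →
      Step (.sys E σ P) (.out c v) (sysDist E (.dirac σ) π)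
  | inp {E : PhysEnv g} {σ : PhysState E} {P : Proc g} {c : g.Chan} {v : Val g}
      {π : FDist (Proc g)} :
      P.Untimed (.inp c v) π → σ.x ∈ E.inv →
      Step (.sys E σ P) (.inp c v) (sysDist E (.dirac σ) π)
  | time {E : PhysEnv g} {σ : PhysState E} {P : Proc g} {π : FDist (Proc g)} :
      P.Timed π → (¬ ∃ γ, RawCPS.TauStep (.sys E σ P) γ) → σ.x ∈ E.inv →
      Step (.sys E σ P) .tick (sysDist E (E.next σ) π)

/-- Cyber-physical systems, always well-formed. -/
def CPS (g : Signature.{u}) : Type u := {M : RawCPS g // M.WellFormed}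

/-- The deadlocked system. -/
def Dead : CPS g := ⟨.dead, trivial⟩

/-- `M –α→ γ`: the transitions of systems, with `γ` seen as a distribution over well-formed systems
(transitions preserve well-formedness). -/
def Step (M : CPS g) (α : Act g) (γ : FDist (CPS g)) : Prop :=
  M.1.Step α (γ.map Subtype.val)

/-! ## Weak transitions -/

/-- `M –α̂→ γ`. -/
def HatStep (M : CPS g) (α : Act g) (γ : FDist (CPS g)) : Prop :=
  Step M α γ ∨ (α = .tau ∧ γ = .dirac M)

/-- `γ –α̂→ γ'` between sub-distributions: for some writing `γ = ∑ᵢ pᵢ · δ_{Mᵢ}` (the `Mᵢ` may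
repeat), the `Mⱼ` with `j ∈ J ≠ ∅` make a step to `ηⱼ`, no other `Mᵢ` can make one, and
`γ' = ∑_{j ∈ J} pⱼ · ηⱼ`. -/
def LiftedStep (α : Act g) (γ γ' : SubDist (CPS g)) : Prop :=
  ∃ (n : ℕ) (p : Fin n → ℝ≥0) (M : Fin n → CPS g) (J : Finset (Fin n))
    (η : Fin n → FDist (CPS g)),
    (∀ i, 0 < p i) ∧
    γ.weight = ∑ i, p i • (FDist.dirac (M i)).weight ∧
    J.Nonempty ∧
    (∀ j ∈ J, HatStep (M j) α (η j)) ∧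
    (∀ i ∉ J, ¬ ∃ δ, HatStep (M i) α δ) ∧
    γ'.weight = ∑ j ∈ J, p j • (η j).weight

/-- `γ ⟹τ̂ γ'`. -/
def WeakTau (γ γ' : SubDist (CPS g)) : Prop :=
  Relation.ReflTransGen (LiftedStep .tau) γ γ'

/-- `γ ⟹α̂ γ'`. -/
def LiftedWeakStep : Act g → SubDist (CPS g) → SubDist (CPS g) → Prop
  | .tau, γ, γ' => WeakTau γ γ'
  | α, γ, γ' => ∃ δ δ', WeakTau γ δ ∧ LiftedStep α δ δ' ∧ WeakTau δ' γ'

/-- `M ⟹α̂ γ`. -/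
def WeakStep (M : CPS g) (α : Act g) (γ : SubDist (CPS g)) : Prop :=
  LiftedWeakStep α (FDist.dirac M).toSubDist γ

/-! ## Bisimulation metrics -/

/-- Matchings for a pair of distributions. -/
def Matching {O : Type*} (γ γ' : FDist O) : Set (FDist (O × O)) :=
  {ω | ω.map Prod.fst = γ ∧ ω.map Prod.snd = γ'}

/-- The Kantorovich lifting of `d`. The infimum is in `[0,1]`. -/
def kantorovich {O : Type*} (d : O → O → unitInterval) (γ γ' : FDist O) : unitInterval :=
  ⨅ ω ∈ Matching γ γ', ω.expect fun R => d R.1 R.2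

/-- 1-bounded pseudometrics. -/
structure IsPseudometric {O : Type*} (d : O → O → unitInterval) : Prop where
  self : ∀ M, d M M = 0
  symm : ∀ M N, d M N = d N M
  triangle : ∀ M N R, (d M N : ℝ) ≤ d M R + d R N

/-- Weak bisimulation metrics. -/
structure IsWeakBisimulationMetric (d : CPS g → CPS g → unitInterval) : Prop where
  pseudometric : IsPseudometric d
  transfer : ∀ M N, d M N < 1 → ∀ α γ, Step M α γ →
    ∃ γ' : SubDist (CPS g), WeakStep N α γ' ∧ kantorovich d γ (γ'.complete Dead) ≤ d M N

/-- The weak bisimilarity metric: the pointwise infimum of all weak bisimulation metrics. -/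
def weakBisimilarityMetric (g : Signature.{u}) : CPS g → CPS g → unitInterval :=
  sInf {d | IsWeakBisimulationMetric d}

/-- The bisimulation metric functional. Suprema and infima are in `[0,1]`, so that the supremum
of the empty set is `0` and the infimum of the empty set is `1`. -/
def bisimFunctional (d : CPS g → CPS g → unitInterval) (M N : CPS g) : unitInterval :=
  ⨆ (α : Act g) (_ : (∃ γ, Step M α γ) ∨ ∃ γ, Step N α γ),
    max
      (⨆ (γ₁ : FDist (CPS g)) (_ : Step M α γ₁),
        ⨅ (γ₂ : SubDist (CPS g)) (_ : WeakStep N α γ₂), kantorovich d γ₁ (γ₂.complete Dead))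
      (⨆ (γ₂ : FDist (CPS g)) (_ : Step N α γ₂),
        ⨅ (γ₁ : SubDist (CPS g)) (_ : WeakStep M α γ₁), kantorovich d (γ₁.complete Dead) γ₂)

/-- The `n`-weak bisimilarity metric: the `n`-th iterate of the functional at the constant `0`. -/
def nWeakBisimilarityMetric (g : Signature.{u}) (n : ℕ) : CPS g → CPS g → unitInterval :=
  bisimFunctional^[n] fun _ _ => 0

end CPC

end

noncomputable section

namespace CPC

universe u

/-! ## Expectations and the monad of finite-support distributions -/

section Distributions

variable {O O' O'' ι : Type*}

/-! The iterates `𝐝ⁿ` increase, so they converge to their supremum `limitMetric`. Every weak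
bisimulation metric `d` satisfies `𝐁(d) ≤ d`, hence lies above all iterates and above `limitMetric`.
It remains to show that `limitMetric` is itself a weak bisimulation metric; being then the least
one, it is their infimum.

Attained bounds come from compactness. Recursion is time-guarded, so every `τ`-transition lowers a
size (`CPS.rank`); each system has finitely many transitions for each action. Hence there are
finitely many outcomes of deterministic sequences of `τ`-steps, and the outcomes of randomised ones
(`Run`) are the mixtures of these. Near-optimal answers for all `𝐝ⁿ` can then be replaced by one
answer that is optimal for the limit (`exists_coupled_limit`, `limitMetric_tau`).

The delicate point is loss of mass: a weak `α`-transition drops, that is, sends to `Dead`, the mass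
of systems without `α`-transition, while a system with one has to perform it. This form of dropping
is not stable under matching. It is replaced by `Observe`, where a communication may drop mass at
any time and `tick` only in `Dead` itself; such runs do transfer along `limitMetric`
(`transfer_observe`). The return to genuine weak transitions (`exists_weakStep_of_run`) uses that
every system satisfying its invariant is at distance `1` from `Dead` (`limitMetric_dead`): dropped
mass already costs the maximum, so forcing it to perform `α` costs no more. For `tick` the argument
uses that a system within its invariant and without `τ` can let time pass
(`CPS.Stable.exists_tick`), and that a system that ticks has no `τ` (`limitMetric_tick`).

The triangle inequality follows from minimality: the infimum over two-step paths, `pathMetric`,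
satisfies `𝐁(d) ≤ d` as well (`bisimFunctional_pathMetric_le`), so `limitMetric ≤ pathMetric`. -/

/-- The expectation of a real function. -/
def FDist.ex (γ : FDist O) (f : O → ℝ) : ℝ := γ.weight.sum fun o p => (p : ℝ) * f o

/-- The support. -/
def FDist.supp (γ : FDist O) : Finset O := γ.weight.support

theorem FDist.weight_injective : Function.Injective (FDist.weight (O := O)) := by
  rintro ⟨γ, h⟩ ⟨γ', h'⟩ rfl
  rfl

theorem SubDist.weight_injective : Function.Injective (SubDist.weight (O := O)) := by
  rintro ⟨γ, h, h'⟩ ⟨γ', _, _⟩ rfl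
  rfl

theorem FDist.ex_eq_sum (γ : FDist O) (f : O → ℝ) :
    γ.ex f = ∑ o ∈ γ.supp, (γ.weight o : ℝ) * f o := rfl

/-- The linear functional on weights that underlies the expectation. -/
def weightEx (f : O → ℝ) : (O →₀ ℝ≥0) →+ ℝ :=
  Finsupp.liftAddHom fun o => (AddMonoidHom.mulRight (f o)).comp NNReal.toRealHom.toAddMonoidHom

theorem FDist.ex_eq_weightEx (γ : FDist O) (f : O → ℝ) : γ.ex f = weightEx f γ.weight := by
  rw [FDist.ex, weightEx, Finsupp.liftAddHom_apply]
  rfl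

@[simp] theorem weightEx_single (f : O → ℝ) (o : O) (p : ℝ≥0) :
    weightEx f (Finsupp.single o p) = p * f o := by
  simp [weightEx]

@[simp] theorem weightEx_smul (f : O → ℝ) (p : ℝ≥0) (γ : O →₀ ℝ≥0) :
    weightEx f (p • γ) = p * weightEx f γ := by
  induction γ using Finsupp.induction_linear with
  | zero => simp
  | add a b ha hb => simp [ha, hb, mul_add]
  | single o q =>
    rw [Finsupp.smul_single, weightEx_single, weightEx_single, smul_eq_mul, NNReal.coe_mul,
      mul_assoc]

theorem weightEx_ext {γ δ : O →₀ ℝ≥0} (h : ∀ f, weightEx f γ = weightEx f δ) : γ = δ := by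
  classical
  ext o
  have key : ∀ γ : O →₀ ℝ≥0, weightEx (Pi.single o 1) γ = γ o := by
    intro γ
    induction γ using Finsupp.induction_linear with
    | zero => simp
    | add a b ha hb => simp [ha, hb]
    | single o' q =>
      by_cases h : o' = o
      · subst h; simp
      · simp [h]
  rw [← key γ, ← key δ, h]

/-- Reduces identities between images, mixtures and point distributions to identities of
expectations, which `simp` settles. -/
theorem FDist.ext_ex {γ δ : FDist O} (h : ∀ f, γ.ex f = δ.ex f) : γ = δ :=
  FDist.weight_injective (weightEx_ext fun f => by
    rw [← FDist.ex_eq_weightEx, ← FDist.ex_eq_weightEx, h])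

@[simp] theorem FDist.ex_dirac (o : O) (f : O → ℝ) : (FDist.dirac o).ex f = f o := by
  simp [FDist.ex_eq_weightEx, FDist.dirac]

@[simp] theorem FDist.ex_bind (γ : FDist O) (k : O → FDist O') (f : O' → ℝ) :
    (γ.bind k).ex f = γ.ex fun o => (k o).ex f := by
  have h : (γ.bind k).weight = ∑ o ∈ γ.supp, γ.weight o • (k o).weight := rfl
  rw [FDist.ex_eq_weightEx, h, map_sum, FDist.ex_eq_sum]
  exact Finset.sum_congr rfl fun o _ => by rw [weightEx_smul, FDist.ex_eq_weightEx]

@[simp] theorem FDist.ex_map (γ : FDist O) (m : O → O') (f : O' → ℝ) :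
    (γ.map m).ex f = γ.ex fun o => f (m o) := by
  rw [FDist.ex, FDist.map, Finsupp.sum_mapDomain_index (by simp) (by simp [add_mul])]
  rfl

theorem FDist.ex_const (γ : FDist O) (c : ℝ) : γ.ex (fun _ => c) = c := by
  have h : ((mass γ.weight : ℝ≥0) : ℝ) = 1 := by rw [γ.mass_eq_one]; rfl
  rw [FDist.ex, Finsupp.sum, ← Finset.sum_mul]
  rw [mass, Finsupp.sum, NNReal.coe_sum] at h
  rw [h, one_mul]

theorem FDist.ex_add (γ : FDist O) (f f' : O → ℝ) :
    (γ.ex fun o => f o + f' o) = γ.ex f + γ.ex f' := by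
  simp [FDist.ex_eq_sum, mul_add, Finset.sum_add_distrib]

theorem FDist.ex_mono {γ : FDist O} {f f' : O → ℝ} (h : ∀ o ∈ γ.supp, f o ≤ f' o) :
    γ.ex f ≤ γ.ex f' :=
  Finset.sum_le_sum fun o ho => mul_le_mul_of_nonneg_left (h o ho) (γ.weight o).2

theorem FDist.ex_congr {γ : FDist O} {f f' : O → ℝ} (h : ∀ o ∈ γ.supp, f o = f' o) :
    γ.ex f = γ.ex f' := by
  rw [FDist.ex_eq_sum, FDist.ex_eq_sum]
  exact Finset.sum_congr rfl fun o ho => by rw [h o ho]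

theorem FDist.ex_comm (γ : FDist O) (δ : FDist O') (f : O → O' → ℝ) :
    (γ.ex fun o => δ.ex (f o)) = δ.ex fun o' => γ.ex fun o => f o o' := by
  simp only [FDist.ex_eq_sum, Finset.mul_sum]
  rw [Finset.sum_comm]
  refine Finset.sum_congr rfl fun _ _ => Finset.sum_congr rfl fun _ _ => by ring

theorem FDist.coe_expect (γ : FDist O) (f : O → unitInterval) :
    ((γ.expect f : unitInterval) : ℝ) = γ.ex fun o => f o := rfl

theorem FDist.map_eq_bind (γ : FDist O) (m : O → O') : γ.map m = γ.bind fun o => .dirac (m o) :=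
  FDist.ext_ex fun f => by simp

theorem FDist.dirac_bind (o : O) (k : O → FDist O') : (FDist.dirac o).bind k = k o :=
  FDist.ext_ex fun f => by simp

theorem FDist.bind_dirac (γ : FDist O) : γ.bind FDist.dirac = γ :=
  FDist.ext_ex fun f => by simp

theorem FDist.bind_assoc (γ : FDist O) (k : O → FDist O') (l : O' → FDist O'') :
    (γ.bind k).bind l = γ.bind fun o => (k o).bind l :=
  FDist.ext_ex fun f => by simp

theorem FDist.map_map (γ : FDist O) (m : O → O') (m' : O' → O'') :
    (γ.map m).map m' = γ.map fun o => m' (m o) :=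
  FDist.ext_ex fun f => by simp

theorem FDist.bind_map (γ : FDist O) (m : O → O') (k : O' → FDist O'') :
    (γ.map m).bind k = γ.bind fun o => k (m o) :=
  FDist.ext_ex fun f => by simp

theorem FDist.map_bind (γ : FDist O) (k : O → FDist O') (m : O' → O'') :
    (γ.bind k).map m = γ.bind fun o => (k o).map m :=
  FDist.ext_ex fun f => by simp

theorem FDist.map_dirac (o : O) (m : O → O') : (FDist.dirac o).map m = .dirac (m o) :=
  FDist.ext_ex fun f => by simp

theorem FDist.bind_const (γ : FDist O) (δ : FDist O') : (γ.bind fun _ => δ) = δ :=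
  FDist.ext_ex fun f => by simp [FDist.ex_const]

theorem FDist.bind_congr {γ : FDist O} {k l : O → FDist O'} (h : ∀ o ∈ γ.supp, k o = l o) :
    γ.bind k = γ.bind l :=
  FDist.ext_ex fun f => by
    rw [FDist.ex_bind, FDist.ex_bind]
    exact FDist.ex_congr fun o ho => by rw [h o ho]

theorem FDist.map_congr {γ : FDist O} {m m' : O → O'} (h : ∀ o ∈ γ.supp, m o = m' o) :
    γ.map m = γ.map m' := by
  rw [FDist.map_eq_bind, FDist.map_eq_bind]
  exact FDist.bind_congr fun o ho => by rw [h o ho]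

theorem FDist.map_id' (γ : FDist O) : (γ.map fun o => o) = γ :=
  FDist.ext_ex fun f => by simp

theorem FDist.map_injective {m : O → O'} (hm : Function.Injective m) :
    Function.Injective (FDist.map m) := by
  intro γ δ h
  exact FDist.weight_injective
    (Finsupp.mapDomain_injective hm (congrArg FDist.weight h))

theorem FDist.mem_supp {γ : FDist O} {o : O} : o ∈ γ.supp ↔ γ.weight o ≠ 0 :=
  Finsupp.mem_support_iff

theorem FDist.mem_supp_dirac {o o' : O} : o' ∈ (FDist.dirac o).supp ↔ o' = o := by
  classical
  rw [FDist.mem_supp, FDist.dirac, Finsupp.single_apply]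
  by_cases h : o = o' <;> simp [h, eq_comm]

theorem FDist.mem_supp_bind {γ : FDist O} {k : O → FDist O'} {o' : O'} :
    o' ∈ (γ.bind k).supp ↔ ∃ o ∈ γ.supp, o' ∈ (k o).supp := by
  have h : (γ.bind k).weight = ∑ o ∈ γ.supp, γ.weight o • (k o).weight := rfl
  rw [FDist.mem_supp, h, Finsupp.finsetSum_apply, Ne, Finset.sum_eq_zero_iff]
  simp [FDist.mem_supp]

theorem FDist.mem_supp_map {γ : FDist O} {m : O → O'} {o' : O'} :
    o' ∈ (γ.map m).supp ↔ ∃ o ∈ γ.supp, m o = o' := by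
  simp [FDist.map_eq_bind, FDist.mem_supp_bind, FDist.mem_supp_dirac, eq_comm]

theorem FDist.mem_supp_prod {γ : FDist O} {δ : FDist O'} {p : O × O'} :
    p ∈ (γ.prod δ).supp ↔ p.1 ∈ γ.supp ∧ p.2 ∈ δ.supp := by
  obtain ⟨a, b⟩ := p
  simp [FDist.prod, FDist.mem_supp_bind, FDist.mem_supp_map]

theorem FDist.supp_nonempty (γ : FDist O) : γ.supp.Nonempty := by
  by_contra h
  rw [Finset.not_nonempty_iff_eq_empty] at h
  have := γ.mass_eq_one
  rw [mass, Finsupp.sum, show γ.weight.support = ∅ from h] at this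
  simp at this

theorem FDist.eq_dirac {γ : FDist O} {o : O} (h : ∀ o' ∈ γ.supp, o' = o) : γ = .dirac o := by
  have : γ.map (fun _ => o) = γ := by
    conv_rhs => rw [← FDist.map_id' γ]
    exact FDist.map_congr fun o' ho' => (h o' ho').symm
  rw [← this]
  exact FDist.ext_ex fun f => by simp [FDist.ex_const]

theorem FDist.map_weight (γ : FDist O) (m : O → O') :
    (γ.map m).weight = ∑ o ∈ γ.supp, γ.weight o • (FDist.dirac (m o)).weight := by
  rw [FDist.map_eq_bind]; rfl

theorem FDist.bind_weight (γ : FDist O) (k : O → FDist O') :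
    (γ.bind k).weight = ∑ o ∈ γ.supp, γ.weight o • (k o).weight := rfl

/-- Disintegration of a distribution along a map. -/
theorem FDist.exists_disintegration (ρ : FDist ι) (m : ι → O) :
    ∃ κ : O → FDist ι, ρ = (ρ.map m).bind κ ∧
      ∀ o ∈ (ρ.map m).supp, ∀ i ∈ (κ o).supp, i ∈ ρ.supp ∧ m i = o := by
  classical
  have hw : ∀ o, (ρ.map m).weight o = mass (ρ.weight.filter fun i => m i = o) := by
    intro o
    rw [FDist.map_weight, Finsupp.finsetSum_apply, mass, Finsupp.sum, Finsupp.support_filter,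
      Finset.sum_filter]
    refine Finset.sum_congr rfl fun i _ => ?_
    by_cases h : m i = o <;> simp [FDist.dirac, h]
  let κ : O → FDist ι := fun o =>
    if h : (ρ.map m).weight o = 0 then ρ else
      ⟨((ρ.map m).weight o)⁻¹ • ρ.weight.filter fun i => m i = o, by
        rw [mass_smul, ← hw, inv_mul_cancel₀ h]⟩
  have hκ : ∀ o, (ρ.map m).weight o • (κ o).weight = ρ.weight.filter fun i => m i = o := by
    intro o
    by_cases h : (ρ.map m).weight o = 0
    · rw [h, zero_smul]
      rw [hw, mass, Finsupp.sum, Finset.sum_eq_zero_iff] at h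
      symm
      ext i
      by_cases hi : i ∈ (ρ.weight.filter fun i => m i = o).support
      · rw [h i hi]; rfl
      · rw [Finsupp.notMem_support_iff.1 hi]; rfl
    · simp only [κ, dif_neg h, smul_smul, mul_inv_cancel₀ h, one_smul]
  refine ⟨κ, FDist.weight_injective ?_, fun o ho i hi => ?_⟩
  · rw [FDist.bind_weight]
    simp only [hκ]
    ext i
    rw [Finsupp.finsetSum_apply]
    by_cases hi : i ∈ ρ.supp
    · have hmi : m i ∈ (ρ.map m).supp := FDist.mem_supp_map.2 ⟨i, hi, rfl⟩
      rw [Finset.sum_eq_single_of_mem _ hmi fun o _ ho => by simp [ho.symm]]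
      simp
    · have : ρ.weight i = 0 := by simpa [FDist.mem_supp] using hi
      rw [this, Finset.sum_eq_zero]
      intro o _
      simp [Finsupp.filter_apply, this]
  · have h : (ρ.weight.filter fun i => m i = o) i ≠ 0 := by
      rw [← hκ o]
      simpa using ⟨FDist.mem_supp.1 ho, FDist.mem_supp.1 hi⟩
    rw [Finsupp.filter_apply] at h
    split_ifs at h with h'
    · exact ⟨FDist.mem_supp.2 h, h'⟩
    · exact absurd rfl h

/-! ## Couplings of bounded cost -/

/-- `γ` and `η` have a matching of `d`-cost at most `c`. -/
def Coupled (d : O → O' → unitInterval) (c : ℝ) (γ : FDist O) (η : FDist O') : Prop :=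
  ∃ ω : FDist (O × O'), ω.map Prod.fst = γ ∧ ω.map Prod.snd = η ∧
    (ω.ex fun p => (d p.1 p.2 : ℝ)) ≤ c

theorem Coupled.mono {d : O → O' → unitInterval} {c c' : ℝ} {γ : FDist O} {η : FDist O'}
    (h : Coupled d c γ η) (hc : c ≤ c') : Coupled d c' γ η := by
  obtain ⟨ω, h1, h2, h3⟩ := h
  exact ⟨ω, h1, h2, h3.trans hc⟩

/-- The product matching works because `d ≤ 1`. Pairs at distance `1` thus impose no condition. -/
theorem coupled_of_one_le {d : O → O' → unitInterval} {c : ℝ} (hc : 1 ≤ c) (γ : FDist O)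
    (η : FDist O') : Coupled d c γ η := by
  refine ⟨γ.prod η, FDist.ext_ex fun f => ?_, FDist.ext_ex fun f => ?_, le_trans ?_ hc⟩
  · simp [FDist.prod, FDist.ex_const]
  · simp [FDist.prod, FDist.ex_const]
  · rw [← FDist.ex_const (γ.prod η) 1]
    exact FDist.ex_mono fun p _ => (d p.1 p.2).2.2

theorem coupled_refl {d : O → O → unitInterval} (hd : ∀ x, d x x = 0) (γ : FDist O) :
    Coupled d 0 γ γ := by
  refine ⟨γ.map fun o => (o, o), ?_, ?_, ?_⟩
  · simp [FDist.map_map, FDist.map_id']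
  · simp [FDist.map_map, FDist.map_id']
  · simp [hd, FDist.ex_const]

theorem Coupled.swap {d : O → O → unitInterval} (hd : ∀ x y, d x y = d y x) {c : ℝ}
    {γ η : FDist O} (h : Coupled d c γ η) : Coupled d c η γ := by
  obtain ⟨ω, h1, h2, h3⟩ := h
  refine ⟨ω.map Prod.swap, by simpa [FDist.map_map] using h2, by simpa [FDist.map_map] using h1, ?_⟩
  rw [FDist.ex_map]
  refine le_of_eq_of_le (FDist.ex_congr fun p _ => ?_) h3
  rw [hd]
  rfl

theorem Coupled.one_le {d : O → O' → unitInterval} {c : ℝ} {γ : FDist O} {η : FDist O'}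
    (h : Coupled d c γ η) (h1 : ∀ x ∈ γ.supp, ∀ y ∈ η.supp, d x y = 1) : 1 ≤ c := by
  obtain ⟨ω, rfl, rfl, h3⟩ := h
  rw [← FDist.ex_const ω 1]
  refine (FDist.ex_mono fun p hp => ?_).trans h3
  rw [h1 _ (FDist.mem_supp_map.2 ⟨p, hp, rfl⟩) _ (FDist.mem_supp_map.2 ⟨p, hp, rfl⟩)]
  rfl

/-- Against a point distribution the matching is forced, so its cost is an average of distances to
`y`. -/
theorem Coupled.ex_le_of_dirac {d : O → O' → unitInterval} {c : ℝ} {γ : FDist O} {y : O'}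
    (h : Coupled d c γ (.dirac y)) : (γ.ex fun x => (d x y : ℝ)) ≤ c := by
  obtain ⟨ω, rfl, h2, h3⟩ := h
  rw [FDist.ex_map]
  refine le_of_eq_of_le (FDist.ex_congr fun p hp => ?_) h3
  have : p.2 ∈ (FDist.dirac y).supp := h2 ▸ FDist.mem_supp_map.2 ⟨p, hp, rfl⟩
  rw [FDist.mem_supp_dirac.1 this]

theorem coupled_dirac (d : O → O' → unitInterval) (x : O) (y : O') :
    Coupled d (d x y) (.dirac x) (.dirac y) :=
  ⟨.dirac (x, y), FDist.map_dirac _ _, FDist.map_dirac _ _, by simp⟩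

theorem Coupled.bind {d : O → O' → unitInterval} {ρ : FDist ι} {c : ι → ℝ} {γ : ι → FDist O}
    {η : ι → FDist O'} (h : ∀ i ∈ ρ.supp, Coupled d (c i) (γ i) (η i)) :
    Coupled d (ρ.ex c) (ρ.bind γ) (ρ.bind η) := by
  classical
  let ω : ι → FDist (O × O') := fun i =>
    if hi : i ∈ ρ.supp then (h i hi).choose else (γ i).prod (η i)
  have hω : ∀ i ∈ ρ.supp, (ω i).map Prod.fst = γ i ∧ (ω i).map Prod.snd = η i ∧
      ((ω i).ex fun p => (d p.1 p.2 : ℝ)) ≤ c i := by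
    intro i hi
    simp only [ω, dif_pos hi]
    exact (h i hi).choose_spec
  refine ⟨ρ.bind ω, ?_, ?_, ?_⟩
  · rw [FDist.map_bind]; exact FDist.bind_congr fun i hi => (hω i hi).1
  · rw [FDist.map_bind]; exact FDist.bind_congr fun i hi => (hω i hi).2.1
  · rw [FDist.ex_bind]; exact FDist.ex_mono fun i hi => (hω i hi).2.2

/-- A coupling with a mixture splits into couplings with the components. -/
theorem Coupled.split {d : O → O' → unitInterval} {c : ℝ} {γ : FDist O} {ρ : FDist ι}
    {e : ι → FDist O'} (h : Coupled d c γ (ρ.bind e)) :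
    ∃ (x : ι → FDist O) (c' : ι → ℝ), γ = ρ.bind x ∧ ρ.ex c' ≤ c ∧
      ∀ i ∈ ρ.supp, Coupled d (c' i) (x i) (e i) := by
  obtain ⟨ω, rfl, h2, h3⟩ := h
  obtain ⟨κ, hκ, hκs⟩ := ω.exists_disintegration Prod.snd
  rw [h2] at hκ hκs
  -- Draw `y` from `e i`, then a pair of `ω` conditioned on its second component being `y`; averaged
  -- over `i` this is `ω` again.
  let ω' : ι → FDist (O × O') := fun i => (e i).bind κ
  have hω : ω = ρ.bind ω' := by rw [hκ, FDist.bind_assoc]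
  refine ⟨fun i => (ω' i).map Prod.fst, fun i => (ω' i).ex fun p => (d p.1 p.2 : ℝ), ?_, ?_,
    fun i hi => ⟨ω' i, rfl, ?_, le_rfl⟩⟩
  · rw [← FDist.map_bind, ← hω]
  · rwa [← FDist.ex_bind, ← hω]
  · rw [FDist.map_bind]
    conv_rhs => rw [← FDist.bind_dirac (e i)]
    refine FDist.bind_congr fun y hy => FDist.eq_dirac fun z hz => ?_
    obtain ⟨p, hp, rfl⟩ := FDist.mem_supp_map.1 hz
    exact (hκs y (FDist.mem_supp_bind.2 ⟨i, hi, hy⟩) p hp).2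

/-- Gluing: given the middle point, the two matchings are drawn independently from their conditional
distributions. Three cost functions appear because the lemma serves before the triangle inequality
of `limitMetric` is known, with `pathMetric` as the third. -/
theorem Coupled.trans {d₁ : O → O' → unitInterval} {d₂ : O' → O'' → unitInterval}
    {d₃ : O → O'' → unitInterval} {c₁ c₂ : ℝ} {γ : FDist O} {η : FDist O'} {θ : FDist O''}
    (h₁ : Coupled d₁ c₁ γ η) (h₂ : Coupled d₂ c₂ η θ)
    (hd : ∀ x y z, (d₃ x z : ℝ) ≤ d₁ x y + d₂ y z) : Coupled d₃ (c₁ + c₂) γ θ := by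
  obtain ⟨ω, hω1, hω2, hω3⟩ := h₁
  obtain ⟨ω', hω1', hω2', hω3'⟩ := h₂
  obtain ⟨κ, hκ, hκs⟩ := ω.exists_disintegration Prod.snd
  obtain ⟨κ', hκ', hκs'⟩ := ω'.exists_disintegration Prod.fst
  rw [hω2] at hκ hκs
  rw [hω1'] at hκ' hκs'
  refine ⟨η.bind fun y => (κ y).bind fun p => (κ' y).map fun q => (p.1, q.2), ?_, ?_, ?_⟩
  · rw [← hω1]
    conv_rhs => rw [hκ]
    exact FDist.ext_ex fun f => by simp [FDist.ex_const]
  · rw [← hω2']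
    conv_rhs => rw [hκ']
    exact FDist.ext_ex fun f => by simp [FDist.ex_const]
  · rw [hκ, FDist.ex_bind] at hω3
    rw [hκ', FDist.ex_bind] at hω3'
    refine le_trans ?_ (add_le_add hω3 hω3')
    rw [← FDist.ex_add, FDist.ex_bind]
    refine FDist.ex_mono fun y hy => ?_
    simp only [FDist.ex_bind, FDist.ex_map]
    rw [← FDist.ex_const (κ y) ((κ' y).ex _), ← FDist.ex_add]
    refine FDist.ex_mono fun p hp => ?_
    rw [← FDist.ex_const (κ' y) (d₁ p.1 p.2 : ℝ), ← FDist.ex_add]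
    refine FDist.ex_mono fun q hq => ?_
    have hp2 := (hκs y hy p hp).2
    have hq1 := (hκs' y hy q hq).2
    have := hd p.1 y q.2
    rw [hp2, hq1]
    exact this

theorem Coupled.kantorovich_le {d : O → O → unitInterval} {c : unitInterval} {γ η : FDist O}
    (h : Coupled d c γ η) : kantorovich d γ η ≤ c := by
  obtain ⟨ω, h1, h2, h3⟩ := h
  exact (iInf₂_le ω ⟨h1, h2⟩).trans h3

/-- The strict inequality makes it unnecessary to know that the infimum over matchings is attained.
-/
theorem coupled_of_kantorovich_lt {d : O → O → unitInterval} {c : unitInterval} {γ η : FDist O}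
    (h : kantorovich d γ η < c) : Coupled d c γ η := by
  rw [kantorovich, iInf_lt_iff] at h
  obtain ⟨ω, h⟩ := h
  rw [iInf_lt_iff] at h
  obtain ⟨⟨h1, h2⟩, h⟩ := h
  exact ⟨ω, h1, h2, le_of_lt h⟩

end Distributions

/-! ## Processes -/

section Processes

variable {g : Signature.{u}}

theorem mem_supp_choice {k : ℕ} {p : Weights k} {C : Fin k → Proc g} {Q : Proc g}
    (h : Q ∈ (choice p C).supp) : ∃ i, Q = C i := by
  by_contra! hne
  refine FDist.mem_supp.1 h ?_
  rw [choice, Finsupp.finsetSum_apply]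
  refine Finset.sum_eq_zero fun i _ => ?_
  simp [FDist.dirac, (hne i).symm]

theorem mem_supp_parDist {π₁ π₂ : FDist (Proc g)} {Q : Proc g} :
    Q ∈ (parDist π₁ π₂).supp ↔ ∃ Q₁ ∈ π₁.supp, ∃ Q₂ ∈ π₂.supp, Q = .par Q₁ Q₂ := by
  rw [parDist, FDist.mem_supp_map]
  constructor
  · rintro ⟨⟨a, b⟩, h, rfl⟩
    obtain ⟨h1, h2⟩ := FDist.mem_supp_prod.1 h
    exact ⟨a, h1, b, h2, rfl⟩
  · rintro ⟨a, h1, b, h2, rfl⟩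
    exact ⟨(a, b), FDist.mem_supp_prod.2 ⟨h1, h2⟩, rfl⟩

theorem mem_supp_resDist {π : FDist (Proc g)} {c : g.Chan} {Q : Proc g} :
    Q ∈ (resDist π c).supp ↔ ∃ Q' ∈ π.supp, Q = .res Q' c := by
  rw [resDist, FDist.mem_supp_map]
  simp [eq_comm]

/-- The size of the part of a process that is executed within the current time slot. -/
def Proc.usize : Proc g → ℕ
  | .nil => 1
  | .tick _ _ => 1
  | .par P Q => 1 + P.usize + Q.usize
  | .output _ _ _ C _ _ => 1 + ∑ i, (C i).usize
  | .input _ _ C _ _ => 1 + ∑ i, (C i).usize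
  | .sense _ _ C => 1 + ∑ i, (C i).usize
  | .write _ _ _ C => 1 + ∑ i, (C i).usize
  | .ite _ P Q => 1 + P.usize + Q.usize
  | .res P _ => 1 + P.usize
  | .var _ => 1
  | .fix P => 1 + P.usize

theorem Proc.usize_pos (P : Proc g) : 0 < P.usize := by
  cases P <;> simp only [Proc.usize] <;> omega

/-! ### Size and well-formedness under substitution. -/

theorem Proc.usize_substVal (v : Val g) (P : Proc g) (k : ℕ) :
    (P.substVal v k).usize = P.usize := by
  induction P generalizing k <;> simp_all [Proc.substVal, Proc.usize]

theorem Proc.timeGuards_substVal (v : Val g) (P : Proc g) (k m : ℕ) :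
    (P.substVal v k).TimeGuards m ↔ P.TimeGuards m := by
  induction P generalizing k m <;> simp_all [Proc.substVal, Proc.TimeGuards]

theorem Proc.guarded_substVal (v : Val g) (P : Proc g) (k : ℕ) :
    (P.substVal v k).Guarded ↔ P.Guarded := by
  induction P generalizing k <;>
    simp_all [Proc.substVal, Proc.Guarded, Proc.timeGuards_substVal]

theorem Proc.devicesIn_substVal {S : Set g.Sensor} {A : Set g.Actuator} (v : Val g) (P : Proc g)
    (k : ℕ) : (P.substVal v k).DevicesIn S A ↔ P.DevicesIn S A := by
  induction P generalizing k <;> simp_all [Proc.substVal, Proc.DevicesIn]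

theorem ValTerm.closedAt_subst {v : Val g} {e : ValTerm g} {n : ℕ} (h : e.ClosedAt (n + 1)) :
    (e.subst n v).ClosedAt n := by
  cases e with
  | const w => trivial
  | var i =>
    simp only [ValTerm.ClosedAt] at h
    simp only [ValTerm.subst]
    split_ifs
    · trivial
    · omega
    · simp only [ValTerm.ClosedAt]; omega

theorem Proc.closedAt_substVal {v : Val g} {P : Proc g} {n m : ℕ} (h : P.ClosedAt (n + 1) m) :
    (P.substVal v n).ClosedAt n m := by
  induction P generalizing n m <;>
    simp_all [Proc.substVal, Proc.ClosedAt, Guard.subst, ValTerm.closedAt_subst]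

theorem ValTerm.ClosedAt.mono {e : ValTerm g} {n n' : ℕ} (h : e.ClosedAt n) (hn : n ≤ n') :
    e.ClosedAt n' := by
  cases e with
  | const w => trivial
  | var i => exact lt_of_lt_of_le h hn

theorem Proc.ClosedAt.mono {P : Proc g} {n n' m m' : ℕ} (h : P.ClosedAt n m) (hn : n ≤ n')
    (hm : m ≤ m') : P.ClosedAt n' m' := by
  induction P generalizing n n' m m' with
  | nil => trivial
  | tick p C ih => exact fun i => ih i (h i) hn hm
  | par P Q ihP ihQ => exact ⟨ihP h.1 hn hm, ihQ h.2 hn hm⟩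
  | output c e p C q D ihC ihD =>
    exact ⟨h.1.mono hn, fun i => ihC i (h.2.1 i) hn hm, fun i => ihD i (h.2.2 i) hn hm⟩
  | input c p C q D ihC ihD =>
    exact ⟨fun i => ihC i (h.1 i) (by omega) hm, fun i => ihD i (h.2 i) hn hm⟩
  | sense s p C ih => exact fun i => ih i (h i) (by omega) hm
  | write a e p C ih => exact ⟨h.1.mono hn, fun i => ih i (h.2 i) hn hm⟩
  | ite b P Q ihP ihQ =>
    exact ⟨fun i => (h.1 i).mono hn, ihP h.2.1 hn hm, ihQ h.2.2 hn hm⟩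
  | res P c ih => exact ih h hn hm
  | var i => exact lt_of_lt_of_le h hm
  | fix P ih => exact ih (m := m + 1) (m' := m' + 1) h hn (by omega)

/-- Vacuous guardedness: `j` does not occur free in `P`. -/
theorem Proc.ClosedAt.timeGuards {P : Proc g} {n m j : ℕ} (h : P.ClosedAt n m) (hj : m ≤ j) :
    P.TimeGuards j := by
  induction P generalizing n m j with
  | nil => trivial
  | tick p C ih => trivial
  | par P Q ihP ihQ => exact ⟨ihP h.1 hj, ihQ h.2 hj⟩
  | output c e p C q D ihC ihD => exact fun i => ihC i (h.2.1 i) hj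
  | input c p C q D ihC ihD => exact fun i => ihC i (h.1 i) hj
  | sense s p C ih => exact fun i => ih i (h i) hj
  | write a e p C ih => exact fun i => ih i (h.2 i) hj
  | ite b P Q ihP ihQ => exact ⟨ihP h.2.1 hj, ihQ h.2.2 hj⟩
  | res P c ih => exact ih h hj
  | var i => exact (lt_of_lt_of_le h hj).ne
  | fix P ih => exact ih (m := m + 1) (j := j + 1) h (by omega)

/-- Time-guarded occurrences lie exactly in the subterms that `usize` ignores. -/
theorem Proc.usize_substProc {R P : Proc g} {k : ℕ} (h : P.TimeGuards k) :
    (Proc.substProc R k P).usize = P.usize := by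
  induction P generalizing k with
  | var n =>
    simp only [Proc.TimeGuards] at h
    simp only [Proc.substProc, if_neg h]
    split_ifs <;> rfl
  | _ => simp_all [Proc.substProc, Proc.usize, Proc.TimeGuards]

theorem Proc.closedAt_substProc {R P : Proc g} (hR : R.ClosedAt 0 0) {n m : ℕ}
    (h : P.ClosedAt n (m + 1)) : (Proc.substProc R m P).ClosedAt n m := by
  induction P generalizing n m with
  | var i =>
    simp only [Proc.ClosedAt] at h
    simp only [Proc.substProc]
    split_ifs
    · exact hR.mono (Nat.zero_le _) (Nat.zero_le _)
    · omega
    · simp only [Proc.ClosedAt]; omega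
  | _ => simp_all [Proc.substProc, Proc.ClosedAt]

theorem Proc.timeGuards_substProc {R P : Proc g} (hR : R.ClosedAt 0 0) {j k : ℕ} (hjk : j < k)
    (h : P.TimeGuards j) : (Proc.substProc R k P).TimeGuards j := by
  induction P generalizing j k with
  | var i =>
    simp only [Proc.TimeGuards] at h
    simp only [Proc.substProc]
    split_ifs
    · exact hR.timeGuards (Nat.zero_le _)
    · simp only [Proc.TimeGuards]; omega
    · exact h
  | _ => simp_all [Proc.substProc, Proc.TimeGuards]

theorem Proc.guarded_substProc {R P : Proc g} (hR : R.ClosedAt 0 0) (hR' : R.Guarded) {k : ℕ}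
    (h : P.Guarded) : (Proc.substProc R k P).Guarded := by
  induction P generalizing k with
  | var i =>
    simp only [Proc.substProc]
    split_ifs
    · exact hR'
    · trivial
    · trivial
  | fix P ih =>
    exact ⟨Proc.timeGuards_substProc hR (Nat.succ_pos k) h.1, ih h.2⟩
  | _ => simp_all [Proc.substProc, Proc.Guarded]

theorem Proc.devicesIn_substProc {S : Set g.Sensor} {A : Set g.Actuator} {R P : Proc g}
    (hR : R.DevicesIn S A) {k : ℕ} (h : P.DevicesIn S A) :
    (Proc.substProc R k P).DevicesIn S A := by
  induction P generalizing k with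
  | var i =>
    simp only [Proc.substProc]
    split_ifs
    · exact hR
    · trivial
    · trivial
  | _ => simp_all [Proc.substProc, Proc.DevicesIn]

/-- Closed up to `n` value variables, time-guarded, and with devices in `S` and `A`. -/
structure Proc.Ok (S : Set g.Sensor) (A : Set g.Actuator) (n : ℕ) (P : Proc g) : Prop where
  closed : P.ClosedAt n 0
  guarded : P.Guarded
  devices : P.DevicesIn S A

variable {S : Set g.Sensor} {A : Set g.Actuator}

theorem Proc.Ok.mono {P : Proc g} {n n' : ℕ} (h : P.Ok S A n) (hn : n ≤ n') : P.Ok S A n' :=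
  ⟨h.closed.mono hn le_rfl, h.guarded, h.devices⟩

theorem Proc.Ok.par {P Q : Proc g} {n : ℕ} (hP : P.Ok S A n) (hQ : Q.Ok S A n) :
    (Proc.par P Q).Ok S A n :=
  ⟨⟨hP.closed, hQ.closed⟩, ⟨hP.guarded, hQ.guarded⟩, ⟨hP.devices, hQ.devices⟩⟩

theorem Proc.Ok.of_par {P Q : Proc g} {n : ℕ} (h : (Proc.par P Q).Ok S A n) :
    P.Ok S A n ∧ Q.Ok S A n :=
  ⟨⟨h.closed.1, h.guarded.1, h.devices.1⟩, ⟨h.closed.2, h.guarded.2, h.devices.2⟩⟩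

theorem Proc.Ok.of_ite {b : Guard g} {P Q : Proc g} {n : ℕ} (h : (Proc.ite b P Q).Ok S A n) :
    P.Ok S A n ∧ Q.Ok S A n :=
  ⟨⟨h.closed.2.1, h.guarded.1, h.devices.1⟩, ⟨h.closed.2.2, h.guarded.2, h.devices.2⟩⟩

theorem Proc.Ok.unfold {P : Proc g} (h : (Proc.fix P).Ok S A 0) :
    (Proc.substProc (.fix P) 0 P).Ok S A 0 :=
  ⟨Proc.closedAt_substProc h.closed h.closed,
    Proc.guarded_substProc h.closed h.guarded h.guarded.2,
    Proc.devicesIn_substProc h.devices h.devices⟩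

/-- Unfolding removes the `fix` node and adds nothing to the current time slot. Induction on `usize`
can therefore pass through recursion, where structural induction fails. -/
theorem Proc.Ok.usize_unfold {P : Proc g} (h : (Proc.fix P).Ok S A 0) :
    (Proc.substProc (.fix P) 0 P).usize < (Proc.fix P).usize := by
  rw [Proc.usize_substProc h.guarded.1, Proc.usize]
  omega

theorem Proc.Ok.substVal {P : Proc g} {n : ℕ} (h : P.Ok S A (n + 1)) (v : Val g) :
    (P.substVal v n).Ok S A n :=
  ⟨Proc.closedAt_substVal h.closed, (Proc.guarded_substVal v P n).2 h.guarded,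
    (Proc.devicesIn_substVal v P n).2 h.devices⟩

/-- The number of value variables that are bound by a label. -/
def Label.binds : Label g → ℕ
  | .sns _ => 1
  | _ => 0

theorem lt_usize_sum {k : ℕ} (C : Fin k → Proc g) (i : Fin k) :
    (C i).usize < 1 + ∑ j, (C j).usize := by
  have := Finset.single_le_sum (f := fun j => (C j).usize) (fun _ _ => Nat.zero_le _)
    (Finset.mem_univ i)
  omega

/-- The strict decrease bounds the number of consecutive untimed steps. After a sensor label one
value variable is still free, awaiting the reading. -/
theorem Proc.Untimed.ok {P : Proc g} {lam : Label g} {π : FDist (Proc g)}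
    (h : P.Untimed lam π) (hP : P.Ok S A 0) :
    ∀ Q ∈ π.supp, Q.Ok S A lam.binds ∧ Q.usize < P.usize := by
  induction h with
  | outp =>
    intro Q hQ
    obtain ⟨i, rfl⟩ := mem_supp_choice hQ
    exact ⟨⟨hP.closed.2.1 i, hP.guarded.1 i, hP.devices.1 i⟩, lt_usize_sum _ i⟩
  | inpp v =>
    intro Q hQ
    obtain ⟨i, rfl⟩ := mem_supp_choice hQ
    refine ⟨Proc.Ok.substVal ⟨hP.closed.1 i, hP.guarded.1 i, hP.devices.1 i⟩ v, ?_⟩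
    rw [Proc.usize_substVal]
    exact lt_usize_sum _ i
  | write =>
    intro Q hQ
    obtain ⟨i, rfl⟩ := mem_supp_choice hQ
    exact ⟨⟨hP.closed.2 i, hP.guarded i, hP.devices.2 i⟩, lt_usize_sum _ i⟩
  | read =>
    intro Q hQ
    obtain ⟨i, rfl⟩ := mem_supp_choice hQ
    exact ⟨⟨hP.closed i, hP.guarded i, hP.devices.2 i⟩, lt_usize_sum _ i⟩
  | comL _ _ ih₁ ih₂ =>
    intro Q hQ
    obtain ⟨Q₁, h₁, Q₂, h₂, rfl⟩ := mem_supp_parDist.1 hQ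
    have h₁ := ih₁ hP.of_par.1 Q₁ h₁
    have h₂ := ih₂ hP.of_par.2 Q₂ h₂
    refine ⟨h₁.1.par h₂.1, ?_⟩
    simp only [Proc.usize]; omega
  | comR _ _ ih₁ ih₂ =>
    intro Q hQ
    obtain ⟨Q₁, h₁, Q₂, h₂, rfl⟩ := mem_supp_parDist.1 hQ
    have h₁ := ih₁ hP.of_par.1 Q₁ h₁
    have h₂ := ih₂ hP.of_par.2 Q₂ h₂
    refine ⟨h₁.1.par h₂.1, ?_⟩
    simp only [Proc.usize]; omega
  | parL _ ih =>
    intro Q hQ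
    obtain ⟨Q₁, h₁, Q₂, h₂, rfl⟩ := mem_supp_parDist.1 hQ
    have h₁ := ih hP.of_par.1 Q₁ h₁
    obtain rfl := FDist.mem_supp_dirac.1 h₂
    refine ⟨h₁.1.par (hP.of_par.2.mono (Nat.zero_le _)), ?_⟩
    simp only [Proc.usize]; omega
  | parR _ ih =>
    intro Q hQ
    obtain ⟨Q₁, h₁, Q₂, h₂, rfl⟩ := mem_supp_parDist.1 hQ
    have h₂ := ih hP.of_par.2 Q₂ h₂
    obtain rfl := FDist.mem_supp_dirac.1 h₁
    refine ⟨(hP.of_par.1.mono (Nat.zero_le _)).par h₂.1, ?_⟩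
    simp only [Proc.usize]; omega
  | chnRes _ _ _ ih =>
    intro Q hQ
    obtain ⟨Q', h', rfl⟩ := mem_supp_resDist.1 hQ
    have h' := ih ⟨hP.closed, hP.guarded, hP.devices⟩ Q' h'
    refine ⟨⟨h'.1.closed, h'.1.guarded, h'.1.devices⟩, ?_⟩
    simp only [Proc.usize]; omega
  | unfold _ ih =>
    intro Q hQ
    have h' := ih hP.unfold Q hQ
    exact ⟨h'.1, h'.2.trans hP.usize_unfold⟩
  | iteTrue _ _ ih =>
    intro Q hQ
    have h' := ih hP.of_ite.1 Q hQ
    refine ⟨h'.1, ?_⟩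
    simp only [Proc.usize]; omega
  | iteFalse _ _ ih =>
    intro Q hQ
    have h' := ih hP.of_ite.2 Q hQ
    refine ⟨h'.1, ?_⟩
    simp only [Proc.usize]; omega

theorem Proc.Untimed.devices {P : Proc g} {lam : Label g} {π : FDist (Proc g)}
    (h : P.Untimed lam π) (hP : P.DevicesIn S A) :
    (∀ s, lam = .sns s → s ∈ S) ∧ ∀ a v, lam = .wrt a v → a ∈ A := by
  induction h with
  | outp => simp
  | inpp v => simp
  | write =>
    refine ⟨by simp, ?_⟩
    rintro a v ⟨⟩
    exact hP.1
  | read =>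
    refine ⟨?_, by simp⟩
    rintro s ⟨⟩
    exact hP.1
  | comL => simp
  | comR => simp
  | parL _ ih => exact ih hP.1
  | parR _ ih => exact ih hP.2
  | chnRes _ _ _ ih => exact ih hP
  | unfold _ ih => exact ih (Proc.devicesIn_substProc hP hP)
  | iteTrue _ _ ih => exact ih hP.1
  | iteFalse _ _ ih => exact ih hP.2

theorem Proc.Timed.ok {P : Proc g} {π : FDist (Proc g)} (h : P.Timed π) (hP : P.Ok S A 0) :
    ∀ Q ∈ π.supp, Q.Ok S A 0 := by
  induction h with
  | timeNil =>
    intro Q hQ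
    obtain rfl := FDist.mem_supp_dirac.1 hQ
    exact hP
  | delay =>
    intro Q hQ
    obtain ⟨i, rfl⟩ := mem_supp_choice hQ
    exact ⟨hP.closed i, hP.guarded i, hP.devices i⟩
  | timeoutOut =>
    intro Q hQ
    obtain ⟨i, rfl⟩ := mem_supp_choice hQ
    exact ⟨hP.closed.2.2 i, hP.guarded.2 i, hP.devices.2 i⟩
  | timeoutIn =>
    intro Q hQ
    obtain ⟨i, rfl⟩ := mem_supp_choice hQ
    exact ⟨hP.closed.2 i, hP.guarded.2 i, hP.devices.2 i⟩
  | timePar _ _ _ ih₁ ih₂ =>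
    intro Q hQ
    obtain ⟨Q₁, h₁, Q₂, h₂, rfl⟩ := mem_supp_parDist.1 hQ
    exact (ih₁ hP.of_par.1 Q₁ h₁).par (ih₂ hP.of_par.2 Q₂ h₂)
  | chnRes _ ih =>
    intro Q hQ
    obtain ⟨Q', h', rfl⟩ := mem_supp_resDist.1 hQ
    have h' := ih ⟨hP.closed, hP.guarded, hP.devices⟩ Q' h'
    exact ⟨h'.closed, h'.guarded, h'.devices⟩
  | unfold _ ih => exact ih hP.unfold
  | iteTrue _ _ ih => exact ih hP.of_ite.1
  | iteFalse _ _ ih => exact ih hP.of_ite.2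

theorem Guard.exists_evalsTo {b : Guard g} (h : ∀ i, (b.args i).ClosedAt 0) :
    b.EvalsTo true ∨ b.EvalsTo false := by
  have hv : ∀ i, ∃ v, b.args i = .const v := by
    intro i
    have := h i
    revert this
    cases b.args i with
    | const v => exact fun _ => ⟨v, rfl⟩
    | var n => exact fun h => absurd h (Nat.not_lt_zero n)
  choose v hv using hv
  cases ht : b.test v
  · exact Or.inr ⟨v, hv, ht⟩
  · exact Or.inl ⟨v, hv, ht⟩

/-- A process that cannot communicate internally nor access a device lets time pass. -/
theorem Proc.Ok.exists_timed {P : Proc g} (hP : P.Ok S A 0)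
    (hτ : ∀ π, ¬ P.Untimed .tau π) (hs : ∀ s π, ¬ P.Untimed (.sns s) π)
    (hw : ∀ a v π, ¬ P.Untimed (.wrt a v) π) : ∃ π, P.Timed π := by
  induction hn : P.usize using Nat.strong_induction_on generalizing P with
  | _ n ih =>
    subst hn
    cases P with
    | nil => exact ⟨_, .timeNil⟩
    | tick p C => exact ⟨_, .delay⟩
    | par P Q =>
      obtain ⟨π₁, h₁⟩ := ih P.usize (by simp only [Proc.usize]; omega) hP.of_par.1
        (fun π h => hτ _ (.parL h)) (fun s π h => hs _ _ (.parL h))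
        (fun a v π h => hw _ _ _ (.parL h)) rfl
      obtain ⟨π₂, h₂⟩ := ih Q.usize (by simp only [Proc.usize]; omega) hP.of_par.2
        (fun π h => hτ _ (.parR h)) (fun s π h => hs _ _ (.parR h))
        (fun a v π h => hw _ _ _ (.parR h)) rfl
      exact ⟨_, .timePar h₁ h₂ fun ⟨π, h⟩ => hτ π h⟩
    | output c e p C q D => exact ⟨_, .timeoutOut⟩
    | input c p C q D => exact ⟨_, .timeoutIn⟩
    | sense s p C => exact absurd .read (hs s _)
    | write a e p C =>
      have he := hP.closed.1
      cases e with
      | const v => exact absurd .write (hw a v _)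
      | var n => exact absurd he (Nat.not_lt_zero n)
    | ite b P Q =>
      rcases Guard.exists_evalsTo hP.closed.1 with hb | hb
      · obtain ⟨π, h⟩ := ih P.usize (by simp only [Proc.usize]; omega) hP.of_ite.1
          (fun π h => hτ _ (.iteTrue hb h)) (fun s π h => hs _ _ (.iteTrue hb h))
          (fun a v π h => hw _ _ _ (.iteTrue hb h)) rfl
        exact ⟨π, .iteTrue hb h⟩
      · obtain ⟨π, h⟩ := ih Q.usize (by simp only [Proc.usize]; omega) hP.of_ite.2
          (fun π h => hτ _ (.iteFalse hb h)) (fun s π h => hs _ _ (.iteFalse hb h))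
          (fun a v π h => hw _ _ _ (.iteFalse hb h)) rfl
        exact ⟨π, .iteFalse hb h⟩
    | res P c =>
      obtain ⟨π, h⟩ := ih P.usize (by simp only [Proc.usize]; omega) (P := P)
        ⟨hP.closed, hP.guarded, hP.devices⟩
        (fun π h => hτ _ (.chnRes h (by simp) (by simp)))
        (fun s π h => hs _ _ (.chnRes h (by simp) (by simp)))
        (fun a v π h => hw _ _ _ (.chnRes h (by simp) (by simp))) rfl
      exact ⟨_, .chnRes h⟩
    | var n => exact absurd hP.closed (Nat.not_lt_zero n)
    | fix P =>
      obtain ⟨π, h⟩ := ih _ hP.usize_unfold hP.unfold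
        (fun π h => hτ _ (.unfold h)) (fun s π h => hs _ _ (.unfold h))
        (fun a v π h => hw _ _ _ (.unfold h)) rfl
      exact ⟨π, .unfold h⟩

/-- The process has finitely many outputs, accesses finitely many devices, and has finitely many
transitions for each label. -/
structure Proc.FiniteBranching (P : Proc g) : Prop where
  untimed : ∀ lam, {π | P.Untimed lam π}.Finite
  outputs : {x : g.Chan × Val g | ∃ π, P.Untimed (.out x.1 x.2) π}.Finite
  sensors : {s | ∃ π, P.Untimed (.sns s) π}.Finite
  writes : {x : g.Actuator × Val g | ∃ π, P.Untimed (.wrt x.1 x.2) π}.Finite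
  timed : {π | P.Timed π}.Finite

theorem Proc.FiniteBranching.of_imp {P Q : Proc g} (h : Q.FiniteBranching)
    (hu : ∀ lam π, P.Untimed lam π → Q.Untimed lam π) (ht : ∀ π, P.Timed π → Q.Timed π) :
    P.FiniteBranching where
  untimed lam := (h.untimed lam).subset (hu lam)
  outputs := h.outputs.subset fun _ ⟨π, hπ⟩ => ⟨π, hu _ _ hπ⟩
  sensors := h.sensors.subset fun _ ⟨π, hπ⟩ => ⟨π, hu _ _ hπ⟩
  writes := h.writes.subset fun _ ⟨π, hπ⟩ => ⟨π, hu _ _ hπ⟩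
  timed := h.timed.subset ht

theorem Guard.EvalsTo.unique {b : Guard g} {t t' : Bool} (h : b.EvalsTo t) (h' : b.EvalsTo t') :
    t = t' := by
  obtain ⟨v, hv, rfl⟩ := h
  obtain ⟨w, hw, rfl⟩ := h'
  congr 1
  funext i
  have := (hv i).symm.trans (hw i)
  simpa using this

/-- An input has one label for each value, possibly infinitely many. A communication takes its value
from an output, so finiteness of the outputs bounds the internal communications. -/
theorem Proc.FiniteBranching.par {P Q : Proc g} (hP : P.FiniteBranching)
    (hQ : Q.FiniteBranching) : (Proc.par P Q).FiniteBranching where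
  untimed lam := by
    refine Set.Finite.subset (s :=
      ((fun π => parDist π (.dirac Q)) '' {π | P.Untimed lam π} ∪
        (fun π => parDist (.dirac P) π) '' {π | Q.Untimed lam π}) ∪
      ((⋃ x ∈ {x : g.Chan × Val g | ∃ π, P.Untimed (.out x.1 x.2) π},
        Set.image2 parDist {π | P.Untimed (.out x.1 x.2) π} {π | Q.Untimed (.inp x.1 x.2) π}) ∪
       (⋃ x ∈ {x : g.Chan × Val g | ∃ π, Q.Untimed (.out x.1 x.2) π},
        Set.image2 parDist {π | P.Untimed (.inp x.1 x.2) π} {π | Q.Untimed (.out x.1 x.2) π})))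
      ?_ ?_
    · refine (((hP.untimed lam).image _).union ((hQ.untimed lam).image _)).union
        ((hP.outputs.biUnion fun x _ => ?_).union (hQ.outputs.biUnion fun x _ => ?_))
      · exact (hP.untimed _).image2 _ (hQ.untimed _)
      · exact (hP.untimed _).image2 _ (hQ.untimed _)
    · intro π h
      cases h with
      | @comL _ _ c v π₁ π₂ h₁ h₂ =>
        refine Or.inr (Or.inl ?_)
        exact Set.mem_biUnion (x := (c, v)) ⟨π₁, h₁⟩ ⟨π₁, h₁, π₂, h₂, rfl⟩
      | @comR _ _ c v π₁ π₂ h₁ h₂ =>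
        refine Or.inr (Or.inr ?_)
        exact Set.mem_biUnion (x := (c, v)) ⟨π₂, h₂⟩ ⟨π₁, h₁, π₂, h₂, rfl⟩
      | parL h => exact Or.inl (Or.inl ⟨_, h, rfl⟩)
      | parR h => exact Or.inl (Or.inr ⟨_, h, rfl⟩)
  outputs := by
    refine (hP.outputs.union hQ.outputs).subset ?_
    rintro x ⟨π, h⟩
    cases h with
    | parL h => exact Or.inl ⟨_, h⟩
    | parR h => exact Or.inr ⟨_, h⟩
  sensors := by
    refine (hP.sensors.union hQ.sensors).subset ?_
    rintro x ⟨π, h⟩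
    cases h with
    | parL h => exact Or.inl ⟨_, h⟩
    | parR h => exact Or.inr ⟨_, h⟩
  writes := by
    refine (hP.writes.union hQ.writes).subset ?_
    rintro x ⟨π, h⟩
    cases h with
    | parL h => exact Or.inl ⟨_, h⟩
    | parR h => exact Or.inr ⟨_, h⟩
  timed := by
    refine (hP.timed.image2 parDist hQ.timed).subset ?_
    intro π h
    cases h with
    | timePar h₁ h₂ _ => exact ⟨_, h₁, _, h₂, rfl⟩

theorem Proc.FiniteBranching.res {P : Proc g} (hP : P.FiniteBranching) (c : g.Chan) :
    (Proc.res P c).FiniteBranching where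
  untimed lam := by
    refine ((hP.untimed lam).image fun π => resDist π c).subset ?_
    intro π h
    cases h with
    | chnRes h => exact ⟨_, h, rfl⟩
  outputs := by
    refine hP.outputs.subset ?_
    rintro x ⟨π, h⟩
    cases h with
    | chnRes h => exact ⟨_, h⟩
  sensors := by
    refine hP.sensors.subset ?_
    rintro x ⟨π, h⟩
    cases h with
    | chnRes h => exact ⟨_, h⟩
  writes := by
    refine hP.writes.subset ?_
    rintro x ⟨π, h⟩
    cases h with
    | chnRes h => exact ⟨_, h⟩
  timed := by
    refine (hP.timed.image fun π => resDist π c).subset ?_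
    intro π h
    cases h with
    | chnRes h => exact ⟨_, h, rfl⟩

/-- A process is finitely branching if its labels other than inputs coincide, and its transitions
are determined by their labels. -/
theorem Proc.FiniteBranching.of_single {P : Proc g} (lam₀ : Label g)
    (hu : ∀ lam π, P.Untimed lam π → lam = lam₀ ∨ ∃ c v, lam = .inp c v)
    (hf : ∀ lam, {π | P.Untimed lam π}.Subsingleton) (ht : {π | P.Timed π}.Subsingleton) :
    P.FiniteBranching where
  untimed lam := (hf lam).finite
  outputs := Set.Subsingleton.finite <| by
    rintro ⟨c, v⟩ ⟨π, h⟩ ⟨c', v'⟩ ⟨π', h'⟩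
    have h1 := (hu _ _ h).resolve_right (by simp)
    have h2 := (hu _ _ h').resolve_right (by simp)
    have := h1.trans h2.symm
    simpa using this
  sensors := Set.Subsingleton.finite <| by
    rintro s ⟨π, h⟩ s' ⟨π', h'⟩
    have h1 := (hu _ _ h).resolve_right (by simp)
    have h2 := (hu _ _ h').resolve_right (by simp)
    have := h1.trans h2.symm
    simpa using this
  writes := Set.Subsingleton.finite <| by
    rintro ⟨c, v⟩ ⟨π, h⟩ ⟨c', v'⟩ ⟨π', h'⟩
    have h1 := (hu _ _ h).resolve_right (by simp)
    have h2 := (hu _ _ h').resolve_right (by simp)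
    have := h1.trans h2.symm
    simpa using this
  timed := ht.finite

theorem Proc.Ok.finiteBranching {P : Proc g} (hP : P.Ok S A 0) : P.FiniteBranching := by
  induction hn : P.usize using Nat.strong_induction_on generalizing P with
  | _ n ih =>
    subst hn
    cases P with
    | nil =>
      exact .of_single .tau (fun _ _ h => nomatch h) (fun _ _ h => nomatch h)
        (by rintro _ ⟨⟩ _ ⟨⟩; rfl)
    | tick p C =>
      exact .of_single .tau (fun _ _ h => nomatch h) (fun _ _ h => nomatch h)
        (by rintro _ ⟨⟩ _ ⟨⟩; rfl)
    | par P Q =>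
      exact .par (ih P.usize (by simp only [Proc.usize]; omega) hP.of_par.1 rfl)
        (ih Q.usize (by simp only [Proc.usize]; omega) hP.of_par.2 rfl)
    | output c e p C q D =>
      cases e with
      | const v =>
        refine .of_single (.out c v) ?_ ?_ (by rintro _ ⟨⟩ _ ⟨⟩; rfl)
        · rintro _ _ ⟨⟩; exact Or.inl rfl
        · rintro _ _ ⟨⟩ _ ⟨⟩; rfl
      | var n => exact absurd hP.closed.1 (Nat.not_lt_zero n)
    | input c p C q D =>
      refine .of_single .tau ?_ ?_ (by rintro _ ⟨⟩ _ ⟨⟩; rfl)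
      · rintro _ _ ⟨⟩; exact Or.inr ⟨_, _, rfl⟩
      · rintro _ _ ⟨⟩ _ ⟨⟩; rfl
    | sense s p C =>
      refine .of_single (.sns s) ?_ ?_ (by rintro _ ⟨⟩)
      · rintro _ _ ⟨⟩; exact Or.inl rfl
      · rintro _ _ ⟨⟩ _ ⟨⟩; rfl
    | write a e p C =>
      cases e with
      | const v =>
        refine .of_single (.wrt a v) ?_ ?_ (by rintro _ ⟨⟩)
        · rintro _ _ ⟨⟩; exact Or.inl rfl
        · rintro _ _ ⟨⟩ _ ⟨⟩; rfl
      | var n => exact absurd hP.closed.1 (Nat.not_lt_zero n)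
    | ite b P Q =>
      rcases Guard.exists_evalsTo hP.closed.1 with hb | hb
      · refine .of_imp (ih P.usize (by simp only [Proc.usize]; omega) hP.of_ite.1 rfl) ?_ ?_
        · intro lam π h
          cases h with
          | iteTrue _ h => exact h
          | iteFalse hb' _ => exact absurd (hb.unique hb') (by simp)
        · intro π h
          cases h with
          | iteTrue _ h => exact h
          | iteFalse hb' _ => exact absurd (hb.unique hb') (by simp)
      · refine .of_imp (ih Q.usize (by simp only [Proc.usize]; omega) hP.of_ite.2 rfl) ?_ ?_
        · intro lam π h
          cases h with
          | iteTrue hb' _ => exact absurd (hb.unique hb') (by simp)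
          | iteFalse _ h => exact h
        · intro π h
          cases h with
          | iteTrue hb' _ => exact absurd (hb.unique hb') (by simp)
          | iteFalse _ h => exact h
    | res P c =>
      exact .res (ih P.usize (by simp only [Proc.usize]; omega) (P := P)
        ⟨hP.closed, hP.guarded, hP.devices⟩ rfl) c
    | var n => exact absurd hP.closed (Nat.not_lt_zero n)
    | fix P =>
      refine .of_imp (ih _ hP.usize_unfold hP.unfold rfl) ?_ ?_
      · rintro _ _ ⟨⟩; assumption
      · rintro _ ⟨⟩; assumption

end Processes

/-! ## Cyber-physical systems -/

section Systems

variable {g : Signature.{u}}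

theorem mem_supp_sysDist {E : PhysEnv g} {σ : FDist (PhysState E)} {π : FDist (Proc g)}
    {N : RawCPS g} :
    N ∈ (sysDist E σ π).supp ↔ ∃ σ' ∈ σ.supp, ∃ Q ∈ π.supp, N = .sys E σ' Q := by
  rw [sysDist, FDist.mem_supp_map]
  constructor
  · rintro ⟨⟨a, b⟩, h, rfl⟩
    obtain ⟨h1, h2⟩ := FDist.mem_supp_prod.1 h
    exact ⟨a, h1, b, h2, rfl⟩
  · rintro ⟨a, h1, b, h2, rfl⟩
    exact ⟨(a, b), FDist.mem_supp_prod.2 ⟨h1, h2⟩, rfl⟩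

theorem RawCPS.WellFormed.ok {E : PhysEnv g} {σ : PhysState E} {P : Proc g}
    (h : (RawCPS.sys E σ P).WellFormed) : P.Ok E.S E.A 0 :=
  ⟨h.1, h.2.1, h.2.2⟩

theorem Proc.Ok.wellFormed {E : PhysEnv g} {P : Proc g} (h : P.Ok E.S E.A 0) (σ : PhysState E) :
    (RawCPS.sys E σ P).WellFormed :=
  ⟨h.closed, h.guarded, h.devices⟩

/-- A bound on the number of consecutive `τ`-transitions. -/
def RawCPS.rank : RawCPS g → ℕ
  | .dead => 0
  | .sys _ _ P => P.usize

/-- The system is not dead and its physical state satisfies the invariant. -/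
def RawCPS.InInv : RawCPS g → Prop
  | .dead => False
  | .sys E σ _ => σ.x ∈ E.inv

theorem PhysState.setActuator_x {E : PhysEnv g} (σ : PhysState E) (a : E.A) (v : Val g) :
    (σ.setActuator a v).x = σ.x := by
  cases v <;> rfl

/-- The rank drops even on deadlock, since `usize` is positive and `Dead` has rank `0`. The
invariant persists because no `τ`-transition from inside it changes the state variables: writing
affects actuators only. -/
theorem RawCPS.TauStep.facts {M : RawCPS g} {γ : FDist (RawCPS g)} (h : M.TauStep γ)
    (hM : M.WellFormed) : ∀ N ∈ γ.supp, N.WellFormed ∧ N.rank < M.rank ∧ (M.InInv → N.InInv) := by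
  cases h with
  | tau h hi =>
    intro N hN
    obtain ⟨σ', h1, Q, h2, rfl⟩ := mem_supp_sysDist.1 hN
    obtain rfl := FDist.mem_supp_dirac.1 h1
    have := h.ok hM.ok Q h2
    exact ⟨this.1.wellFormed _, this.2, id⟩
  | sensRead s h hi =>
    intro N hN
    obtain ⟨σ', h1, Q, h2, rfl⟩ := mem_supp_sysDist.1 hN
    obtain rfl := FDist.mem_supp_dirac.1 h1
    obtain ⟨Q', h2', rfl⟩ := FDist.mem_supp_map.1 h2
    have := h.ok hM.ok Q' h2'
    refine ⟨(this.1.substVal _).wellFormed _, ?_, id⟩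
    simp only [RawCPS.rank, Proc.usize_substVal]
    exact this.2
  | actWrite a v h hi =>
    intro N hN
    obtain ⟨σ', h1, Q, h2, rfl⟩ := mem_supp_sysDist.1 hN
    obtain rfl := FDist.mem_supp_dirac.1 h1
    have := h.ok hM.ok Q h2
    refine ⟨this.1.wellFormed _, this.2, fun hM => ?_⟩
    simp only [RawCPS.InInv, PhysState.setActuator_x]
    exact hM
  | deadlock hi =>
    intro N hN
    obtain rfl := FDist.mem_supp_dirac.1 hN
    exact ⟨trivial, Proc.usize_pos _, fun h => absurd h hi⟩

theorem RawCPS.Step.wellFormed {M : RawCPS g} {α : Act g} {γ : FDist (RawCPS g)}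
    (h : M.Step α γ) (hM : M.WellFormed) : ∀ N ∈ γ.supp, N.WellFormed := by
  cases h with
  | tau h => exact fun N hN => (h.facts hM N hN).1
  | out h hi =>
    intro N hN
    obtain ⟨σ', h1, Q, h2, rfl⟩ := mem_supp_sysDist.1 hN
    exact (h.ok hM.ok Q h2).1.wellFormed _
  | inp h hi =>
    intro N hN
    obtain ⟨σ', h1, Q, h2, rfl⟩ := mem_supp_sysDist.1 hN
    exact (h.ok hM.ok Q h2).1.wellFormed _
  | time h _ hi =>
    intro N hN
    obtain ⟨σ', h1, Q, h2, rfl⟩ := mem_supp_sysDist.1 hN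
    exact (h.ok hM.ok Q h2).wellFormed _

theorem RawCPS.tauStep_finite {M : RawCPS g} (hM : M.WellFormed) : {γ | M.TauStep γ}.Finite := by
  classical
  cases M with
  | dead => exact Set.finite_empty.subset fun γ h => nomatch h
  | sys E σ P =>
    have hP := hM.ok.finiteBranching
    have hs : {s : E.S | ∃ π, P.Untimed (.sns s) π}.Finite :=
      hP.sensors.preimage (f := Subtype.val) Subtype.val_injective.injOn
    have hw : {x : E.A × Val g | ∃ π, P.Untimed (.wrt x.1 x.2) π}.Finite :=
      hP.writes.preimage (f := fun x : E.A × Val g => ((x.1 : g.Actuator), x.2))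
        (Function.Injective.injOn fun x y h => by
          simp only [Prod.mk.injEq] at h
          exact Prod.ext (Subtype.ext h.1) h.2)
    refine Set.Finite.subset (((hP.untimed .tau).image fun π => sysDist E (.dirac σ) π).union
      ((hs.biUnion fun s _ => (hP.untimed (.sns s)).image fun π =>
        sysDist E (.dirac σ) (π.map fun Q => Q.substVal (.real (σ.s s)) 0)).union
      ((hw.biUnion fun x _ => (hP.untimed (.wrt x.1 x.2)).image fun π =>
        sysDist E (.dirac (σ.setActuator x.1 x.2)) π).union
      (Set.finite_singleton (.dirac .dead))))) ?_
    intro γ h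
    cases h with
    | tau h hi => exact Or.inl ⟨_, h, rfl⟩
    | sensRead s h hi =>
      exact Or.inr (Or.inl (Set.mem_biUnion (x := s) ⟨_, h⟩ ⟨_, h, rfl⟩))
    | actWrite a v h hi =>
      exact Or.inr (Or.inr (Or.inl (Set.mem_biUnion (x := (a, v)) ⟨_, h⟩ ⟨_, h, rfl⟩)))
    | deadlock hi => exact Or.inr (Or.inr (Or.inr rfl))

theorem RawCPS.step_finite {M : RawCPS g} (hM : M.WellFormed) (α : Act g) :
    {γ | M.Step α γ}.Finite := by
  cases M with
  | dead =>
    refine Set.finite_empty.subset fun γ h => ?_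
    cases h with
    | tau h => cases h
  | sys E σ P =>
    have hP := hM.ok.finiteBranching
    cases α with
    | tau =>
      refine (RawCPS.tauStep_finite hM).subset ?_
      rintro γ ⟨h⟩
      exact h
    | out c v =>
      refine ((hP.untimed (.out c v)).image fun π => sysDist E (.dirac σ) π).subset ?_
      intro γ h
      cases h with
      | out h hi => exact ⟨_, h, rfl⟩
    | inp c v =>
      refine ((hP.untimed (.inp c v)).image fun π => sysDist E (.dirac σ) π).subset ?_
      intro γ h
      cases h with
      | inp h hi => exact ⟨_, h, rfl⟩
    | tick =>
      refine (hP.timed.image fun π => sysDist E (E.next σ) π).subset ?_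
      intro γ h
      cases h with
      | time h _ hi => exact ⟨_, h, rfl⟩

/-- The underlying system. -/
def CPS.raw (M : CPS g) : RawCPS g := M.1

/-- The cyber-physical system given by a well-formed system. -/
def CPS.ofRaw (M : RawCPS g) (hM : M.WellFormed) : CPS g := ⟨M, hM⟩

theorem CPS.raw_wellFormed (M : CPS g) : M.raw.WellFormed := M.2

theorem CPS.raw_injective : Function.Injective (CPS.raw (g := g)) := Subtype.val_injective

theorem CPS.raw_ofRaw (M : RawCPS g) (hM : M.WellFormed) : (CPS.ofRaw M hM).raw = M := rfl

theorem CPS.raw_dead : (Dead : CPS g).raw = .dead := rfl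

theorem step_iff {M : CPS g} {α : Act g} {γ : FDist (CPS g)} :
    Step M α γ ↔ M.raw.Step α (γ.map CPS.raw) := Iff.rfl

/-- A bound on the number of consecutive `τ`-transitions. -/
def CPS.rank (M : CPS g) : ℕ := M.raw.rank

/-- The system is not dead and its physical state satisfies the invariant. -/
def CPS.InInv (M : CPS g) : Prop := M.raw.InInv

/-- No `τ`-transition is possible. -/
def CPS.Stable (M : CPS g) : Prop := ∀ γ, ¬ Step M .tau γ

theorem exists_map_raw {γ : FDist (RawCPS g)} (h : ∀ N ∈ γ.supp, N.WellFormed) :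
    ∃ γ' : FDist (CPS g), γ'.map CPS.raw = γ := by
  classical
  refine ⟨γ.map fun N => if hN : N.WellFormed then CPS.ofRaw N hN else Dead, ?_⟩
  rw [FDist.map_map]
  conv_rhs => rw [← FDist.map_id' γ]
  exact FDist.map_congr fun N hN => by rw [dif_pos (h N hN), CPS.raw_ofRaw]

theorem RawCPS.Step.exists_step {M : CPS g} {α : Act g} {γ : FDist (RawCPS g)}
    (h : M.raw.Step α γ) : ∃ γ' : FDist (CPS g), CPC.Step M α γ' := by
  obtain ⟨γ', rfl⟩ := exists_map_raw (h.wellFormed M.raw_wellFormed)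
  exact ⟨γ', h⟩

theorem mem_supp_map_raw {γ : FDist (CPS g)} {N : CPS g} (hN : N ∈ γ.supp) :
    N.raw ∈ (γ.map CPS.raw).supp :=
  FDist.mem_supp_map.2 ⟨N, hN, rfl⟩

theorem step_finite (M : CPS g) (α : Act g) : {γ | Step M α γ}.Finite :=
  (RawCPS.step_finite M.raw_wellFormed α).preimage (FDist.map_injective CPS.raw_injective).injOn

theorem RawCPS.Step.tauStep {M : RawCPS g} {γ : FDist (RawCPS g)} (h : M.Step .tau γ) :
    M.TauStep γ := by
  cases h with
  | tau h => exact h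

theorem Step.rank_lt {M N : CPS g} {γ : FDist (CPS g)} (h : Step M .tau γ) (hN : N ∈ γ.supp) :
    N.rank < M.rank :=
  ((RawCPS.Step.tauStep (step_iff.1 h)).facts M.raw_wellFormed _ (mem_supp_map_raw hN)).2.1

theorem RawCPS.Step.inInv_of_ne_tick {M N : RawCPS g} {α : Act g} {γ : FDist (RawCPS g)}
    (h : M.Step α γ) (hM : M.WellFormed) (hα : α ≠ .tick) (hi : M.InInv) (hN : N ∈ γ.supp) :
    N.InInv := by
  cases h with
  | tau h => exact (h.facts hM _ hN).2.2 hi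
  | out h hi =>
    obtain ⟨σ', h1, Q, h2, rfl⟩ := mem_supp_sysDist.1 hN
    obtain rfl := FDist.mem_supp_dirac.1 h1
    exact hi
  | inp h hi =>
    obtain ⟨σ', h1, Q, h2, rfl⟩ := mem_supp_sysDist.1 hN
    obtain rfl := FDist.mem_supp_dirac.1 h1
    exact hi
  | time => exact absurd rfl hα

theorem Step.inInv_of_ne_tick {M N : CPS g} {α : Act g} {γ : FDist (CPS g)} (h : Step M α γ)
    (hα : α ≠ .tick) (hM : M.InInv) (hN : N ∈ γ.supp) : N.InInv :=
  RawCPS.Step.inInv_of_ne_tick (step_iff.1 h) M.raw_wellFormed hα hM (mem_supp_map_raw hN)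

theorem RawCPS.Step.inInv {M : RawCPS g} {α : Act g} {γ : FDist (RawCPS g)} (h : M.Step α γ)
    (hα : α ≠ .tau) : M.InInv := by
  cases h with
  | tau h => exact absurd rfl hα
  | out h hi => exact hi
  | inp h hi => exact hi
  | time _ _ hi => exact hi

theorem Step.inInv {M : CPS g} {α : Act g} {γ : FDist (CPS g)} (h : Step M α γ)
    (hα : α ≠ .tau) : M.InInv :=
  RawCPS.Step.inInv (step_iff.1 h) hα

theorem RawCPS.Step.not_tauStep {M : RawCPS g} {γ γ' : FDist (RawCPS g)} (h : M.Step .tick γ) :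
    ¬ M.TauStep γ' := by
  cases h with
  | time _ hn _ => exact fun h' => hn ⟨_, h'⟩

theorem Step.stable_of_tick {M : CPS g} {γ : FDist (CPS g)} (h : Step M .tick γ) : M.Stable :=
  fun _ h' => RawCPS.Step.not_tauStep (step_iff.1 h) (RawCPS.Step.tauStep (step_iff.1 h'))

theorem RawCPS.not_step_dead {α : Act g} {γ : FDist (RawCPS g)} : ¬ RawCPS.dead.Step α γ := by
  intro h
  cases h with
  | tau h => cases h

theorem not_step_dead {α : Act g} {γ : FDist (CPS g)} : ¬ Step Dead α γ :=
  RawCPS.not_step_dead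

theorem not_inInv_dead : ¬ (Dead : CPS g).InInv := id

theorem step_dead_of_not_inInv {M : CPS g} (hM : ¬ M.InInv) (hd : M ≠ Dead) :
    Step M .tau (.dirac Dead) := by
  rw [step_iff, FDist.map_dirac, CPS.raw_dead]
  unfold CPS.InInv at hM
  have hd' : M.raw ≠ .dead := fun h => hd (CPS.raw_injective h)
  generalize M.raw = R at hM hd'
  cases R with
  | dead => exact absurd rfl hd'
  | sys E σ P => exact .tau (.deadlock hM)

theorem CPS.Stable.eq_dead {M : CPS g} (hM : M.Stable) (hi : ¬ M.InInv) : M = Dead := by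
  by_contra hd
  exact hM _ (step_dead_of_not_inInv hi hd)

/-- All devices of the process belong to `E`, so each device access would be a `τ`-transition.
Without `τ` there is neither a device access nor an internal communication, and the process lets
time pass. -/
theorem RawCPS.exists_tick {M : RawCPS g} (hM : M.WellFormed) (hi : M.InInv)
    (hτ : ∀ γ, ¬ M.TauStep γ) : ∃ γ, M.Step .tick γ := by
  cases M with
  | dead => exact absurd hi id
  | sys E σ P =>
    obtain ⟨π, hπ⟩ := hM.ok.exists_timed (fun π h => hτ _ (.tau h hi))
      (fun s π h => hτ _ (.sensRead ⟨s, (h.devices hM.2.2).1 s rfl⟩ h hi))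
      (fun a v π h => hτ _ (.actWrite ⟨a, (h.devices hM.2.2).2 a v rfl⟩ v h hi))
    exact ⟨_, .time hπ (fun ⟨γ, h⟩ => hτ γ h) hi⟩

theorem CPS.Stable.exists_tick {M : CPS g} (hM : M.Stable) (hi : M.InInv) :
    ∃ γ, Step M .tick γ := by
  obtain ⟨γ, h⟩ := RawCPS.exists_tick M.raw_wellFormed hi fun γ h => by
    obtain ⟨γ', h'⟩ := RawCPS.Step.exists_step (.tau h)
    exact hM _ h'
  exact h.exists_step

end Systems

/-! ## Mixtures of finitely many distributions -/

section Mixtures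

variable {O O' ι : Type*}

/-- The mixtures of the distributions in `F`. -/
def Mixtures (F : Set (FDist O)) : Set (FDist O) :=
  {η | ∃ ρ : FDist (FDist O), (∀ e ∈ ρ.supp, e ∈ F) ∧ η = ρ.bind id}

theorem mem_mixtures_of_mem {F : Set (FDist O)} {e : FDist O} (he : e ∈ F) : e ∈ Mixtures F :=
  ⟨.dirac e, fun _ he' => FDist.mem_supp_dirac.1 he' ▸ he, (FDist.dirac_bind e id).symm⟩

theorem Mixtures.mono {F G : Set (FDist O)} (h : F ⊆ G) : Mixtures F ⊆ Mixtures G :=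
  fun _ ⟨ρ, h1, h2⟩ => ⟨ρ, fun e he => h (h1 e he), h2⟩

theorem bind_mem_mixtures {F : Set (FDist O)} {ρ : FDist ι} {e : ι → FDist O}
    (h : ∀ i ∈ ρ.supp, e i ∈ Mixtures F) : ρ.bind e ∈ Mixtures F := by
  have h' : ∀ i, ∃ r : FDist (FDist O), i ∈ ρ.supp → (∀ e' ∈ r.supp, e' ∈ F) ∧ e i = r.bind id := by
    intro i
    by_cases hi : i ∈ ρ.supp
    · obtain ⟨r, hr⟩ := h i hi
      exact ⟨r, fun _ => hr⟩
    · exact ⟨.dirac (e i), fun hi' => absurd hi' hi⟩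
  choose r hr using h'
  refine ⟨ρ.bind r, fun e' he' => ?_, ?_⟩
  · obtain ⟨i, hi, he'⟩ := FDist.mem_supp_bind.1 he'
    exact (hr i hi).1 e' he'
  · rw [FDist.bind_assoc]
    exact FDist.bind_congr fun i hi => (hr i hi).2

/-- Independent choices from finitely many distributions. -/
theorem exists_product (t : Finset O) (r : O → FDist O') :
    ∃ Θ : FDist (O → O'), (∀ s ∈ t, Θ.map (fun f => f s) = r s) := by
  classical
  induction t using Finset.induction_on with
  | empty => exact ⟨.dirac fun s => (r s).supp_nonempty.choose, by simp⟩
  | insert a t ha ih =>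
    obtain ⟨Θ, hΘ⟩ := ih
    refine ⟨Θ.bind fun f => (r a).map fun e => Function.update f a e, fun s hs => ?_⟩
    rw [FDist.map_bind]
    simp only [FDist.map_map]
    rcases Finset.mem_insert.1 hs with rfl | hs
    · simp only [Function.update_self, FDist.map_id', FDist.bind_const]
    · have hsa : s ≠ a := fun h => ha (h ▸ hs)
      simp only [Function.update_of_ne hsa]
      rw [← hΘ s hs]
      exact FDist.ext_ex fun f => by simp [FDist.ex_const]

/-- Randomising separately at each `s` amounts to drawing in advance a whole function of pure
choices: the independent product of the local choices has the right marginals. This is how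
behavioural strategies become mixtures of pure ones. -/
theorem bind_mem_mixtures_bind {γ : FDist O} {k : O → FDist O'} {F : O → Set (FDist O')}
    (h : ∀ s ∈ γ.supp, k s ∈ Mixtures (F s)) :
    γ.bind k ∈ Mixtures {η | ∃ f : O → FDist O', (∀ s ∈ γ.supp, f s ∈ F s) ∧ η = γ.bind f} := by
  have h' : ∀ s, ∃ ρ : FDist (FDist O'), s ∈ γ.supp →
      (∀ e ∈ ρ.supp, e ∈ F s) ∧ k s = ρ.bind id := by
    intro s
    by_cases hs : s ∈ γ.supp
    · obtain ⟨ρ, hρ⟩ := h s hs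
      exact ⟨ρ, fun _ => hρ⟩
    · exact ⟨.dirac (k s), fun hs' => absurd hs' hs⟩
  choose r hr using h'
  obtain ⟨Θ, hΘ⟩ := exists_product γ.supp r
  refine ⟨Θ.map fun f => γ.bind f, fun e he => ?_, ?_⟩
  · obtain ⟨f, hf, rfl⟩ := FDist.mem_supp_map.1 he
    refine ⟨f, fun s hs => (hr s hs).1 _ ?_, rfl⟩
    rw [← hΘ s hs]
    exact FDist.mem_supp_map.2 ⟨f, hf, rfl⟩
  · have : γ.bind k = γ.bind fun s => Θ.bind fun f => f s := by
      refine FDist.bind_congr fun s hs => ?_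
      rw [(hr s hs).2, ← hΘ s hs, FDist.bind_map]
      rfl
    rw [this]
    refine FDist.ext_ex fun f => ?_
    simp only [FDist.ex_bind, FDist.ex_map, id]
    rw [FDist.ex_comm]

theorem finite_bind {γ : FDist O} {F : O → Set (FDist O')} (h : ∀ s ∈ γ.supp, (F s).Finite) :
    {η | ∃ f : O → FDist O', (∀ s ∈ γ.supp, f s ∈ F s) ∧ η = γ.bind f}.Finite := by
  classical
  have hfin : {f : {s // s ∈ γ.supp} → FDist O' | ∀ s : {s // s ∈ γ.supp}, f s ∈ F s.1}.Finite :=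
    Set.Finite.pi' fun s => h s s.2
  by_cases hne : Nonempty (FDist O')
  · refine (hfin.image fun f => γ.bind fun s =>
      if hs : s ∈ γ.supp then f ⟨s, hs⟩ else Classical.choice hne).subset ?_
    rintro η ⟨f, hf, rfl⟩
    refine ⟨fun s => f s, fun s => hf s s.2, FDist.bind_congr fun s hs => ?_⟩
    simp only [dif_pos hs]
  · refine Set.finite_empty.subset ?_
    rintro η ⟨f, hf, rfl⟩
    exact hne ⟨γ.bind f⟩

/-! ## Compactness -/

/-- Distributions with support in `T`. -/
abbrev FDist.On (T : Finset O) : Type _ := {γ : FDist O // γ.supp ⊆ T}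

instance (T : Finset O) : TopologicalSpace (FDist.On T) :=
  .induced (fun γ o => γ.1.weight o) inferInstance

theorem FDist.On.continuous_ex (T : Finset O) (f : O → ℝ) :
    Continuous fun γ : FDist.On T => γ.1.ex f := by
  have h : (fun γ : FDist.On T => γ.1.ex f) =
      fun γ => ∑ o ∈ T, ((γ.1.weight o : ℝ≥0) : ℝ) * f o := by
    funext γ
    rw [FDist.ex_eq_sum]
    refine Finset.sum_subset γ.2 fun o _ ho => ?_
    have : γ.1.weight o = 0 := by simpa [FDist.mem_supp] using ho
    simp [this]
  rw [h]
  refine continuous_finsetSum _ fun o _ => Continuous.mul_const ?_ _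
  exact NNReal.continuous_coe.comp ((continuous_apply o).comp continuous_induced_dom)

/-- In coordinates this is a closed part of a cube: weights vanishing off `T`, of sum `1`. -/
instance (T : Finset O) : CompactSpace (FDist.On T) := by
  classical
  have hi : Topology.IsInducing fun (γ : FDist.On T) (o : O) => γ.1.weight o := ⟨rfl⟩
  have hmass : ∀ γ : FDist O, γ.supp ⊆ T → ∑ o ∈ T, γ.weight o = 1 := by
    intro γ hγ
    rw [← γ.mass_eq_one, mass, Finsupp.sum]
    exact (Finset.sum_subset hγ fun o _ ho => by simpa [FDist.mem_supp] using ho).symm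
  have hrange : (fun (γ : FDist.On T) (o : O) => γ.1.weight o) '' Set.univ =
      (Set.univ.pi fun _ => Set.Icc 0 1) ∩
        ((⋂ o ∈ (T : Set O)ᶜ, {w : O → ℝ≥0 | w o = 0}) ∩ {w | ∑ o ∈ T, w o = 1}) := by
    ext w
    constructor
    · rintro ⟨γ, -, rfl⟩
      have h0 : ∀ o ∉ T, γ.1.weight o = 0 := fun o ho => by
        by_contra h
        exact ho (γ.2 (FDist.mem_supp.2 h))
      refine ⟨fun o _ => ⟨zero_le, ?_⟩, Set.mem_iInter₂.2 fun o ho => h0 o ho, hmass γ.1 γ.2⟩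
      by_cases ho : o ∈ T
      · rw [← hmass γ.1 γ.2]
        exact Finset.single_le_sum (f := fun o => γ.1.weight o) (fun _ _ => zero_le) ho
      · simp only [h0 o ho]
        exact zero_le
    · rintro ⟨-, h0, h1⟩
      have h0 : ∀ o ∉ T, w o = 0 := fun o ho => Set.mem_iInter₂.1 h0 o ho
      let w' : O →₀ ℝ≥0 := Finsupp.onFinset T w fun o ho => by
        by_contra h
        exact ho (h0 o h)
      have hw' : w'.support ⊆ T := Finsupp.support_onFinset_subset
      refine ⟨⟨⟨w', ?_⟩, hw'⟩, trivial, rfl⟩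
      rw [mass, Finsupp.sum, Finset.sum_subset hw' fun o _ ho => by simpa using ho]
      exact h1
  refine ⟨hi.isCompact_iff.2 ?_⟩
  rw [hrange]
  refine (isCompact_univ_pi fun _ => isCompact_Icc).inter_right (IsClosed.inter ?_ ?_)
  · exact isClosed_biInter fun o _ => isClosed_eq (continuous_apply o) continuous_const
  · exact isClosed_eq (continuous_finsetSum _ fun o _ => continuous_apply o) continuous_const

/-- A mixture of `F` together with a matching is a point of a compact space, since all supports lie
in fixed finite sets. The points of `d n`-cost at most `c + 1/(n+1)` form nonempty closed sets,
decreasing because `d` increases. A common point has `D`-cost at most `c`. -/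
theorem exists_coupled_limit {F : Set (FDist O)} (hF : F.Finite) {γ : FDist O}
    {d : ℕ → O → O → unitInterval} (hd : Monotone d) {D : O → O → unitInterval}
    (hD : ∀ x y, Tendsto (fun n => (d n x y : ℝ)) atTop (𝓝 (D x y))) {c : ℝ}
    (h : ∀ n, ∀ c' > c, ∃ η ∈ Mixtures F, Coupled (d n) c' γ η) :
    ∃ η ∈ Mixtures F, Coupled D c γ η := by
  classical
  let T : Finset (O × O) := γ.supp ×ˢ hF.toFinset.biUnion FDist.supp
  -- The marginal conditions are tested against all real functions, so that they are visibly closed.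
  let A : ℕ → Set (FDist.On hF.toFinset × FDist.On T) := fun n =>
    ((⋂ f : O → ℝ, {x | x.2.1.ex (fun p => f p.1) = γ.ex f}) ∩
      ⋂ f : O → ℝ, {x | x.2.1.ex (fun p => f p.2) = x.1.1.ex fun e => e.ex f}) ∩
      {x | x.2.1.ex (fun p => (d n p.1 p.2 : ℝ)) ≤ c + 1 / ((n : ℝ) + 1)}
  have hcl : ∀ n, IsClosed (A n) := fun n =>
    ((isClosed_iInter fun f => isClosed_eq
        ((FDist.On.continuous_ex T _).comp continuous_snd) continuous_const).inter
      (isClosed_iInter fun f => isClosed_eq ((FDist.On.continuous_ex T _).comp continuous_snd)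
        ((FDist.On.continuous_ex hF.toFinset _).comp continuous_fst))).inter
      (isClosed_le ((FDist.On.continuous_ex T _).comp continuous_snd) continuous_const)
  have hne : ∀ n, (A n).Nonempty := by
    intro n
    obtain ⟨η, ⟨ρ, hρ, rfl⟩, ω, h1, h2, h3⟩ := h n (c + 1 / ((n : ℝ) + 1))
      (lt_add_of_pos_right c Nat.one_div_pos_of_nat)
    refine ⟨(⟨ρ, fun e he => hF.mem_toFinset.2 (hρ e he)⟩, ⟨ω, fun p hp => ?_⟩), ?_⟩
    · refine Finset.mem_product.2 ⟨h1 ▸ FDist.mem_supp_map.2 ⟨p, hp, rfl⟩, ?_⟩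
      have : p.2 ∈ (ρ.bind id).supp := h2 ▸ FDist.mem_supp_map.2 ⟨p, hp, rfl⟩
      obtain ⟨e, he, hpe⟩ := FDist.mem_supp_bind.1 this
      exact Finset.mem_biUnion.2 ⟨e, hF.mem_toFinset.2 (hρ e he), hpe⟩
    · refine ⟨⟨Set.mem_iInter.2 fun f => ?_, Set.mem_iInter.2 fun f => ?_⟩, h3⟩
      · simp only [Set.mem_ofPred_eq, ← h1, FDist.ex_map]
      · have := congrArg (fun δ => FDist.ex δ f) h2
        simpa using this
  have hanti : ∀ n, A (n + 1) ⊆ A n := by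
    rintro n x ⟨hx, hx'⟩
    refine ⟨hx, ?_⟩
    have h1 : x.2.1.ex (fun p => (d n p.1 p.2 : ℝ)) ≤
        x.2.1.ex fun p => (d (n + 1) p.1 p.2 : ℝ) :=
      FDist.ex_mono fun p _ => hd (Nat.le_succ n) p.1 p.2
    have h2 : 1 / (((n + 1 : ℕ) : ℝ) + 1) ≤ 1 / ((n : ℝ) + 1) :=
      Nat.one_div_le_one_div (Nat.le_succ n)
    exact h1.trans (hx'.trans (add_le_add le_rfl h2))
  obtain ⟨⟨ρ, ω⟩, hx⟩ := IsCompact.nonempty_iInter_of_sequence_nonempty_isCompact_isClosed A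
    hanti hne (hcl 0).isCompact hcl
  have hx := Set.mem_iInter.1 hx
  refine ⟨ρ.1.bind id, ⟨ρ.1, fun e he => hF.mem_toFinset.1 (ρ.2 he), rfl⟩, ω.1, ?_, ?_, ?_⟩
  · refine FDist.ext_ex fun f => ?_
    rw [FDist.ex_map]
    exact Set.mem_iInter.1 (hx 0).1.1 f
  · refine FDist.ext_ex fun f => ?_
    rw [FDist.ex_map, FDist.ex_bind]
    exact Set.mem_iInter.1 (hx 0).1.2 f
  · refine le_of_tendsto_of_tendsto' (b := atTop)
      (f := fun n : ℕ => ω.1.ex fun p => (d n p.1 p.2 : ℝ))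
      (g := fun n : ℕ => c + 1 / ((n : ℝ) + 1)) ?_ ?_ fun n => (hx n).2
    · simp only [FDist.ex_eq_sum]
      exact tendsto_finsetSum _ fun p _ => (hD p.1 p.2).const_mul _
    · simpa using tendsto_const_nhds.add (tendsto_one_div_add_atTop_nhds_zero_nat (𝕜 := ℝ))

end Mixtures

/-! ## Randomised runs of internal transitions -/

section Runs

variable {g : Signature.{u}} {ι : Type*}

/-- `Run B N η`: a randomised scheduler that performs `τ`-transitions from `N`, and stops with one
of the outcomes that `B` allows, ends with outcome `η`. -/
inductive Run (B : CPS g → FDist (CPS g) → Prop) : CPS g → FDist (CPS g) → Prop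
  | base {N : CPS g} {η : FDist (CPS g)} : B N η → Run B N η
  | step {N : CPS g} {ν : FDist (CPS g)} {k : CPS g → FDist (CPS g)} :
      Step N .tau ν → (∀ s ∈ ν.supp, Run B s (k s)) → Run B N (ν.bind k)
  | mix {N : CPS g} {ρ : FDist (FDist (CPS g))} :
      (∀ e ∈ ρ.supp, Run B N e) → Run B N (ρ.bind id)

/-- The outcomes of sequences of `τ`-transitions. -/
abbrev TauRun : CPS g → FDist (CPS g) → Prop := Run fun N η => η = .dirac N

variable {B B' : CPS g → FDist (CPS g) → Prop}

theorem TauRun.refl (N : CPS g) : TauRun N (.dirac N) := .base rfl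

theorem TauRun.of_step {N : CPS g} {ν : FDist (CPS g)} (h : Step N .tau ν) : TauRun N ν := by
  rw [← FDist.bind_dirac ν]
  exact .step h fun s _ => TauRun.refl s

theorem Run.bind_family {N : CPS g} {ρ : FDist ι} {e : ι → FDist (CPS g)}
    (h : ∀ i ∈ ρ.supp, Run B N (e i)) : Run B N (ρ.bind e) := by
  have : ρ.bind e = (ρ.map e).bind id := by rw [FDist.bind_map]; rfl
  rw [this]
  refine .mix fun e' he' => ?_
  obtain ⟨i, hi, rfl⟩ := FDist.mem_supp_map.1 he'
  exact h i hi

/-- Several indices may sit at the same system with different outcomes. Conditioning on the system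
averages these outcomes, and runs are closed under mixing. -/
theorem Run.exists_kernel {ρ : FDist ι} {m : ι → CPS g} {e : ι → FDist (CPS g)}
    (h : ∀ i ∈ ρ.supp, Run B (m i) (e i)) :
    ∃ k : CPS g → FDist (CPS g), (∀ s ∈ (ρ.map m).supp, Run B s (k s)) ∧
      ρ.bind e = (ρ.map m).bind k := by
  obtain ⟨κ, h1, h2⟩ := ρ.exists_disintegration m
  refine ⟨fun s => (κ s).bind e, fun s hs => Run.bind_family fun i hi => ?_, ?_⟩
  · obtain ⟨hi', rfl⟩ := h2 s hs i hi
    exact h i hi'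
  · rw [← FDist.bind_assoc, ← h1]

theorem TauRun.comp {N : CPS g} {σ : FDist (CPS g)} (h : TauRun N σ)
    {k : CPS g → FDist (CPS g)} (hk : ∀ s ∈ σ.supp, Run B s (k s)) : Run B N (σ.bind k) := by
  induction h with
  | base h =>
    subst h
    rw [FDist.dirac_bind]
    exact hk _ (FDist.mem_supp_dirac.2 rfl)
  | step h _ ih =>
    rw [FDist.bind_assoc]
    exact .step h fun s hs => ih s hs fun t ht => hk t (FDist.mem_supp_bind.2 ⟨s, hs, ht⟩)
  | mix _ ih =>
    rw [FDist.bind_assoc]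
    exact Run.bind_family fun e he => ih e he fun t ht => hk t (FDist.mem_supp_bind.2 ⟨e, he, ht⟩)

theorem TauRun.comp_map {N : CPS g} {ρ : FDist ι} {m : ι → CPS g} (h : TauRun N (ρ.map m))
    {e : ι → FDist (CPS g)} (he : ∀ i ∈ ρ.supp, Run B (m i) (e i)) : Run B N (ρ.bind e) := by
  obtain ⟨k, hk, hk'⟩ := Run.exists_kernel he
  rw [hk']
  exact h.comp hk

/-- Prolongs a run at its end, provided that the basic outcomes absorb further `τ`-transitions. -/
theorem Run.bind_right (hB : ∀ M e, B M e → ∀ k : CPS g → FDist (CPS g),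
      (∀ s ∈ e.supp, TauRun s (k s)) → B M (e.bind k))
    {N : CPS g} {η : FDist (CPS g)} (h : Run B N η) {k : CPS g → FDist (CPS g)}
    (hk : ∀ s ∈ η.supp, TauRun s (k s)) : Run B N (η.bind k) := by
  induction h with
  | base h => exact .base (hB _ _ h k hk)
  | step h _ ih =>
    rw [FDist.bind_assoc]
    exact .step h fun s hs => ih s hs fun t ht => hk t (FDist.mem_supp_bind.2 ⟨s, hs, ht⟩)
  | mix _ ih =>
    rw [FDist.bind_assoc]
    exact Run.bind_family fun e he => ih e he fun t ht => hk t (FDist.mem_supp_bind.2 ⟨e, he, ht⟩)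

/-- A run is a sequence of `τ`-transitions, followed by basic outcomes. -/
theorem Run.exists_tauRun {N : CPS g} {η : FDist (CPS g)} (h : Run B N η) :
    ∃ ρ : FDist (CPS g × FDist (CPS g)), TauRun N (ρ.map Prod.fst) ∧
      (∀ i ∈ ρ.supp, B i.1 i.2) ∧ η = ρ.bind Prod.snd := by
  induction h with
  | @base N η h =>
    refine ⟨.dirac (N, η), ?_, fun i hi => ?_, ?_⟩
    · rw [FDist.map_dirac]
      exact .refl N
    · rw [FDist.mem_supp_dirac.1 hi]
      exact h
    · rw [FDist.dirac_bind]
  | @step N ν k h _ ih =>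
    have ih' : ∀ s, ∃ ρ : FDist (CPS g × FDist (CPS g)), s ∈ ν.supp → TauRun s (ρ.map Prod.fst) ∧
        (∀ i ∈ ρ.supp, B i.1 i.2) ∧ k s = ρ.bind Prod.snd := by
      intro s
      by_cases hs : s ∈ ν.supp
      · obtain ⟨ρ, hρ⟩ := ih s hs
        exact ⟨ρ, fun _ => hρ⟩
      · exact ⟨.dirac (s, k s), fun hs' => absurd hs' hs⟩
    choose r hr using ih'
    refine ⟨ν.bind r, ?_, fun i hi => ?_, ?_⟩
    · rw [FDist.map_bind]
      exact .step h fun s hs => (hr s hs).1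
    · obtain ⟨s, hs, hi⟩ := FDist.mem_supp_bind.1 hi
      exact (hr s hs).2.1 i hi
    · rw [FDist.bind_assoc]
      exact FDist.bind_congr fun s hs => (hr s hs).2.2
  | @mix N ρ _ ih =>
    have ih' : ∀ e, ∃ ρ' : FDist (CPS g × FDist (CPS g)), e ∈ ρ.supp →
        TauRun N (ρ'.map Prod.fst) ∧ (∀ i ∈ ρ'.supp, B i.1 i.2) ∧ e = ρ'.bind Prod.snd := by
      intro e
      by_cases hs : e ∈ ρ.supp
      · obtain ⟨ρ', hρ⟩ := ih e hs
        exact ⟨ρ', fun _ => hρ⟩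
      · exact ⟨.dirac (N, e), fun hs' => absurd hs' hs⟩
    choose r hr using ih'
    refine ⟨ρ.bind r, ?_, fun i hi => ?_, ?_⟩
    · rw [FDist.map_bind]
      exact Run.bind_family fun s hs => (hr s hs).1
    · obtain ⟨s, hs, hi⟩ := FDist.mem_supp_bind.1 hi
      exact (hr s hs).2.1 i hi
    · rw [FDist.bind_assoc]
      exact FDist.bind_congr fun s hs => (hr s hs).2.2

theorem TauRun.eq_dirac {N : CPS g} (hN : N.Stable) {η : FDist (CPS g)} (h : TauRun N η) :
    η = .dirac N := by
  induction h with
  | base h => exact h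
  | step h _ _ => exact absurd h (hN _)
  | @mix N ρ _ ih =>
    rw [← FDist.bind_const ρ (.dirac N)]
    exact FDist.bind_congr fun e he => ih e he hN

theorem stable_dead : (Dead : CPS g).Stable := fun _ => not_step_dead

/-- A run from a stable system never leaves it, so the outcomes need to be compared at `N` only. -/
theorem Run.mono_of_stable {N : CPS g} (hN : N.Stable) (hB : ∀ e, B N e → B' N e)
    {η : FDist (CPS g)} (h : Run B N η) : Run B' N η := by
  induction h with
  | base h => exact .base (hB _ h)
  | step h _ _ => exact absurd h (hN _)
  | mix _ ih => exact .mix fun e he => ih e he hN hB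

theorem Run.mono (hB : ∀ N e, B N e → B' N e) {N : CPS g} {η : FDist (CPS g)} (h : Run B N η) :
    Run B' N η := by
  induction h with
  | base h => exact .base (hB _ _ h)
  | step h _ ih => exact .step h ih
  | mix _ ih => exact .mix ih

theorem TauRun.inInv {N : CPS g} (hN : N.InInv) {η : FDist (CPS g)} (h : TauRun N η) :
    ∀ s ∈ η.supp, s.InInv := by
  induction h with
  | base h =>
    subst h
    intro s hs
    rw [FDist.mem_supp_dirac.1 hs]
    exact hN
  | step h _ ih =>
    intro t ht
    obtain ⟨s, hs, ht⟩ := FDist.mem_supp_bind.1 ht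
    exact ih s hs (h.inInv_of_ne_tick (by simp) hN hs) t ht
  | mix _ ih =>
    intro t ht
    obtain ⟨e, he, ht⟩ := FDist.mem_supp_bind.1 ht
    exact ih e he hN t ht

/-- Runs without randomisation. -/
inductive PureRun (B : CPS g → FDist (CPS g) → Prop) : CPS g → FDist (CPS g) → Prop
  | base {N : CPS g} {η : FDist (CPS g)} : B N η → PureRun B N η
  | step {N : CPS g} {ν : FDist (CPS g)} {k : CPS g → FDist (CPS g)} :
      Step N .tau ν → (∀ s ∈ ν.supp, PureRun B s (k s)) → PureRun B N (ν.bind k)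

theorem PureRun.run {N : CPS g} {η : FDist (CPS g)} (h : PureRun B N η) : Run B N η := by
  induction h with
  | base h => exact .base h
  | step h _ ih => exact .step h ih

/-- The decision tree of a deterministic scheduler has depth at most the rank of `N`, and finitely
many options at each node. -/
theorem PureRun.finite (hB : ∀ M, {e | B M e}.Finite) (N : CPS g) :
    {η | PureRun B N η}.Finite := by
  induction hn : N.rank using Nat.strong_induction_on generalizing N with
  | _ n ih =>
    subst hn
    refine ((hB N).union ((step_finite N .tau).biUnion (t := fun ν =>
      {η | ∃ f : CPS g → FDist (CPS g), (∀ s ∈ ν.supp, f s ∈ {e | PureRun B s e}) ∧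
        η = ν.bind f}) fun ν hν => finite_bind fun s hs => ih _ (hν.rank_lt hs) s rfl)).subset ?_
    intro η h
    cases h with
    | base h => exact Or.inl h
    | step h hk => exact Or.inr (Set.mem_biUnion h ⟨_, hk, rfl⟩)

theorem Run.mem_mixtures (hB : ∀ M e, B M e → e ∈ Mixtures {e | B' M e})
    {N : CPS g} {η : FDist (CPS g)} (h : Run B N η) : η ∈ Mixtures {e | PureRun B' N e} := by
  induction h with
  | base h => exact Mixtures.mono (fun _ he => .base he) (hB _ _ h)
  | step h _ ih =>
    refine Mixtures.mono ?_ (bind_mem_mixtures_bind ih)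
    rintro _ ⟨f, hf, rfl⟩
    exact PureRun.step h hf
  | mix _ ih => exact bind_mem_mixtures ih

theorem run_of_mem_mixtures (hB : ∀ M e, B' M e → B M e) {N : CPS g} {η : FDist (CPS g)}
    (h : η ∈ Mixtures {e | PureRun B' N e}) : Run B N η := by
  obtain ⟨ρ, hρ, rfl⟩ := h
  exact .mix fun e he => (hρ e he).run.mono hB

end Runs

/-! ## Weak transitions as runs -/

section WeakTransitions

variable {g : Signature.{u}} {ι : Type*}

/-- An `α`-transition followed by `τ`-transitions. -/
def Perform (α : Act g) (M : CPS g) (e : FDist (CPS g)) : Prop :=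
  ∃ (γ : FDist (CPS g)) (k : CPS g → FDist (CPS g)), Step M α γ ∧
    (∀ s ∈ γ.supp, TauRun s (k s)) ∧ e = γ.bind k

/-- An `α`-transition followed by `τ`-transitions or, where no `α`-transition is possible, loss of
the probability mass. -/
def PerformOrStuck (α : Act g) (M : CPS g) (e : FDist (CPS g)) : Prop :=
  Perform α M e ∨ (¬ ∃ δ, Step M α δ) ∧ e = .dirac Dead

theorem Perform.bind {α : Act g} {M : CPS g} {e : FDist (CPS g)} (h : Perform α M e)
    {k : CPS g → FDist (CPS g)} (hk : ∀ s ∈ e.supp, TauRun s (k s)) :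
    Perform α M (e.bind k) := by
  obtain ⟨γ, l, h1, h2, rfl⟩ := h
  refine ⟨γ, fun s => (l s).bind k, h1, fun s hs => (h2 s hs).comp fun t ht => ?_,
    FDist.bind_assoc _ _ _⟩
  exact hk t (FDist.mem_supp_bind.2 ⟨s, hs, ht⟩)

theorem dirac_dead_bind {k : CPS g → FDist (CPS g)}
    (hk : ∀ s ∈ (FDist.dirac (Dead : CPS g)).supp, TauRun s (k s)) :
    (FDist.dirac Dead).bind k = .dirac Dead := by
  rw [FDist.dirac_bind]
  exact (hk _ (FDist.mem_supp_dirac.2 rfl)).eq_dirac stable_dead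

/-! ### Completed sub-distributions, and weak transitions read as runs. -/

theorem weightEx_mass {O : Type*} (γ : O →₀ ℝ≥0) : weightEx (fun _ => 1) γ = mass γ := by
  induction γ using Finsupp.induction_linear with
  | zero => simp [mass]
  | add a b ha hb => rw [map_add, ha, hb, mass_add, NNReal.coe_add]
  | single o q => simp [mass_single]

theorem SubDist.ex_complete {O : Type*} (γ : SubDist O) (o : O) (f : O → ℝ) :
    (γ.complete o).ex f = weightEx f γ.weight + (1 - weightEx (fun _ => 1) γ.weight) * f o := by
  rw [FDist.ex_eq_weightEx, SubDist.complete, map_add, weightEx_single, weightEx_mass,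
    NNReal.coe_sub γ.mass_le_one, NNReal.coe_one]

theorem FDist.complete_toSubDist {O : Type*} (γ : FDist O) (o : O) :
    γ.toSubDist.complete o = γ := by
  refine FDist.ext_ex fun f => ?_
  have h : γ.toSubDist.weight = γ.weight := rfl
  rw [SubDist.ex_complete, h, ← FDist.ex_eq_weightEx, ← FDist.ex_eq_weightEx, FDist.ex_const]
  simp

theorem weightEx_sum_smul {O : Type*} (f : O → ℝ) (s : Finset ι) (p : ι → ℝ≥0)
    (e : ι → FDist O) :
    weightEx f (∑ i ∈ s, p i • (e i).weight) = ∑ i ∈ s, (p i : ℝ) * (e i).ex f := by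
  rw [map_sum]
  exact Finset.sum_congr rfl fun i _ => by rw [weightEx_smul, FDist.ex_eq_weightEx]

/-- The missing mass becomes one more index, `none`, located at `Dead`. It idles under `τ` and is
stuck under any other action, so it obeys the same rule as the genuine indices. -/
theorem LiftedStep.exists_family {α : Act g} {γ γ' : SubDist (CPS g)} (h : LiftedStep α γ γ') :
    ∃ (ι : Type) (ρ : FDist ι) (m : ι → CPS g) (e : ι → FDist (CPS g)),
      γ.complete Dead = ρ.map m ∧ γ'.complete Dead = ρ.bind e ∧
      ∀ i, HatStep (m i) α (e i) ∨ (¬ ∃ δ, HatStep (m i) α δ) ∧ e i = .dirac Dead := by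
  classical
  obtain ⟨n, p, M, J, η, hp, hγ, hJ, hη, hJ', hγ'⟩ := h
  have hmass : mass γ.weight = ∑ i, p i := by
    rw [hγ, mass_finset_sum]
    simp only [mass_smul, FDist.mass_eq_one, mul_one]
  let ρ : FDist (Option (Fin n)) :=
    ⟨∑ i, Finsupp.single (some i) (p i) + Finsupp.single none (1 - mass γ.weight), by
      rw [mass_add, mass_finset_sum, mass_single]
      simp only [mass_single]
      rw [← hmass]
      exact add_tsub_cancel_of_le γ.mass_le_one⟩
  have hρ : ∀ f : Option (Fin n) → ℝ,
      ρ.ex f = ∑ i, (p i : ℝ) * f (some i) + (1 - ∑ i, (p i : ℝ)) * f none := by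
    intro f
    rw [FDist.ex_eq_weightEx, map_add, map_sum]
    simp only [weightEx_single]
    rw [NNReal.coe_sub γ.mass_le_one, NNReal.coe_one, hmass, NNReal.coe_sum]
  let m : Option (Fin n) → CPS g := fun i => i.elim Dead M
  by_cases hα : α = .tau
  · subst hα
    -- Every system can idle, so a lifted `τ`-step loses no mass.
    have hJu : ∀ i, i ∈ J := fun i => by
      by_contra hi
      exact hJ' i hi ⟨_, Or.inr ⟨rfl, rfl⟩⟩
    obtain rfl : J = Finset.univ := Finset.eq_univ_iff_forall.2 hJu
    refine ⟨_, ρ, m, fun i => i.elim (.dirac Dead) η, ?_, ?_, ?_⟩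
    · refine FDist.ext_ex fun f => ?_
      rw [SubDist.ex_complete, hγ, weightEx_sum_smul, weightEx_sum_smul, FDist.ex_map, hρ]
      simp [m]
    · refine FDist.ext_ex fun f => ?_
      rw [SubDist.ex_complete, hγ', weightEx_sum_smul, weightEx_sum_smul, FDist.ex_bind, hρ]
      simp [FDist.ex_const]
    · rintro (_ | i)
      · exact Or.inl (Or.inr ⟨rfl, rfl⟩)
      · exact Or.inl (hη i (Finset.mem_univ i))
  · refine ⟨_, ρ, m, fun i => i.elim (.dirac Dead) fun i => if i ∈ J then η i else .dirac Dead,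
      ?_, ?_, ?_⟩
    · refine FDist.ext_ex fun f => ?_
      rw [SubDist.ex_complete, hγ, weightEx_sum_smul, weightEx_sum_smul, FDist.ex_map, hρ]
      simp [m]
    · refine FDist.ext_ex fun f => ?_
      rw [SubDist.ex_complete, hγ', weightEx_sum_smul, weightEx_sum_smul, FDist.ex_bind, hρ]
      simp only [FDist.ex_const, mul_one, Option.elim, FDist.ex_dirac]
      have h1 : ∀ i, (if i ∈ J then η i else FDist.dirac Dead).ex f =
          if i ∈ J then (η i).ex f else f Dead := by
        intro i
        split_ifs <;> simp
      simp only [h1, mul_ite, Finset.sum_ite]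
      rw [← Finset.sum_filter_add_sum_filter_not Finset.univ (fun i => i ∈ J) fun i => (p i : ℝ),
        ← Finset.sum_mul]
      have h2 : Finset.univ.filter (fun i => i ∈ J) = J := by ext; simp
      rw [h2]
      ring
    · rintro (_ | i)
      · refine Or.inr ⟨?_, rfl⟩
        rintro ⟨δ, h | h⟩
        · exact not_step_dead h
        · exact hα h.1
      · by_cases hi : i ∈ J
        · simp only [Option.elim, if_pos hi]
          exact Or.inl (hη i hi)
        · simp only [Option.elim, if_neg hi]
          exact Or.inr ⟨hJ' i hi, trivial⟩

theorem WeakTau.exists_kernel {γ γ' : SubDist (CPS g)} (h : WeakTau γ γ') :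
    ∃ k : CPS g → FDist (CPS g), (∀ s ∈ (γ.complete Dead).supp, TauRun s (k s)) ∧
      γ'.complete Dead = (γ.complete Dead).bind k := by
  induction h with
  | refl => exact ⟨.dirac, fun s _ => .refl s, (FDist.bind_dirac _).symm⟩
  | @tail δ δ' _ h ih =>
    obtain ⟨k, hk, hk'⟩ := ih
    obtain ⟨ι, ρ, m, e, h1, h2, h3⟩ := h.exists_family
    have h4 : ∀ i ∈ ρ.supp, TauRun (m i) (e i) := by
      intro i _
      rcases h3 i with (h | ⟨-, h⟩) | ⟨h, -⟩
      · exact .of_step h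
      · rw [h]; exact .refl _
      · exact absurd ⟨_, Or.inr ⟨rfl, rfl⟩⟩ h
    obtain ⟨l, hl, hl'⟩ := Run.exists_kernel h4
    refine ⟨fun s => (k s).bind l, fun s hs => (hk s hs).comp fun t ht => hl t ?_, ?_⟩
    · rw [← h1, hk']
      exact FDist.mem_supp_bind.2 ⟨s, hs, ht⟩
    · rw [h2, hl', ← h1, hk', FDist.bind_assoc]

theorem WeakTau.tauRun {N : CPS g} {γ : SubDist (CPS g)}
    (h : WeakTau (FDist.dirac N).toSubDist γ) : TauRun N (γ.complete Dead) := by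
  obtain ⟨k, hk, hk'⟩ := h.exists_kernel
  rw [FDist.complete_toSubDist] at hk hk'
  rw [hk', FDist.dirac_bind]
  exact hk N (FDist.mem_supp_dirac.2 rfl)

theorem weakStep_iff {N : CPS g} {α : Act g} (hα : α ≠ .tau) {γ : SubDist (CPS g)} :
    WeakStep N α γ ↔ ∃ δ δ', WeakTau (FDist.dirac N).toSubDist δ ∧ LiftedStep α δ δ' ∧
      WeakTau δ' γ := by
  cases α <;> first | exact absurd rfl hα | exact Iff.rfl

theorem WeakStep.run {N : CPS g} {α : Act g} (hα : α ≠ .tau) {γ : SubDist (CPS g)}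
    (h : WeakStep N α γ) : Run (PerformOrStuck α) N (γ.complete Dead) := by
  obtain ⟨δ, δ', h1, h2, h3⟩ := (weakStep_iff hα).1 h
  obtain ⟨ι, ρ, m, e, h4, h5, h6⟩ := h2.exists_family
  obtain ⟨k, hk, hk'⟩ := h3.exists_kernel
  have h1 := h1.tauRun
  rw [h4] at h1
  rw [hk', h5, FDist.bind_assoc]
  refine h1.comp_map fun i hi => .base ?_
  have hki : ∀ s ∈ (e i).supp, TauRun s (k s) := fun s hs =>
    hk s (h5 ▸ FDist.mem_supp_bind.2 ⟨i, hi, hs⟩)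
  rcases h6 i with (h | ⟨h, -⟩) | ⟨h, h'⟩
  · exact Or.inl ⟨_, k, h, hki, rfl⟩
  · exact absurd h hα
  · refine Or.inr ⟨fun ⟨δ, hδ⟩ => h ⟨δ, Or.inl hδ⟩, ?_⟩
    rw [h'] at hki ⊢
    exact dirac_dead_bind hki

/-- Not all mass may be dropped: the set `J` of a lifted step is nonempty, so some system reached
from `Dead`, hence `Dead` itself, would perform `α`. -/
theorem not_weakStep_dead {α : Act g} (hα : α ≠ .tau) {γ : SubDist (CPS g)} :
    ¬ WeakStep Dead α γ := by
  intro h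
  obtain ⟨δ, δ', h1, ⟨n, p, M, J, η, hp, hδ, ⟨j, hj⟩, hη, -, -⟩, -⟩ := (weakStep_iff hα).1 h
  have h1 := h1.tauRun.eq_dirac stable_dead
  have hMj : M j ∈ (δ.complete Dead).supp := by
    rw [FDist.mem_supp, SubDist.complete, Finsupp.add_apply, hδ, Finsupp.finsetSum_apply]
    refine ne_of_gt (add_pos_of_pos_of_nonneg ?_ zero_le)
    refine Finset.sum_pos' (fun _ _ => zero_le) ⟨j, Finset.mem_univ j, ?_⟩
    simpa [FDist.dirac] using hp j
  rw [h1] at hMj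
  have := FDist.mem_supp_dirac.1 hMj
  rcases hη j hj with h | h
  · rw [this] at h
    exact not_step_dead h
  · exact hα h.1

/-! ### From runs back to weak transitions. -/

theorem LiftedStep.of_fintype [Fintype ι] {α : Act g} {γ γ' : SubDist (CPS g)} (p : ι → ℝ≥0)
    (M : ι → CPS g) (J : Finset ι) (η : ι → FDist (CPS g)) (hp : ∀ i, 0 < p i)
    (hγ : γ.weight = ∑ i, p i • (FDist.dirac (M i)).weight) (hJ : J.Nonempty)
    (hη : ∀ j ∈ J, HatStep (M j) α (η j)) (hJ' : ∀ i ∉ J, ¬ ∃ δ, HatStep (M i) α δ)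
    (hγ' : γ'.weight = ∑ j ∈ J, p j • (η j).weight) : LiftedStep α γ γ' := by
  classical
  let ε := (Fintype.equivFin ι).symm
  refine ⟨Fintype.card ι, fun i => p (ε i), fun i => M (ε i), J.map ε.symm.toEmbedding,
    fun i => η (ε i), fun i => hp _, ?_, hJ.map, fun j hj => ?_, fun i hi => ?_, ?_⟩
  · rw [hγ]
    exact (Equiv.sum_comp ε fun i => p i • (FDist.dirac (M i)).weight).symm
  · obtain ⟨j', hj', rfl⟩ := Finset.mem_map.1 hj
    simpa using hη j' hj'
  · refine hJ' _ fun h => hi (Finset.mem_map.2 ⟨ε i, h, ?_⟩)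
    simp
  · rw [hγ', Finset.sum_map]
    simp

/-- `γ` can evolve into `e` by `τ`-transitions, whatever else is there. -/
def Evolves (γ e : FDist (CPS g)) : Prop :=
  ∀ (p : ℝ≥0) (r : CPS g →₀ ℝ≥0) (δ δ' : SubDist (CPS g)), p ≠ 0 →
    δ.weight = p • γ.weight + r → δ'.weight = p • e.weight + r → WeakTau δ δ'

theorem SubDist.exists_of_mass_eq {O : Type*} (γ : SubDist O) {w : O →₀ ℝ≥0}
    (h : mass w = mass γ.weight) : ∃ γ' : SubDist O, γ'.weight = w :=
  ⟨⟨w, h ▸ γ.mass_pos, h ▸ γ.mass_le_one⟩, rfl⟩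

/-- The components evolve one at a time while the others are part of the idle rest; this is what the
arbitrary scale and remainder in `Evolves` are for. -/
theorem weakTau_sum {s : Finset ι} {p : ι → ℝ≥0} {a e : ι → FDist (CPS g)}
    (hp : ∀ i ∈ s, p i ≠ 0) (h : ∀ i ∈ s, Evolves (a i) (e i)) {r : CPS g →₀ ℝ≥0}
    {δ δ' : SubDist (CPS g)} (hδ : δ.weight = ∑ i ∈ s, p i • (a i).weight + r)
    (hδ' : δ'.weight = ∑ i ∈ s, p i • (e i).weight + r) : WeakTau δ δ' := by
  classical
  induction s using Finset.induction_on generalizing r δ δ' with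
  | empty =>
    rw [SubDist.weight_injective (hδ.trans hδ'.symm)]
    exact .refl
  | insert i s hi ih =>
    rw [Finset.sum_insert hi] at hδ hδ'
    obtain ⟨θ, hθ⟩ := δ.exists_of_mass_eq
      (w := ∑ i ∈ s, p i • (a i).weight + (p i • (e i).weight + r)) (by
        rw [hδ]
        simp only [mass_add, mass_smul, FDist.mass_eq_one]
        ring)
    have h1 : WeakTau δ θ := h i (Finset.mem_insert_self i s) (p i)
      (∑ i ∈ s, p i • (a i).weight + r) δ θ (hp i (Finset.mem_insert_self i s))
      (by rw [hδ, add_assoc]) (by rw [hθ]; abel)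
    refine h1.trans (ih (fun i hi => hp i (Finset.mem_insert_of_mem hi))
      (fun i hi => h i (Finset.mem_insert_of_mem hi)) hθ ?_)
    rw [hδ']; abel

theorem Evolves.bind {ρ : FDist ι} {a e : ι → FDist (CPS g)}
    (h : ∀ i ∈ ρ.supp, Evolves (a i) (e i)) : Evolves (ρ.bind a) (ρ.bind e) := by
  intro p r δ δ' hp hδ hδ'
  rw [FDist.bind_weight, Finset.smul_sum] at hδ hδ'
  simp only [smul_smul] at hδ hδ'
  exact weakTau_sum (fun i hi => mul_ne_zero hp (FDist.mem_supp.1 hi)) h hδ hδ'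

theorem Evolves.trans {γ δ θ : FDist (CPS g)} (h : Evolves γ δ) (h' : Evolves δ θ) :
    Evolves γ θ := by
  intro p r a b hp ha hb
  obtain ⟨c, hc⟩ := a.exists_of_mass_eq (w := p • δ.weight + r) (by
    rw [ha]; simp only [mass_add, mass_smul, FDist.mass_eq_one])
  exact (h p r a c hp ha hc).trans (h' p r c b hp hc hb)

theorem Evolves.of_step {M : CPS g} {ν : FDist (CPS g)} (h : Step M .tau ν) :
    Evolves (.dirac M) ν := by
  classical
  intro p r δ δ' hp hδ hδ'
  have hr : r = ∑ s : {s // s ∈ r.support}, r s • (FDist.dirac (s : CPS g)).weight := by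
    rw [Finset.sum_coe_sort r.support fun s => r s • (FDist.dirac s).weight]
    conv_lhs => rw [← Finsupp.sum_single r]
    simp [Finsupp.sum, FDist.dirac, Finsupp.smul_single]
  refine .single (LiftedStep.of_fintype (ι := Option {s // s ∈ r.support})
    (fun i => i.elim p fun s => r s) (fun i => i.elim M fun s => s) Finset.univ
    (fun i => i.elim ν fun s => .dirac s) ?_ ?_ ⟨none, Finset.mem_univ _⟩ ?_ ?_ ?_)
  · rintro (_ | s)
    · exact pos_iff_ne_zero.2 hp
    · exact pos_iff_ne_zero.2 (Finsupp.mem_support_iff.1 s.2)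
  · rw [hδ, Fintype.sum_option]
    conv_lhs => rw [hr]
    rfl
  · rintro (_ | s) _
    · exact Or.inl h
    · exact Or.inr ⟨rfl, rfl⟩
  · exact fun i hi => absurd (Finset.mem_univ i) hi
  · rw [hδ', Fintype.sum_option]
    conv_lhs => rw [hr]
    rfl

theorem TauRun.evolves {M : CPS g} {η : FDist (CPS g)} (h : TauRun M η) :
    Evolves (.dirac M) η := by
  induction h with
  | base h =>
    subst h
    intro p r δ δ' _ hδ hδ'
    rw [SubDist.weight_injective (hδ.trans hδ'.symm)]
    exact .refl
  | @step N ν k h _ ih =>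
    refine (Evolves.of_step h).trans ?_
    conv => arg 1; rw [← FDist.bind_dirac ν]
    exact Evolves.bind ih
  | @mix N ρ _ ih =>
    rw [← FDist.bind_const ρ (.dirac N)]
    exact Evolves.bind ih

theorem Evolves.weakTau {γ e : FDist (CPS g)} (h : Evolves γ e) :
    WeakTau γ.toSubDist e.toSubDist := by
  refine h 1 0 _ _ one_ne_zero ?_ ?_ <;> rw [one_smul, add_zero] <;> rfl

theorem TauRun.weakStep {N : CPS g} {η : FDist (CPS g)} (h : TauRun N η) :
    WeakStep N .tau η.toSubDist :=
  h.evolves.weakTau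

theorem Perform.exists_evolves {α : Act g} {M : CPS g} {e : FDist (CPS g)} (h : Perform α M e) :
    ∃ γ, Step M α γ ∧ Evolves γ e := by
  obtain ⟨γ, k, h1, h2, rfl⟩ := h
  refine ⟨γ, h1, ?_⟩
  conv => arg 1; rw [← FDist.bind_dirac γ]
  exact Evolves.bind fun s hs => (h2 s hs).evolves

/-- Runs that lose probability mass in systems without `α`-transition only, but not everything,
are weak transitions. -/
theorem exists_weakStep {N : CPS g} {α : Act g} (hα : α ≠ .tau) {ρ : FDist ι} {m : ι → CPS g}
    {e : ι → FDist (CPS g)} (hN : TauRun N (ρ.map m))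
    (h : ∀ i ∈ ρ.supp, PerformOrStuck α (m i) (e i)) (hne : ∃ i ∈ ρ.supp, Perform α (m i) (e i)) :
    ∃ γ : SubDist (CPS g), WeakStep N α γ ∧ γ.complete Dead = ρ.bind e := by
  classical
  have h' : ∀ i, ∃ γ, Perform α (m i) (e i) → Step (m i) α γ ∧ Evolves γ (e i) := by
    intro i
    by_cases hi : Perform α (m i) (e i)
    · obtain ⟨γ, hγ⟩ := hi.exists_evolves
      exact ⟨γ, fun _ => hγ⟩
    · exact ⟨e i, fun hi' => absurd hi' hi⟩
  choose a ha using h'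
  -- The indices that survive the lifted `α`-step. The other indices of the support are stuck, so
  -- the step is allowed to drop them.
  let J := ρ.supp.filter fun i => Perform α (m i) (e i)
  have hmass : ∀ b : ι → FDist (CPS g),
      mass (∑ i ∈ J, ρ.weight i • (b i).weight) = ∑ i ∈ J, ρ.weight i := by
    intro b
    rw [mass_finset_sum]
    simp only [mass_smul, FDist.mass_eq_one, mul_one]
  have hpos : 0 < ∑ i ∈ J, ρ.weight i := by
    obtain ⟨i, hi, hi'⟩ := hne
    exact Finset.sum_pos' (fun _ _ => zero_le)
      ⟨i, Finset.mem_filter.2 ⟨hi, hi'⟩, pos_iff_ne_zero.2 (FDist.mem_supp.1 hi)⟩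
  have hle : ∑ i ∈ J, ρ.weight i ≤ 1 := by
    rw [← ρ.mass_eq_one, mass, Finsupp.sum]
    exact Finset.sum_le_sum_of_subset (Finset.filter_subset _ _)
  let δ : SubDist (CPS g) := ⟨∑ i ∈ J, ρ.weight i • (a i).weight, by rwa [hmass], by rwa [hmass]⟩
  let γ : SubDist (CPS g) := ⟨∑ i ∈ J, ρ.weight i • (e i).weight, by rwa [hmass], by rwa [hmass]⟩
  refine ⟨γ, (weakStep_iff hα).2 ⟨(ρ.map m).toSubDist, δ, hN.evolves.weakTau, ?_, ?_⟩, ?_⟩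
  · refine LiftedStep.of_fintype (ι := {i // i ∈ ρ.supp}) (fun i => ρ.weight i) (fun i => m i)
      (Finset.univ.filter fun i => Perform α (m i) (e i)) (fun i => a i)
      (fun i => pos_iff_ne_zero.2 (FDist.mem_supp.1 i.2)) ?_ ?_ ?_ ?_ ?_
    · rw [Finset.sum_coe_sort ρ.supp fun i => ρ.weight i • (FDist.dirac (m i)).weight]
      exact FDist.map_weight _ _
    · obtain ⟨i, hi, hi'⟩ := hne
      exact ⟨⟨i, hi⟩, by simpa using hi'⟩
    · intro i hi
      exact Or.inl (ha i (Finset.mem_filter.1 hi).2).1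
    · rintro i hi ⟨θ, hθ⟩
      have hi : ¬ Perform α (m i) (e i) := by simpa using hi
      rcases h i i.2 with h | h
      · exact hi h
      · rcases hθ with hθ | hθ
        · exact h.1 ⟨θ, hθ⟩
        · exact hα hθ.1
    · have : δ.weight = ∑ i ∈ J, ρ.weight i • (a i).weight := rfl
      rw [this, Finset.sum_filter, Finset.sum_filter]
      exact (Finset.sum_coe_sort ρ.supp fun i =>
        if Perform α (m i) (e i) then ρ.weight i • (a i).weight else 0).symm
  · exact weakTau_sum (r := 0) (s := J) (p := ρ.weight)
      (fun i hi => FDist.mem_supp.1 (Finset.mem_filter.1 hi).1)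
      (fun i hi => (ha i (Finset.mem_filter.1 hi).2).2) (add_zero _).symm (add_zero _).symm
  · refine FDist.ext_ex fun f => ?_
    have h1 : γ.weight = ∑ i ∈ J, ρ.weight i • (e i).weight := rfl
    have h2 : ρ.ex (fun _ => 1) = 1 := FDist.ex_const _ _
    rw [SubDist.ex_complete, h1, weightEx_sum_smul, weightEx_sum_smul, FDist.ex_bind]
    rw [FDist.ex_eq_sum, ← Finset.sum_filter_add_sum_filter_not _
      (fun i => Perform α (m i) (e i))] at h2
    rw [FDist.ex_eq_sum, ← Finset.sum_filter_add_sum_filter_not ρ.supp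
      (fun i => Perform α (m i) (e i))]
    simp only [FDist.ex_const, mul_one] at h2 ⊢
    -- The dropped mass, which completion restores at `Dead`, is the mass of the stuck indices,
    -- whose outcome is already `Dead`.
    have h3 : ∀ i ∈ ρ.supp.filter (fun i => ¬ Perform α (m i) (e i)),
        (ρ.weight i : ℝ) * (e i).ex f = ρ.weight i * f Dead := by
      intro i hi
      obtain ⟨hi, hi'⟩ := Finset.mem_filter.1 hi
      rw [((h i hi).resolve_left hi').2, FDist.ex_dirac]
    rw [Finset.sum_congr rfl h3, ← Finset.sum_mul, eq_sub_of_add_eq' h2]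

end WeakTransitions

/-! ## The functional and its iterates -/

section Functional

variable {g : Signature.{u}}

theorem kantorovich_mono {O : Type*} {d d' : O → O → unitInterval} (h : d ≤ d') (γ η : FDist O) :
    kantorovich d γ η ≤ kantorovich d' γ η :=
  iInf₂_mono fun ω _ => Subtype.coe_le_coe.1 (by
    rw [FDist.coe_expect, FDist.coe_expect]
    exact FDist.ex_mono fun p _ => h p.1 p.2)

theorem kantorovich_comm {O : Type*} {d : O → O → unitInterval} (hd : ∀ x y, d x y = d y x)
    (γ η : FDist O) : kantorovich d γ η = kantorovich d η γ := by
  have key : ∀ γ η : FDist O, kantorovich d γ η ≤ kantorovich d η γ := fun γ η =>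
    le_iInf₂ fun ω hω => Coupled.kantorovich_le
      (Coupled.swap hd ⟨ω, hω.1, hω.2, le_of_eq (FDist.coe_expect _ _).symm⟩)
  exact le_antisymm (key _ _) (key _ _)

theorem bisimFunctional_mono : Monotone (bisimFunctional (g := g)) := by
  intro d d' h M N
  exact iSup₂_mono fun α _ => max_le_max
    (iSup₂_mono fun γ _ => iInf₂_mono fun _ _ => kantorovich_mono h _ _)
    (iSup₂_mono fun γ _ => iInf₂_mono fun _ _ => kantorovich_mono h _ _)

theorem bisimFunctional_comm {d : CPS g → CPS g → unitInterval} (hd : ∀ M N, d M N = d N M)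
    (M N : CPS g) : bisimFunctional d M N = bisimFunctional d N M := by
  unfold bisimFunctional
  refine iSup_congr fun α => iSup_congr_Prop or_comm fun _ => ?_
  rw [max_comm]
  congr 1
  · exact iSup_congr fun γ => iSup_congr fun _ => iInf_congr fun _ => iInf_congr fun _ =>
      kantorovich_comm hd _ _
  · exact iSup_congr fun γ => iSup_congr fun _ => iInf_congr fun _ => iInf_congr fun _ =>
      kantorovich_comm hd _ _

theorem iInf_kantorovich_le_bisimFunctional {d : CPS g → CPS g → unitInterval} {M N : CPS g}
    {α : Act g} {γ : FDist (CPS g)} (h : Step M α γ) :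
    ⨅ (γ' : SubDist (CPS g)) (_ : WeakStep N α γ'), kantorovich d γ (γ'.complete Dead) ≤
      bisimFunctional d M N := by
  refine le_trans ?_ (le_iSup₂ (f := fun (α : Act g)
    (_ : (∃ γ, Step M α γ) ∨ ∃ γ, Step N α γ) => _) α (Or.inl ⟨γ, h⟩))
  refine le_trans ?_ (le_max_left _ _)
  exact le_iSup₂ (f := fun (γ : FDist (CPS g)) (_ : Step M α γ) =>
    ⨅ (γ' : SubDist (CPS g)) (_ : WeakStep N α γ'), kantorovich d γ (γ'.complete Dead)) γ h

theorem exists_weakStep_of_bisimFunctional_lt {d : CPS g → CPS g → unitInterval} {M N : CPS g}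
    {α : Act g} {γ : FDist (CPS g)} (h : Step M α γ) {c : unitInterval}
    (hc : bisimFunctional d M N < c) :
    ∃ γ' : SubDist (CPS g), WeakStep N α γ' ∧ Coupled d c γ (γ'.complete Dead) := by
  have hlt := (iInf_kantorovich_le_bisimFunctional (N := N) (d := d) h).trans_lt hc
  rw [iInf_lt_iff] at hlt
  obtain ⟨γ', hlt⟩ := hlt
  rw [iInf_lt_iff] at hlt
  obtain ⟨hγ', hlt⟩ := hlt
  exact ⟨γ', hγ', coupled_of_kantorovich_lt hlt⟩

/-- A criterion for prefixed points. Answers are needed only for bounds strictly between `d M N` and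
`1`, so no infimum has to be attained, and symmetry leaves one direction to check. -/
theorem bisimFunctional_le_self {d : CPS g → CPS g → unitInterval} (hd : ∀ M N, d M N = d N M)
    (h : ∀ (M N : CPS g) (α : Act g) (γ : FDist (CPS g)), Step M α γ → ∀ c : unitInterval,
      d M N < c → c < 1 →
        ∃ γ' : SubDist (CPS g), WeakStep N α γ' ∧ Coupled d c γ (γ'.complete Dead)) :
    bisimFunctional d ≤ d := by
  have key : ∀ (M N : CPS g) (α : Act g) (γ : FDist (CPS g)), Step M α γ →
      ⨅ (γ' : SubDist (CPS g)) (_ : WeakStep N α γ'), kantorovich d γ (γ'.complete Dead) ≤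
        d M N := by
    intro M N α γ hs
    by_contra! hlt
    obtain ⟨c, hc1, hc2⟩ := exists_between hlt
    obtain ⟨γ', h1, h2⟩ := h M N α γ hs c hc1 (hc2.trans_le le_top)
    exact absurd ((iInf₂_le γ' h1).trans h2.kantorovich_le) (not_le_of_gt hc2)
  intro M N
  refine iSup₂_le fun α _ => max_le (iSup₂_le fun γ hγ => key M N α γ hγ)
    (iSup₂_le fun γ hγ => ?_)
  rw [hd M N]
  refine le_trans (le_of_eq ?_) (key N M α γ hγ)
  exact iInf_congr fun _ => iInf_congr fun _ => kantorovich_comm hd _ _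

theorem nWeakBisimilarityMetric_succ (n : ℕ) :
    nWeakBisimilarityMetric g (n + 1) = bisimFunctional (nWeakBisimilarityMetric g n) :=
  Function.iterate_succ_apply' _ _ _

theorem nWeakBisimilarityMetric_mono : Monotone (nWeakBisimilarityMetric g) :=
  Monotone.monotone_iterate_of_le_map bisimFunctional_mono fun _ _ => bot_le

theorem nWeakBisimilarityMetric_comm (n : ℕ) (M N : CPS g) :
    nWeakBisimilarityMetric g n M N = nWeakBisimilarityMetric g n N M := by
  induction n generalizing M N with
  | zero => rfl
  | succ n ih =>
    rw [nWeakBisimilarityMetric_succ]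
    exact bisimFunctional_comm ih M N

theorem nWeakBisimilarityMetric_le {d : CPS g → CPS g → unitInterval}
    (hd : bisimFunctional d ≤ d) (n : ℕ) : nWeakBisimilarityMetric g n ≤ d := by
  induction n with
  | zero => exact fun _ _ => bot_le
  | succ n ih =>
    rw [nWeakBisimilarityMetric_succ]
    exact (bisimFunctional_mono ih).trans hd

/-- The supremum of the `n`-weak bisimilarity metrics. -/
def limitMetric (g : Signature.{u}) (M N : CPS g) : unitInterval :=
  ⨆ n, nWeakBisimilarityMetric g n M N

theorem tendsto_limitMetric (M N : CPS g) :
    Tendsto (fun n => nWeakBisimilarityMetric g n M N) atTop (𝓝 (limitMetric g M N)) :=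
  tendsto_atTop_iSup fun _ _ h => nWeakBisimilarityMetric_mono h M N

/-- Applied to the discrete metric it gives zero self-distance, to `pathMetric` the triangle
inequality, and to an arbitrary weak bisimulation metric minimality. -/
theorem limitMetric_le {d : CPS g → CPS g → unitInterval} (hd : bisimFunctional d ≤ d) :
    limitMetric g ≤ d :=
  fun M N => iSup_le fun n => nWeakBisimilarityMetric_le hd n M N

theorem limitMetric_comm (M N : CPS g) : limitMetric g M N = limitMetric g N M :=
  iSup_congr fun n => nWeakBisimilarityMetric_comm n M N

theorem Step.exists_weakStep {M : CPS g} {α : Act g} {γ : FDist (CPS g)} (h : Step M α γ) :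
    ∃ γ' : SubDist (CPS g), WeakStep M α γ' ∧ γ'.complete Dead = γ := by
  by_cases hα : α = .tau
  · subst hα
    exact ⟨γ.toSubDist, (TauRun.of_step h).weakStep, γ.complete_toSubDist Dead⟩
  · have hp : Perform α M γ := ⟨γ, .dirac, h, fun s _ => TauRun.refl s, (FDist.bind_dirac γ).symm⟩
    obtain ⟨γ', h1, h2⟩ := CPC.exists_weakStep (ρ := .dirac ()) (m := fun _ => M)
      (e := fun _ => γ) hα (by rw [FDist.map_dirac]; exact TauRun.refl M) (fun _ _ => Or.inl hp)
      ⟨(), FDist.mem_supp_dirac.2 rfl, hp⟩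
    exact ⟨γ', h1, by rw [h2, FDist.dirac_bind]⟩

theorem limitMetric_self (M : CPS g) : limitMetric g M M = 0 := by
  classical
  let d : CPS g → CPS g → unitInterval := fun M N => if M = N then 0 else 1
  have hd : bisimFunctional d ≤ d := by
    refine bisimFunctional_le_self (fun M N => by simp only [d, eq_comm]) ?_
    intro M N α γ h c hc hc1
    have hMN : M = N := by
      by_contra hne
      simp only [d, if_neg hne] at hc
      exact absurd (hc.trans hc1) (lt_irrefl _)
    subst hMN
    obtain ⟨γ', h1, h2⟩ := h.exists_weakStep
    exact ⟨γ', h1, h2 ▸ (coupled_refl (d := d) (fun x => if_pos rfl) γ).mono c.2.1⟩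
  have := limitMetric_le hd M M
  rw [show d M M = 0 from if_pos rfl] at this
  exact le_antisymm this bot_le

theorem exists_weakStep_of_limitMetric_lt {M N : CPS g} {α : Act g} {γ : FDist (CPS g)}
    (h : Step M α γ) (h1 : limitMetric g M N < 1) (n : ℕ) {c : ℝ} (hc : limitMetric g M N < c) :
    ∃ γ' : SubDist (CPS g), WeakStep N α γ' ∧
      Coupled (nWeakBisimilarityMetric g n) c γ (γ'.complete Dead) := by
  have h0 : (0 : ℝ) ≤ limitMetric g M N := (limitMetric g M N).2.1
  -- Truncation brings the bound into `[0,1]`; it stays strictly above the distance because that is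
  -- below `1`.
  let c' : unitInterval := ⟨min c 1, le_min (h0.trans hc.le) zero_le_one, min_le_right _ _⟩
  have hc' : limitMetric g M N < c' := Subtype.coe_lt_coe.1 (lt_min hc h1)
  have hlt : bisimFunctional (nWeakBisimilarityMetric g n) M N < c' := by
    rw [← nWeakBisimilarityMetric_succ]
    -- The shift to `n + 1` pays for unfolding the functional once.
    exact (le_iSup (fun n => nWeakBisimilarityMetric g n M N) (n + 1)).trans_lt hc'
  obtain ⟨γ', h2, h3⟩ := exists_weakStep_of_bisimFunctional_lt h hlt
  exact ⟨γ', h2, h3.mono (min_le_left _ _)⟩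

theorem coupled_of_not_lt_one {O : Type*} {d : O → O → unitInterval} {c : unitInterval}
    (h : ¬ c < 1) (γ η : FDist O) : Coupled d c γ η :=
  coupled_of_one_le (not_lt.1 h) γ η

end Functional

/-! ## Transfer along runs -/

section Transfer

variable {g : Signature.{u}}

/-- An `α`-transition followed by `τ`-transitions, or loss of the probability mass: at any time for
a communication, but only in the dead system for `tick`. -/
def Observe (α : Act g) (M : CPS g) (e : FDist (CPS g)) : Prop :=
  Perform α M e ∨ (α = .tick → M = Dead) ∧ e = .dirac Dead

/-- Outcomes of `Observe` without randomisation. -/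
def PureObserve (α : Act g) (M : CPS g) (e : FDist (CPS g)) : Prop :=
  (∃ γ, Step M α γ ∧ ∃ k : CPS g → FDist (CPS g),
    (∀ s ∈ γ.supp, k s ∈ {e | PureRun (fun N η => η = .dirac N) s e}) ∧ e = γ.bind k) ∨
  (α = .tick → M = Dead) ∧ e = .dirac Dead

theorem finite_dirac (M : CPS g) : {e : FDist (CPS g) | e = .dirac M}.Finite :=
  Set.finite_singleton _

theorem PureObserve.finite (α : Act g) (M : CPS g) : {e | PureObserve α M e}.Finite := by
  refine (((step_finite M α).biUnion (t := fun γ => {e | ∃ k : CPS g → FDist (CPS g),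
    (∀ s ∈ γ.supp, k s ∈ {e | PureRun (fun N η => η = .dirac N) s e}) ∧ e = γ.bind k})
    fun γ _ => finite_bind fun s _ => PureRun.finite finite_dirac s).union
    (finite_dirac Dead)).subset ?_
  rintro e (⟨γ, h, hk⟩ | h)
  · exact Or.inl (Set.mem_biUnion h hk)
  · exact Or.inr h.2

theorem PureObserve.observe {α : Act g} {M : CPS g} {e : FDist (CPS g)} (h : PureObserve α M e) :
    Observe α M e := by
  rcases h with ⟨γ, h, k, hk, rfl⟩ | h
  · exact Or.inl ⟨γ, k, h, fun s hs => (hk s hs).run, rfl⟩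
  · exact Or.inr h

theorem Observe.mem_mixtures {α : Act g} {M : CPS g} {e : FDist (CPS g)} (h : Observe α M e) :
    e ∈ Mixtures {e | PureObserve α M e} := by
  rcases h with ⟨γ, k, h, hk, rfl⟩ | h
  · refine Mixtures.mono ?_ (bind_mem_mixtures_bind fun s hs =>
      (hk s hs).mem_mixtures (B' := fun N η => η = .dirac N) fun M e he => mem_mixtures_of_mem he)
    rintro _ ⟨f, hf, rfl⟩
    exact Or.inl ⟨γ, h, f, hf, rfl⟩
  · exact mem_mixtures_of_mem (Or.inr h)

theorem Observe.bind {α : Act g} {M : CPS g} {e : FDist (CPS g)} (h : Observe α M e)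
    (k : CPS g → FDist (CPS g)) (hk : ∀ s ∈ e.supp, TauRun s (k s)) : Observe α M (e.bind k) := by
  rcases h with h | ⟨h, rfl⟩
  · exact Or.inl (h.bind hk)
  · exact Or.inr ⟨h, dirac_dead_bind hk⟩

theorem Step.observe {α : Act g} {M : CPS g} {γ : FDist (CPS g)} (h : Step M α γ) :
    Observe α M γ :=
  Or.inl ⟨γ, .dirac, h, fun s _ => TauRun.refl s, (FDist.bind_dirac γ).symm⟩

/-- Supplies an arbitrary outcome when the distance is `1` and any coupling will do. For `tick`,
perform `τ` until the system is stable; it then ticks or is `Dead`. A communication may drop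
everything at once. -/
theorem exists_run_observe (α : Act g) (N : CPS g) : ∃ η, Run (Observe α) N η := by
  by_cases hα : α = .tick
  · subst hα
    induction hn : N.rank using Nat.strong_induction_on generalizing N with
    | _ n ih =>
      subst hn
      by_cases hN : N.Stable
      · by_cases hi : N.InInv
        · obtain ⟨γ, hγ⟩ := hN.exists_tick hi
          exact ⟨γ, .base hγ.observe⟩
        · exact ⟨_, .base (Or.inr ⟨fun _ => hN.eq_dead hi, rfl⟩)⟩
      · simp only [CPS.Stable, not_forall, not_not] at hN
        obtain ⟨ν, hν⟩ := hN
        have ih' : ∀ s, ∃ η, s ∈ ν.supp → Run (Observe .tick) s η := by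
          intro s
          by_cases hs : s ∈ ν.supp
          · obtain ⟨η, hη⟩ := ih _ (hν.rank_lt hs) s rfl
            exact ⟨η, fun _ => hη⟩
          · exact ⟨ν, fun hs' => absurd hs' hs⟩
        choose k hk using ih'
        exact ⟨_, .step hν hk⟩
  · exact ⟨_, .base (Or.inr ⟨fun h => absurd h hα, rfl⟩)⟩

theorem run_observe_dead_of_not_inInv (α : Act g) {N : CPS g} (hN : ¬ N.InInv) :
    Run (Observe α) N (.dirac Dead) := by
  have hd : Run (Observe α) Dead (.dirac Dead) := .base (Or.inr ⟨fun _ => rfl, rfl⟩)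
  by_cases h : N = Dead
  · rw [h]; exact hd
  · have := Run.step (B := Observe α) (k := fun _ => .dirac Dead) (step_dead_of_not_inInv hN h)
      fun s hs => by rw [FDist.mem_supp_dirac.1 hs]; exact hd
    rwa [FDist.bind_const] at this

theorem exists_run_limit {B PB : CPS g → FDist (CPS g) → Prop} (hfin : ∀ M, {e | PB M e}.Finite)
    (h1 : ∀ M e, B M e → e ∈ Mixtures {e | PB M e}) (h2 : ∀ M e, PB M e → B M e) {N : CPS g}
    {γ : FDist (CPS g)} {c : ℝ}
    (h : ∀ n, ∀ c' > c, ∃ η, Run B N η ∧ Coupled (nWeakBisimilarityMetric g n) c' γ η) :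
    ∃ η, Run B N η ∧ Coupled (limitMetric g) c γ η := by
  obtain ⟨η, h3, h4⟩ := exists_coupled_limit (PureRun.finite hfin N) (γ := γ)
    (d := nWeakBisimilarityMetric g) nWeakBisimilarityMetric_mono (D := limitMetric g) (c := c)
    (fun x y => (continuous_subtype_val.tendsto _).comp (tendsto_limitMetric x y))
    (fun n c' hc' => by
      obtain ⟨η, h3, h4⟩ := h n c' hc'
      exact ⟨η, h3.mem_mixtures h1, h4⟩)
  exact ⟨η, run_of_mem_mixtures h2 h3, h4⟩

/-- For each `n`, weak transitions give answers of `𝐝ⁿ`-cost arbitrarily close to the limit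
distance; compactness turns them into a single answer with exactly that bound. -/
theorem limitMetric_tau {M N : CPS g} {γ : FDist (CPS g)} (h : Step M .tau γ) :
    ∃ η, TauRun N η ∧ Coupled (limitMetric g) (limitMetric g M N) γ η := by
  by_cases h1 : limitMetric g M N < 1
  · refine exists_run_limit (PB := fun N η => η = .dirac N) finite_dirac
      (fun M e he => mem_mixtures_of_mem he) (fun M e he => he) fun n c hc => ?_
    obtain ⟨γ', h2, h3⟩ := exists_weakStep_of_limitMetric_lt h h1 n hc
    exact ⟨_, WeakTau.tauRun h2, h3⟩
  · exact ⟨_, TauRun.refl N, coupled_of_not_lt_one h1 _ _⟩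

theorem eq_one_of_one_le {c : unitInterval} (h : (1 : ℝ) ≤ c) : c = 1 :=
  le_antisymm le_top h

/-- A stable system within its invariant ticks, which `Dead` cannot match. Otherwise a
`τ`-transition leads to systems of smaller rank, still within the invariant, and `Dead` can only
stay. -/
theorem limitMetric_dead {M : CPS g} (hM : M.InInv) : limitMetric g M Dead = 1 := by
  induction hn : M.rank using Nat.strong_induction_on generalizing M with
  | _ n ih =>
    subst hn
    by_cases hs : M.Stable
    · obtain ⟨γ, hγ⟩ := hs.exists_tick hM
      by_contra hne
      have h1 : limitMetric g M Dead < 1 := lt_of_le_of_ne le_top hne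
      obtain ⟨γ', h2, -⟩ := exists_weakStep_of_limitMetric_lt hγ h1 0
        (Subtype.coe_lt_coe.2 h1)
      exact not_weakStep_dead (by simp) h2
    · simp only [CPS.Stable, not_forall, not_not] at hs
      obtain ⟨ν, hν⟩ := hs
      obtain ⟨η, h1, h2⟩ := limitMetric_tau (N := Dead) hν
      refine eq_one_of_one_le (h2.one_le fun x hx y hy => ?_)
      rw [h1.eq_dirac stable_dead] at hy
      rw [FDist.mem_supp_dirac.1 hy]
      exact ih _ (hν.rank_lt hx) (hν.inInv_of_ne_tick (by simp) hM hx) rfl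

/-- If `N` is not already `Dead` it deadlocks by `τ`, and `M` can answer only by runs that keep its
invariant, all at distance `1` from `Dead`. -/
theorem limitMetric_of_not_inInv {M N : CPS g} (hM : M.InInv) (hN : ¬ N.InInv) :
    limitMetric g M N = 1 := by
  by_cases hd : N = Dead
  · rw [hd]; exact limitMetric_dead hM
  · obtain ⟨η, h1, h2⟩ := limitMetric_tau (N := M) (step_dead_of_not_inInv hN hd)
    rw [limitMetric_comm]
    refine eq_one_of_one_le (h2.one_le fun x hx y hy => ?_)
    rw [FDist.mem_supp_dirac.1 hx, limitMetric_comm]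
    exact limitMetric_dead (h1.inInv hM y hy)

theorem inInv_of_limitMetric_lt {M N : CPS g} (hM : M.InInv) (h : limitMetric g M N < 1) :
    N.InInv := by
  by_contra hN
  exact absurd (limitMetric_of_not_inInv hM hN) h.ne

theorem limitMetric_observe_of_imp {α : Act g} (hα : α ≠ .tau) {M N : CPS g}
    {γ : FDist (CPS g)} (h : Step M α γ)
    (hN : ∀ η, Run (PerformOrStuck α) N η → Run (Observe α) N η) :
    ∃ η, Run (Observe α) N η ∧ Coupled (limitMetric g) (limitMetric g M N) γ η := by
  by_cases h1 : limitMetric g M N < 1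
  · refine exists_run_limit (PureObserve.finite α) (fun M e he => he.mem_mixtures)
      (fun M e he => he.observe) fun n c hc => ?_
    obtain ⟨γ', h2, h3⟩ := exists_weakStep_of_limitMetric_lt h h1 n hc
    exact ⟨_, hN _ (h2.run hα), h3⟩
  · obtain ⟨η, hη⟩ := exists_run_observe α N
    exact ⟨η, hη, coupled_of_not_lt_one h1 _ _⟩

/-- A weak `tick` drops mass also in unstable systems, which `Observe` forbids, so `N` is first
driven to stability along any `τ`-transition `ν`. Since `M` ticks it is stable and matches `N → ν`
only by staying; hence the `ν`-average of the distances to `M` is at most the distance of `M` and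
`N`, and induction on the rank applies. In a stable system, being stuck means being `Dead`. -/
theorem limitMetric_tick {M N : CPS g} {γ : FDist (CPS g)} (h : Step M .tick γ) :
    ∃ η, Run (Observe .tick) N η ∧ Coupled (limitMetric g) (limitMetric g M N) γ η := by
  induction hn : N.rank using Nat.strong_induction_on generalizing N with
  | _ n ih =>
    subst hn
    by_cases hN : N.Stable
    · refine limitMetric_observe_of_imp (by simp) h fun η => Run.mono_of_stable hN fun e he => ?_
      rcases he with he | ⟨he, rfl⟩
      · exact Or.inl he
      · exact Or.inr ⟨fun _ => hN.eq_dead fun hi => he (hN.exists_tick hi), rfl⟩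
    · simp only [CPS.Stable, not_forall, not_not] at hN
      obtain ⟨ν, hν⟩ := hN
      obtain ⟨η, h1, h2⟩ := limitMetric_tau (N := M) hν
      rw [h1.eq_dirac h.stable_of_tick] at h2
      have ih' : ∀ s, ∃ η, s ∈ ν.supp → Run (Observe .tick) s η ∧
          Coupled (limitMetric g) (limitMetric g M s) γ η := by
        intro s
        by_cases hs : s ∈ ν.supp
        · obtain ⟨η, hη⟩ := ih _ (hν.rank_lt hs) rfl
          exact ⟨η, fun _ => hη⟩
        · exact ⟨ν, fun hs' => absurd hs' hs⟩
      choose k hk using ih'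
      refine ⟨_, .step hν fun s hs => (hk s hs).1, ?_⟩
      have h3 := Coupled.bind fun s hs => (hk s hs).2
      rw [FDist.bind_const] at h3
      refine h3.mono ?_
      rw [limitMetric_comm M N]
      refine le_of_eq_of_le (FDist.ex_congr fun s _ => ?_) h2.ex_le_of_dirac
      rw [limitMetric_comm]

theorem limitMetric_observe {α : Act g} (hα : α ≠ .tau) {M N : CPS g} {γ : FDist (CPS g)}
    (h : Step M α γ) :
    ∃ η, Run (Observe α) N η ∧ Coupled (limitMetric g) (limitMetric g M N) γ η := by
  by_cases ht : α = .tick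
  · subst ht
    exact limitMetric_tick h
  · refine limitMetric_observe_of_imp hα h fun η => Run.mono fun N e he => ?_
    rcases he with he | ⟨-, rfl⟩
    · exact Or.inl he
    · exact Or.inr ⟨fun h => absurd h ht, rfl⟩

/-- Answer separately for each pair in the support of the matching, then merge the answers that
start from the same `t`. The total cost is that of the matching. -/
theorem Coupled.exists_bind {B : CPS g → FDist (CPS g) → Prop}
    {d : CPS g → CPS g → unitInterval} {c : ℝ} {γ η : FDist (CPS g)} (h : Coupled d c γ η)
    {k : CPS g → FDist (CPS g)}
    (hk : ∀ s ∈ γ.supp, ∀ t, ∃ θ, Run B t θ ∧ Coupled d (d s t) (k s) θ) :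
    ∃ l : CPS g → FDist (CPS g), (∀ t ∈ η.supp, Run B t (l t)) ∧
      Coupled d c (γ.bind k) (η.bind l) := by
  obtain ⟨ω, rfl, rfl, h3⟩ := h
  have h' : ∀ p : CPS g × CPS g, ∃ θ, p ∈ ω.supp → Run B p.2 θ ∧
      Coupled d (d p.1 p.2) (k p.1) θ := by
    intro p
    by_cases hp : p ∈ ω.supp
    · obtain ⟨θ, hθ⟩ := hk p.1 (FDist.mem_supp_map.2 ⟨p, hp, rfl⟩) p.2
      exact ⟨θ, fun _ => hθ⟩
    · exact ⟨k p.1, fun hp' => absurd hp' hp⟩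
  choose θ hθ using h'
  obtain ⟨l, hl, hl'⟩ := Run.exists_kernel fun p hp => (hθ p hp).1
  refine ⟨l, hl, ?_⟩
  rw [← hl', FDist.bind_map]
  exact (Coupled.bind fun p hp => (hθ p hp).2).mono h3

/-- Transfer of transitions extends to runs, once it holds for basic outcomes. -/
theorem Run.transfer {B : CPS g → FDist (CPS g) → Prop}
    (hB : ∀ R e, B R e → ∀ N, ∃ η, Run B N η ∧ Coupled (limitMetric g) (limitMetric g R N) e η)
    {R : CPS g} {e : FDist (CPS g)} (h : Run B R e) (N : CPS g) :
    ∃ η, Run B N η ∧ Coupled (limitMetric g) (limitMetric g R N) e η := by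
  induction h generalizing N with
  | base h => exact hB _ _ h N
  | step h _ ih =>
    obtain ⟨η, h1, h2⟩ := limitMetric_tau (N := N) h
    obtain ⟨l, hl, hl'⟩ := h2.exists_bind ih
    exact ⟨_, h1.comp hl, hl'⟩
  | @mix R ρ _ ih =>
    have ih' : ∀ e, ∃ η, e ∈ ρ.supp → Run B N η ∧
        Coupled (limitMetric g) (limitMetric g R N) e η := by
      intro e
      by_cases he : e ∈ ρ.supp
      · obtain ⟨η, hη⟩ := ih e he N
        exact ⟨η, fun _ => hη⟩
      · exact ⟨e, fun he' => absurd he' he⟩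
    choose k hk using ih'
    refine ⟨_, Run.bind_family fun e he => (hk e he).1, ?_⟩
    have := Coupled.bind (γ := id) fun e he => (hk e he).2
    rwa [FDist.ex_const] at this

theorem TauRun.transfer {R : CPS g} {e : FDist (CPS g)} (h : TauRun R e) (N : CPS g) :
    ∃ η, TauRun N η ∧ Coupled (limitMetric g) (limitMetric g R N) e η := by
  refine Run.transfer ?_ h N
  rintro R _ rfl N
  exact ⟨_, TauRun.refl N, coupled_dirac _ _ _⟩

theorem transfer_observe {α : Act g} (hα : α ≠ .tau) {R : CPS g} {e : FDist (CPS g)}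
    (h : Run (Observe α) R e) (N : CPS g) :
    ∃ η, Run (Observe α) N η ∧ Coupled (limitMetric g) (limitMetric g R N) e η := by
  refine Run.transfer ?_ h N
  rintro R e (⟨γ, k, h1, h2, rfl⟩ | ⟨h1, rfl⟩) N
  · obtain ⟨η, h3, h4⟩ := limitMetric_observe (N := N) hα h1
    obtain ⟨l, hl, hl'⟩ := h4.exists_bind fun s hs t => (h2 s hs).transfer t
    exact ⟨_, h3.bind_right (fun M e he => he.bind) hl, hl'⟩
  -- Here `R` drops its mass. For `tick` this forces `R = Dead`: a partner within its invariant is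
  -- at distance `1`, any other one runs to `Dead`. For a communication the partner may drop its
  -- mass as well.
  · by_cases hN : α = .tick ∧ N.InInv
    · obtain ⟨η, hη⟩ := exists_run_observe α N
      refine ⟨η, hη, coupled_of_one_le ?_ _ _⟩
      rw [h1 hN.1, limitMetric_comm, limitMetric_dead hN.2]
      exact le_rfl
    · refine ⟨.dirac Dead, ?_, (coupled_dirac _ _ _).mono ?_⟩
      · by_cases hi : N.InInv
        · exact .base (Or.inr ⟨fun h => absurd ⟨h, hi⟩ hN, rfl⟩)
        · exact run_observe_dead_of_not_inInv α hi
      · rw [limitMetric_self]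
        exact (limitMetric g R N).2.1

/-- If the distance of live systems from the dead one is maximal, nothing is gained by dropping
probability mass. -/
theorem exists_weakStep_of_run {d : CPS g → CPS g → unitInterval}
    (hd : ∀ x : CPS g, x.InInv → d x Dead = 1) {α : Act g} (hα : α ≠ .tau) {M N : CPS g}
    {γ η : FDist (CPS g)} (h : Step M α γ) (hη : Run (Observe α) N η) {c : ℝ}
    (hc : Coupled d c γ η) (hc1 : c < 1) (hN : α = .tick → N.InInv) :
    ∃ γ' : SubDist (CPS g), WeakStep N α γ' ∧ Coupled d c γ (γ'.complete Dead) := by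
  classical
  obtain ⟨ρ, h1, h2, rfl⟩ := hη.exists_tauRun
  obtain ⟨x, c', rfl, hcc, hx⟩ := hc.split
  -- Dropped mass sits at `Dead`, while a communication of `M` keeps the invariant, so the matching
  -- pays at least `1` there. For `tick` nothing is dropped, as `N` stays within its invariant and
  -- never reaches `Dead` by `τ`.
  have hbad : ∀ i ∈ ρ.supp, ¬ Perform α i.1 i.2 → 1 ≤ c' i := by
    intro i hi hni
    obtain ⟨ht, he⟩ := (h2 i hi).resolve_left hni
    have hαt : α ≠ .tick := fun hαt => by
      have := h1.inInv (hN hαt) i.1 (FDist.mem_supp_map.2 ⟨i, hi, rfl⟩)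
      rw [ht hαt] at this
      exact not_inInv_dead this
    refine (hx i hi).one_le fun y hy z hz => ?_
    rw [he] at hz
    rw [FDist.mem_supp_dirac.1 hz]
    exact hd y (h.inInv_of_ne_tick hαt (h.inInv hα) (FDist.mem_supp_bind.2 ⟨i, hi, hy⟩))
  -- A component that dropped its mass although it could perform `α` is now made to perform it;
  -- those unable to do so still drop it.
  let e : CPS g × FDist (CPS g) → FDist (CPS g) := fun i =>
    if hi : ¬ Perform α i.1 i.2 ∧ ∃ δ, Step i.1 α δ then hi.2.choose else i.2
  have heP : ∀ i, Perform α i.1 i.2 → e i = i.2 := fun i hi => dif_neg fun h => h.1 hi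
  have he : ∀ i ∈ ρ.supp, PerformOrStuck α i.1 (e i) := by
    intro i hi
    by_cases hP : Perform α i.1 i.2
    · rw [heP i hP]; exact Or.inl hP
    · by_cases hS : ∃ δ, Step i.1 α δ
      · have : e i = hS.choose := dif_pos ⟨hP, hS⟩
        rw [this]
        exact Or.inl ⟨_, .dirac, hS.choose_spec, fun s _ => TauRun.refl s,
          (FDist.bind_dirac _).symm⟩
      · have : e i = i.2 := dif_neg fun h => hS h.2
        rw [this]
        exact Or.inr ⟨hS, ((h2 i hi).resolve_left hP).2⟩
  -- If nothing performed `α`, each component would cost at least `1`, against `c < 1`.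
  have hne : ∃ i ∈ ρ.supp, Perform α i.1 (e i) := by
    by_contra! hno
    refine absurd (hcc.trans_lt hc1) (not_lt_of_ge ?_)
    rw [← FDist.ex_const ρ 1]
    refine FDist.ex_mono fun i hi => hbad i hi fun hP => hno i hi ?_
    rwa [heP i hP]
  obtain ⟨γ', h3, h4⟩ := CPC.exists_weakStep hα h1 he hne
  refine ⟨γ', h3, ?_⟩
  rw [h4]
  refine (Coupled.bind fun i hi => ?_).mono hcc
  by_cases hP : Perform α i.1 i.2
  · rw [heP i hP]; exact hx i hi
  · exact coupled_of_one_le (hbad i hi hP) _ _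

/-! ## The limit is a weak bisimulation metric -/

/-- The sum, truncated at `1`. -/
def truncAdd (a b : unitInterval) : unitInterval :=
  ⟨min 1 (a + b), le_min zero_le_one (add_nonneg a.2.1 b.2.1), min_le_left _ _⟩

/-- The infimum over the two-step paths for `limitMetric`. -/
def pathMetric (g : Signature.{u}) (M N : CPS g) : unitInterval :=
  ⨅ R, truncAdd (limitMetric g M R) (limitMetric g R N)

theorem pathMetric_le (M N R : CPS g) :
    (pathMetric g M N : ℝ) ≤ limitMetric g M R + limitMetric g R N := by
  have h : pathMetric g M N ≤ truncAdd (limitMetric g M R) (limitMetric g R N) :=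
    iInf_le _ R
  exact (Subtype.coe_le_coe.2 h).trans (min_le_right _ _)

theorem pathMetric_comm (M N : CPS g) : pathMetric g M N = pathMetric g N M := by
  refine iInf_congr fun R => ?_
  rw [limitMetric_comm M R, limitMetric_comm R N]
  exact Subtype.ext (congrArg (min 1) (add_comm _ _))

/-- The intermediate system either satisfies its invariant, and is far from `Dead`, or does not, and
is far from `M`. -/
theorem pathMetric_dead {M : CPS g} (hM : M.InInv) : pathMetric g M Dead = 1 := by
  refine le_antisymm le_top (le_iInf fun R => Subtype.coe_le_coe.1 (le_min le_rfl ?_))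
  by_cases hR : R.InInv
  · rw [limitMetric_dead hR]
    exact le_add_of_nonneg_left (limitMetric g M R).2.1
  · rw [limitMetric_of_not_inInv hM hR]
    exact le_add_of_nonneg_right (limitMetric g R Dead).2.1

/-- A transition of `M` is matched by a run of the intermediate `R`, and this run by one of `N`;
gluing the two matchings adds their costs. Transfer of whole runs, not just of single transitions,
is needed for the second match. -/
theorem bisimFunctional_pathMetric_le : bisimFunctional (pathMetric g) ≤ pathMetric g := by
  refine bisimFunctional_le_self pathMetric_comm ?_
  intro M N α γ h c hc hc1
  obtain ⟨R, hR⟩ := iInf_lt_iff.1 hc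
  have hR : (limitMetric g M R : ℝ) + limitMetric g R N < c :=
    (min_lt_iff.1 (Subtype.coe_lt_coe.2 hR)).resolve_left
      (not_lt_of_ge (Subtype.coe_le_coe.2 hc1.le))
  by_cases hα : α = .tau
  · subst hα
    obtain ⟨ηR, h1, h2⟩ := limitMetric_tau (N := R) h
    obtain ⟨ηN, h3, h4⟩ := h1.transfer N
    refine ⟨ηN.toSubDist, h3.weakStep, ?_⟩
    rw [FDist.complete_toSubDist]
    exact (h2.trans h4 fun x y z => pathMetric_le x z y).mono hR.le
  · obtain ⟨ηR, h1, h2⟩ := limitMetric_observe (N := R) hα h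
    obtain ⟨ηN, h3, h4⟩ := transfer_observe hα h1 N
    refine exists_weakStep_of_run (fun _ => pathMetric_dead) hα h h3
      ((h2.trans h4 fun x y z => pathMetric_le x z y).mono hR.le) hc1 fun _ => ?_
    have hlt := hR.trans (Subtype.coe_lt_coe.2 hc1)
    have hMR : limitMetric g M R < 1 := Subtype.coe_lt_coe.1
      ((le_add_of_nonneg_right (limitMetric g R N).2.1).trans_lt hlt)
    have hRN : limitMetric g R N < 1 := Subtype.coe_lt_coe.1
      ((le_add_of_nonneg_left (limitMetric g M R).2.1).trans_lt hlt)
    exact inInv_of_limitMetric_lt (inInv_of_limitMetric_lt (h.inInv hα) hMR) hRN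

theorem isWeakBisimulationMetric_limitMetric : IsWeakBisimulationMetric (limitMetric g) where
  pseudometric :=
    { self := limitMetric_self
      symm := limitMetric_comm
      triangle := fun M N R => (Subtype.coe_le_coe.2
        (limitMetric_le bisimFunctional_pathMetric_le M N)).trans (pathMetric_le M N R) }
  transfer M N hMN α γ h := by
    by_cases hα : α = .tau
    · subst hα
      obtain ⟨η, h1, h2⟩ := limitMetric_tau (N := N) h
      refine ⟨η.toSubDist, h1.weakStep, ?_⟩
      rw [FDist.complete_toSubDist]
      exact h2.kantorovich_le
    · obtain ⟨η, h1, h2⟩ := limitMetric_observe (N := N) hα h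
      obtain ⟨γ', h3, h4⟩ := exists_weakStep_of_run (fun _ => limitMetric_dead) hα h h1 h2
        (Subtype.coe_lt_coe.2 hMN) fun _ => inInv_of_limitMetric_lt (h.inInv hα) hMN
      exact ⟨γ', h3, h4.kantorovich_le⟩

theorem IsWeakBisimulationMetric.bisimFunctional_le {d : CPS g → CPS g → unitInterval}
    (hd : IsWeakBisimulationMetric d) : bisimFunctional d ≤ d := by
  refine bisimFunctional_le_self hd.pseudometric.symm fun M N α γ h c hc hc1 => ?_
  obtain ⟨γ', h1, h2⟩ := hd.transfer M N (hc.trans hc1) α γ h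
  exact ⟨γ', h1, coupled_of_kantorovich_lt (h2.trans_lt hc)⟩

theorem isLeast_limitMetric : IsLeast {d | IsWeakBisimulationMetric d} (limitMetric g) :=
  ⟨isWeakBisimulationMetric_limitMetric, fun _ hd => limitMetric_le hd.bisimFunctional_le⟩

theorem weakBisimilarityMetric_eq : weakBisimilarityMetric g = limitMetric g :=
  isLeast_limitMetric.isGLB.sInf_eq

end Transfer

end CPC

end

theorem mainTheorem5 (g : CPC.Signature) :
    IsLeast {d | CPC.IsWeakBisimulationMetric d} (CPC.weakBisimilarityMetric g) ∧
    ∀ M N : CPC.CPS g,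
      Tendsto (fun n => CPC.nWeakBisimilarityMetric g n M N) atTop
        (𝓝 (CPC.weakBisimilarityMetric g M N)) := by
  rw [CPC.weakBisimilarityMetric_eq]
  exact ⟨CPC.isLeast_limitMetric, CPC.tendsto_limitMetric⟩
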